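/- Setting. Fix integers $k,k^\star\ge 1$, constants $R,K>0$, and a function $K_r:[0,\infty)\to(0,\infty)$. For every $p$ let $S_p\subseteq\{\theta\in\mathbb R^p:\|\theta\|_2\le R\}$ be a symmetric convex set, $C_p\subseteq S_p$ a nonempty compact set, $\Theta^\star=(\theta_1^\star,\dots,\theta^\star_{k^\star})\in\mathbb R^{p\times k^\star}$ a matrix with all columns in $S_p$, $r=r_p:\mathbb R^{p\times k}\to\mathbb R$ a regularizer, $\mathbb P_x$ a probability law on $\mathbb R^p$ and $\Sigma_g\in\mathbb R^{p\times p}$ a positive semidefinite matrix; let $\mathbb P_\varepsilon$ be a probability law on $\mathbb R$. Write $\|Z\|_{\psi_2}=\inf\{t>0:\mathbb E e^{Z^2/t^2}\le 2\}$ for the subgaussian norm. Assume: 1. the loss $\ell:\mathbb R^{k+1}\to\mathbb R$ is nonnegative and $K$-Lipschitz, and the labeling function $\eta:\mathbb R^{k^\star+1}\to\mathbb R$ is $K$-Lipschitz; 2. $\|\varepsilon\|_{\psi_2}\le K$ for $\varepsilon\sim\mathbb P_\varepsilon$; 3. $|r(\Theta_0)-r(\Theta_1)|\le K_r(B)\|\Theta_0-\Theta_1\|_F$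 for all $p$, all $B>0$ and all $\Theta_0,\Theta_1\in\mathbb R^{p\times k}$ with Frobenius norm at most $B$; 4. for $x\sim\mathbb P_x$ and $g\sim N(0,\Sigma_g)$: $\|x^{\mathsf T}\theta\|_{\psi_2}\le K$ and $\|\Sigma_g^{1/2}\theta\|_2\le K$ for all $p$ and all $\theta\in S_p$ with $\|\theta\|_2\le1$; and $\lim_{p\to\infty}\sup_{\theta\in S_p}|\mathbb E\varphi(\theta^{\mathsf T}x)-\mathbb E\varphi(\theta^{\mathsf T}g)|=0$ for every bounded Lipschitz $\varphi:\mathbb R\to\mathbb R$. Let $p=p(n)$ with $p(n)/n\to\gamma\in(0,\infty)$. For each $n$ let $x_1,\dots,x_n$ be i.i.d. with law $\mathbb P_x$, $g_1,\dots,g_n$ i.i.d. $N(0,\Sigma_g)$, and $\varepsilon_1,\dots,\varepsilon_n$ i.i.d. with law $\mathbb P_\varepsilon$, independent of $X=(x_i)_{i\le n}$ and independent of $G=(g_i)_{i\le n}$. Let $C_p^k$ be the set of $\Theta\in\mathbb R^{p\times k}$ whose columns all lie in $C_p$. For $Z=(z_i)_{i\le n}\in\{X,G\}$ set $y_i(Z)=\eta(\Theta^{\star\mathsf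 T}z_i,\varepsilon_i)$, $$\widehat R_n(\Theta;Z)=\frac1n\sum_{i=1}^n\ell(\Theta^{\mathsf T}z_i;y_i(Z))+r(\Theta),\qquad \widehat R_n^\star(Z)=\min_{\Theta\in C_p^k}\widehat R_n(\Theta;Z),$$ and define the test errors $$R_n^x(\Theta)=\mathbb E\,\ell(\Theta^{\mathsf T}x;\eta(\Theta^{\star\mathsf T}x,\varepsilon)),\qquad R_n^g(\Theta)=\mathbb E\,\ell(\Theta^{\mathsf T}g;\eta(\Theta^{\star\mathsf T}g,\varepsilon)),$$ where $x\sim\mathbb P_x$, respectively $g\sim N(0,\Sigma_g)$, is independent of $\varepsilon\sim\mathbb P_\varepsilon$. Theorem. Suppose that one of the following conditions holds. (a) $\ell(u;y)$ is convex in $u$ for every $y$; there is $\mu>0$ such that $r$ is $\mu$-strongly convex (in Frobenius norm) for every $p$; $C_p$ is convex and $\|\Sigma_g^{1/2}\theta\|_2\le K\|\theta\|_2$ for all $\theta\in S_p$, for every $p$; and for some $\rho,\tilde\rho\in\mathbb R$, $\widehat R_n^\star(G)\to\rho$ and $R_n^g(\widehat\Theta_n^G)\to\tilde\rho$ in probability,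 where $\widehat\Theta_n^G$ is the (unique) minimizer of $\widehat R_n(\cdot;G)$ over $C_p^k$. (b) For some $\rho,\tilde\rho\in\mathbb R$, $\widehat R_n^\star(G)\to\rho$ in probability, and for every $\alpha>0$ there is $\delta>0$ such that $$\lim_{n\to\infty}\mathbb P\Big(\min_{\Theta\in C_p^k:\,|R_n^g(\Theta)-\tilde\rho|\ge\alpha}\big|\widehat R_n(\Theta;G)-\widehat R_n^\star(G)\big|\ge\delta\Big)=1$$ (a minimum over the empty set being $+\infty$). (c) There is a function $\rho(s)$, differentiable at $s=0$, such that for all $s$ in a neighborhood of $0$, $\min_{\Theta\in C_p^k}\{\widehat R_n(\Theta;G)+sR_n^g(\Theta)\}\to\rho(s)$ in probability. Then, for any minimizers $\widehat\Theta_n^X$ and $\widehat\Theta_n^G$ of $\widehat R_n(\cdot;X)$ and $\widehat R_n(\cdot;G)$ over $C_p^k$, $$\big|R_n^x(\widehat\Theta_n^X)-R_n^g(\widehat\Theta_n^G)\big|\to0\quad\text{in probability.}$$ -/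

import Mathlib

open MeasureTheory ProbabilityTheory Filter Topology
open scoped NNReal ENNReal RealInnerProductSpace MatrixOrder

noncomputable section

/-- The subgaussian (Orlicz) norm of a real random variable `X` on `(Ω, μ)`:
the infimum of all `t > 0` with `E exp (X ^ 2 / t ^ 2) ≤ 2` (it is `∞` if there is no such `t`). -/
def psi2Norm {Ω : Type*} [MeasurableSpace Ω] (μ : Measure Ω) (X : Ω → ℝ) : ℝ≥0∞ :=
  ⨅ (t : ℝ≥0) (_ : 0 < t)
    (_ : ∫⁻ ω, ENNReal.ofReal (Real.exp (X ω ^ 2 / (t : ℝ) ^ 2)) ∂μ ≤ 2), (t : ℝ≥0∞)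

/-- Feature space `ℝ^p` with its Euclidean norm. -/
abbrev Feat (p : ℕ) : Type := EuclideanSpace ℝ (Fin p)

/-- Parameter matrices `Θ = (θ_1, …, θ_k) ∈ ℝ^{p × k}`, stored through their columns
`θ_j = Θ j ∈ ℝ^p`. The norm of this type, `(∑ j, ‖θ_j‖ ^ 2) ^ (1 / 2)`, is the Frobenius norm. -/
abbrev Param (p k : ℕ) : Type := PiLp 2 (fun _ : Fin k => Feat p)

/-- The vector `Θᵀ x ∈ ℝ^k`, whose entries are the inner products of `x` with the columns. -/
def project {p k : ℕ} (Θ : Param p k) (x : Feat p) : EuclideanSpace ℝ (Fin k) :=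
  WithLp.toLp 2 (fun j => ⟪Θ j, x⟫)

/-- The objects that specify a sequence (in the dimension `p`) of empirical risk minimization
problems, together with the feature distribution and the covariance of its Gaussian equivalent. -/
structure ERMModel (k kstar : ℕ) where
  /-- the loss `ℓ : ℝ^{k+1} → ℝ` -/
  loss : WithLp 2 (EuclideanSpace ℝ (Fin k) × ℝ) → ℝ
  /-- the labeling function `η : ℝ^{kstar+1} → ℝ` -/
  label : WithLp 2 (EuclideanSpace ℝ (Fin kstar) × ℝ) → ℝ
  /-- the symmetric convex sets `S_p` -/
  S : (p : ℕ) → Set (Feat p)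
  /-- the constraint sets `C_p` for the columns of the parameter matrix -/
  C : (p : ℕ) → Set (Feat p)
  /-- the true parameters -/
  Θstar : (p : ℕ) → Param p kstar
  /-- the regularizer -/
  r : (p : ℕ) → Param p k → ℝ
  /-- the law of a feature vector `x ∈ ℝ^p` -/
  lawX : (p : ℕ) → Measure (Feat p)
  /-- the covariance matrix `Σ_g` of the Gaussian feature vectors -/
  Sig : (p : ℕ) → Matrix (Fin p) (Fin p) ℝ
  /-- the law of the noise variables -/
  lawE : Measure ℝ

namespace ERMModel

variable {k kstar : ℕ} (M : ERMModel k kstar)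

/-- The law `N(0, Σ_g)` of a Gaussian feature vector. -/
def lawG (p : ℕ) : Measure (Feat p) := multivariateGaussian 0 (M.Sig p)

/-- The linear map `θ ↦ Σ_g^{1/2} θ`. -/
def sqrtSig (p : ℕ) : Feat p →L[ℝ] Feat p :=
  Matrix.toEuclideanCLM (𝕜 := ℝ) (CFC.sqrt (M.Sig p))

/-- The value `ℓ(u; y)`. -/
def lossAt (u : EuclideanSpace ℝ (Fin k)) (y : ℝ) : ℝ := M.loss (WithLp.toLp 2 (u, y))

/-- The response `η(Θ⋆ᵀ x, e)` to the feature vector `x` and the noise `e`. -/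
def response {p : ℕ} (x : Feat p) (e : ℝ) : ℝ :=
  M.label (WithLp.toLp 2 (project (M.Θstar p) x, e))

/-- The feasible set `C_p^k`: all columns lie in `C_p`. -/
def feasible (p : ℕ) : Set (Param p k) := {Θ | ∀ j, Θ j ∈ M.C p}

/-- The regularized empirical risk of `Θ` for the features `x_1, …, x_n` and the responses
`y_i = η(Θ⋆ᵀ x_i, e_i)`. -/
def empRisk {p n : ℕ} (x : Fin n → Feat p) (e : Fin n → ℝ) (Θ : Param p k) : ℝ :=
  (1 / (n : ℝ)) * ∑ i, M.lossAt (project Θ (x i)) (M.response (x i) (e i)) + M.r p Θ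

/-- The minimum empirical risk over the feasible set. -/
def minRisk {p n : ℕ} (x : Fin n → Feat p) (e : Fin n → ℝ) : ℝ :=
  sInf (M.empRisk x e '' M.feasible p)

/-- `Θ` minimizes the empirical risk over the feasible set. -/
def IsERM {p n : ℕ} (x : Fin n → Feat p) (e : Fin n → ℝ) (Θ : Param p k) : Prop :=
  Θ ∈ M.feasible p ∧ IsMinOn (M.empRisk x e) (M.feasible p) Θ

/-- The test error of `Θ` when the feature vector has the law `μ` and is independent of the
noise. -/
def testError {p : ℕ} (μ : Measure (Feat p)) (Θ : Param p k) : ℝ :=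
  ∫ z, M.lossAt (project Θ z.1) (M.response z.1 z.2) ∂(μ.prod M.lawE)

/-- The test error `R^x` under the law of the features. -/
def testErrorX {p : ℕ} (Θ : Param p k) : ℝ := M.testError (M.lawX p) Θ

/-- The test error `R^g` under the law of the Gaussian features. -/
def testErrorG {p : ℕ} (Θ : Param p k) : ℝ := M.testError (M.lawG p) Θ

/-- The minimum over the feasible set of the empirical risk plus `s` times the Gaussian test
error. -/
def minPerturbedRisk {p n : ℕ} (s : ℝ) (x : Fin n → Feat p) (e : Fin n → ℝ) : ℝ :=
  sInf ((fun Θ => M.empRisk x e Θ + s * M.testErrorG Θ) '' M.feasible p)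

/-- The assumptions on the model, with constants `R`, `K` and a function `Kr`. -/
structure Assumptions (R : ℝ) (K : ℝ≥0) (Kr : ℝ → ℝ≥0) : Prop where
  R_pos : 0 < R
  K_pos : 0 < K
  /- the sets `S_p` -/
  S_convex : ∀ p, Convex ℝ (M.S p)
  S_symm : ∀ p, ∀ θ ∈ M.S p, -θ ∈ M.S p
  S_subset : ∀ p, M.S p ⊆ Metric.closedBall 0 R
  /- loss and labeling functions -/
  loss_nonneg : ∀ v, 0 ≤ M.loss v
  loss_lipschitz : LipschitzWith K M.loss
  label_lipschitz : LipschitzWith K M.label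
  /- constraint set -/
  C_nonempty : ∀ p, (M.C p).Nonempty
  C_compact : ∀ p, IsCompact (M.C p)
  C_subset : ∀ p, M.C p ⊆ M.S p
  /- true parameters -/
  Θstar_mem : ∀ p j, M.Θstar p j ∈ M.S p
  /- noise variables -/
  lawE_prob : IsProbabilityMeasure M.lawE
  lawE_subgaussian : psi2Norm M.lawE id ≤ K
  /- regularizer -/
  r_lipschitz : ∀ p, ∀ B : ℝ, 0 < B → LipschitzOnWith (Kr B) (M.r p) (Metric.closedBall 0 B)
  /- feature vectors -/
  lawX_prob : ∀ p, IsProbabilityMeasure (M.lawX p)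
  Sig_posSemidef : ∀ p, (M.Sig p).PosSemidef
  lawX_subgaussian : ∀ p, ∀ θ ∈ M.S p, ‖θ‖ ≤ 1 → psi2Norm (M.lawX p) (fun x => ⟪θ, x⟫) ≤ K
  Sig_bound : ∀ p, ∀ θ ∈ M.S p, ‖θ‖ ≤ 1 → ‖M.sqrtSig p θ‖ ≤ K
  gaussian_projections : ∀ φ : ℝ → ℝ, (∃ B, ∀ t, |φ t| ≤ B) → (∃ L, LipschitzWith L φ) →
    Tendsto (fun p : ℕ => ⨆ θ : M.S p,
      |∫ x, φ ⟪(θ : Feat p), x⟫ ∂(M.lawX p) - ∫ g, φ ⟪(θ : Feat p), g⟫ ∂(M.lawG p)|)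
      atTop (𝓝 0)

/-- Condition (a), for Gaussian features `g n`, noise `e n` and minimizers `ΘG n` (which are unique
under this condition). -/
def CondA {p : ℕ → ℕ} (K : ℝ≥0) {Ω : Type*} [MeasurableSpace Ω] (P : Measure Ω)
    (g : (n : ℕ) → Fin n → Ω → Feat (p n)) (e : (n : ℕ) → Fin n → Ω → ℝ)
    (ΘG : (n : ℕ) → Ω → Param (p n) k) : Prop :=
  (∀ y : ℝ, ConvexOn ℝ Set.univ (fun u => M.lossAt u y)) ∧
  (∃ m : ℝ, 0 < m ∧ ∀ q, StrongConvexOn Set.univ m (M.r q)) ∧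
  (∀ q, Convex ℝ (M.C q)) ∧
  (∀ q, ∀ θ ∈ M.S q, ‖M.sqrtSig q θ‖ ≤ K * ‖θ‖) ∧
  ∃ ρ ρ' : ℝ,
    TendstoInMeasure P (fun n ω => M.minRisk (fun i => g n i ω) (fun i => e n i ω))
      atTop (fun _ => ρ) ∧
    TendstoInMeasure P (fun n ω => M.testErrorG (ΘG n ω)) atTop (fun _ => ρ')

/-- Condition (b). The event says that the minimum of
`|empirical risk - minimum empirical risk|` over the compact set
`{Θ feasible : |R^g(Θ) - ρ'| ≥ α}` is at least `δ` (a minimum over the empty set being `+∞`). -/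
def CondB {p : ℕ → ℕ} {Ω : Type*} [MeasurableSpace Ω] (P : Measure Ω)
    (g : (n : ℕ) → Fin n → Ω → Feat (p n)) (e : (n : ℕ) → Fin n → Ω → ℝ) : Prop :=
  ∃ ρ ρ' : ℝ,
    TendstoInMeasure P (fun n ω => M.minRisk (fun i => g n i ω) (fun i => e n i ω))
      atTop (fun _ => ρ) ∧
    ∀ α : ℝ, 0 < α → ∃ δ : ℝ, 0 < δ ∧
      Tendsto (fun n => P {ω | ∀ Θ ∈ M.feasible (p n), α ≤ |M.testErrorG Θ - ρ'| →
          δ ≤ |M.empRisk (fun i => g n i ω) (fun i => e n i ω) Θ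
            - M.minRisk (fun i => g n i ω) (fun i => e n i ω)|})
        atTop (𝓝 1)

/-- Condition (c). -/
def CondC {p : ℕ → ℕ} {Ω : Type*} [MeasurableSpace Ω] (P : Measure Ω)
    (g : (n : ℕ) → Fin n → Ω → Feat (p n)) (e : (n : ℕ) → Fin n → Ω → ℝ) : Prop :=
  ∃ ρ : ℝ → ℝ, DifferentiableAt ℝ ρ 0 ∧ ∀ᶠ s in 𝓝 (0 : ℝ),
    TendstoInMeasure P
      (fun n ω => M.minPerturbedRisk s (fun i => g n i ω) (fun i => e n i ω))
      atTop (fun _ => ρ s)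

end ERMModel

/-- `z_1, …, z_n` are i.i.d. with law `μ`, `e_1, …, e_n` are i.i.d. with law `ν`, and the two
families are independent of each other. -/
structure IsSample {Ω : Type*} [MeasurableSpace Ω] (P : Measure Ω) {p n : ℕ}
    (μ : Measure (Feat p)) (ν : Measure ℝ) (z : Fin n → Ω → Feat p) (e : Fin n → Ω → ℝ) :
    Prop where
  law_feature : ∀ i, HasLaw (z i) μ P
  law_noise : ∀ i, HasLaw (e i) ν P
  indep_feature : iIndepFun z P
  indep_noise : iIndepFun e P
  indep : IndepFun (fun ω i => z i ω) (fun ω i => e i ω) P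

end

/-! The test error at a minimizer is not an optimum, but each condition pins it down through minima
of risks: over a constrained set of parameters, or with an extra penalty. It is therefore enough
that minima of the empirical loss plus a penalty `q` over a set `T` have asymptotically the same
smooth statistics under `X` and `G`, for all `T` inside `S_p^k` and all `q` uniformly Lipschitz for
the gauge of `S_p^k`. This is `exists_abs_integral_infRisk_sub_le`; only the law of each sample
enters, so the coupling of `X` and `G` is irrelevant.

The minimum is first replaced by a soft minimum over a finite net. The net is taken in the gauge of
`S_p^k`, because moments are controlled only in directions of `S_p`. Its size is exponential in `p`,
so with `p / n` bounded the entropy costs `O(1 / β)` (`exists_gauge_net`,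
`abs_infRisk_sub_softMin_le`); `exists_dominating` controls the discretization error.

For the soft minimum at fixed `β`, samples are exchanged one at a time. The other samples only tilt
the weights (`softMin_add`), so an exchange acts through `1 / n` times the soft minimum of the
losses of a single sample. In a Taylor expansion the second-order terms sum to `O(1 / n)`, and the
first-order ones are small once expected single-sample soft minima agree uniformly over all families
and weights (`exists_softMin_close`). Up to truncation, the soft minimum is a polynomial in its
partition function, and the `m`-th power of the latter is a mixture of Laplace functionals of `m`
replicas. Each such functional depends on boundedly many projections, whose laws are uniformly close
by tightness and Cramér–Wold (`uniform_gaussian_projections`).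

Conditions (a) and (b) say that parameters with a wrong Gaussian test error have a strictly larger
risk (`WellSeparated`), which is a statement about a constrained minimum and thus transfers. Under
(c) the perturbed minima transfer, and difference quotients at `s` and `-s` enclose the test error
of either minimizer (`tendstoInProb_deriv_of_perturbation`). Finally the two test errors are
uniformly close on `S_p^k` (`exists_testError_close`). -/

/-! ### Exponential moments of subgaussian and Gaussian projections -/

/-- `f` has an exponential moment of order `c`, bounded by `6`. -/
def ExpBound {E : Type*} [MeasurableSpace E] (c : ℝ) (μ : Measure E) (f : E → ℝ) : Prop :=
  AEMeasurable f μ ∧ Integrable (fun x => Real.exp (c * |f x|)) μ ∧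
    ∫ x, Real.exp (c * |f x|) ∂μ ≤ 6

theorem ExpBound.mono {E : Type*} [MeasurableSpace E] {c c' : ℝ} {μ : Measure E} {f g : E → ℝ}
    (h : ExpBound c μ f) (hg : AEMeasurable g μ) (hle : ∀ x, c' * |g x| ≤ c * |f x|) :
    ExpBound c' μ g := by
  have hle' : ∀ x, Real.exp (c' * |g x|) ≤ Real.exp (c * |f x|) :=
    fun x => Real.exp_le_exp.2 (hle x)
  have hi : Integrable (fun x => Real.exp (c' * |g x|)) μ := by
    refine h.2.1.mono' ?_ (ae_of_all _ fun x => ?_)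
    · exact (Real.measurable_exp.comp_aemeasurable
        ((hg.norm).const_mul c')).aestronglyMeasurable
    · rw [Real.norm_of_nonneg (Real.exp_pos _).le]; exact hle' x
  exact ⟨hg, hi, (integral_mono hi h.2.1 hle').trans h.2.2⟩

theorem ExpBound.sq {E : Type*} [MeasurableSpace E] {c : ℝ} (hc : 0 < c) {μ : Measure E}
    {f : E → ℝ} (h : ExpBound c μ f) :
    Integrable (fun x => f x ^ 2) μ ∧ ∫ x, f x ^ 2 ∂μ ≤ 12 / c ^ 2 := by
  have hle : ∀ x, f x ^ 2 ≤ 2 / c ^ 2 * Real.exp (c * |f x|) := by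
    intro x
    have h1 := Real.quadratic_le_exp_of_nonneg (x := c * |f x|) (by positivity)
    have h2 : (c * |f x|) ^ 2 = c ^ 2 * f x ^ 2 := by rw [mul_pow, sq_abs]
    have h3 : 0 ≤ c * |f x| := by positivity
    rw [div_mul_eq_mul_div, le_div_iff₀ (by positivity)]
    nlinarith
  have hi : Integrable (fun x => f x ^ 2) μ := by
    refine (h.2.1.const_mul (2 / c ^ 2)).mono' ?_ (ae_of_all _ fun x => ?_)
    · exact (h.1.pow_const 2).aestronglyMeasurable
    · rw [Real.norm_of_nonneg (sq_nonneg _)]; exact hle x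
  refine ⟨hi, (integral_mono hi (h.2.1.const_mul _) hle).trans ?_⟩
  rw [integral_const_mul]
  calc 2 / c ^ 2 * ∫ x, Real.exp (c * |f x|) ∂μ ≤ 2 / c ^ 2 * 6 := by
        gcongr; exact h.2.2
    _ = 12 / c ^ 2 := by ring

theorem expBound_of_psi2Norm_le {E : Type*} [MeasurableSpace E] {μ : Measure E}
    {f : E → ℝ} (hf : Measurable f) {K : ℝ≥0} (hK : 0 < K) (h : psi2Norm μ f ≤ K) :
    ExpBound (1 / (2 * K)) μ f := by
  have hK' : (0 : ℝ) < K := hK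
  -- The infimum need not be attained; the factor `2` leaves room for an admissible `t < 2 * K`.
  have hlt : psi2Norm μ f < ((2 * K : ℝ≥0) : ℝ≥0∞) :=
    h.trans_lt (by rw [ENNReal.coe_lt_coe]; exact lt_mul_of_one_lt_left hK one_lt_two)
  simp only [psi2Norm, iInf_lt_iff] at hlt
  obtain ⟨t, ht, hint, htK⟩ := hlt
  have ht' : (0 : ℝ) < t := ht
  have htK' : (t : ℝ) < 2 * K := by
    have := ENNReal.coe_lt_coe.1 htK
    exact_mod_cast this
  have hm : Measurable fun ω => Real.exp (f ω ^ 2 / (t : ℝ) ^ 2) := by fun_prop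
  have hi : Integrable (fun ω => Real.exp (f ω ^ 2 / (t : ℝ) ^ 2)) μ := by
    refine ⟨hm.aestronglyMeasurable, ?_⟩
    rw [hasFiniteIntegral_iff_ofReal (ae_of_all _ fun _ => (Real.exp_pos _).le)]
    exact hint.trans_lt (by simp)
  have hint' : ∫ ω, Real.exp (f ω ^ 2 / (t : ℝ) ^ 2) ∂μ ≤ 2 := by
    rw [integral_eq_lintegral_of_nonneg_ae (ae_of_all _ fun _ => (Real.exp_pos _).le)
      hm.aestronglyMeasurable]
    exact ENNReal.toReal_le_of_le_ofReal (by norm_num) (by simpa using hint)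
  -- From `y ≤ 1 + y ^ 2` with `y = |f ω| / t`. The resulting bound is `2 * e < 6`.
  have hle : ∀ ω, Real.exp (1 / (2 * K) * |f ω|) ≤
      Real.exp 1 * Real.exp (f ω ^ 2 / (t : ℝ) ^ 2) := by
    intro ω
    rw [← Real.exp_add]
    apply Real.exp_le_exp.2
    have h1 : 1 / (2 * (K : ℝ)) * |f ω| ≤ |f ω| / t := by
      rw [one_div_mul_eq_div]; gcongr
    have h2 : f ω ^ 2 / (t : ℝ) ^ 2 = (|f ω| / t) ^ 2 := by rw [div_pow, sq_abs]
    rw [h2]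
    nlinarith [sq_nonneg (|f ω| / t - 1)]
  have hi2 : Integrable (fun x => Real.exp (1 / (2 * K) * |f x|)) μ := by
    refine (hi.const_mul (Real.exp 1)).mono' ?_ (ae_of_all _ fun x => ?_)
    · exact (by fun_prop : Measurable fun x => Real.exp (1 / (2 * K) * |f x|)).aestronglyMeasurable
    · rw [Real.norm_of_nonneg (Real.exp_pos _).le]; exact hle x
  refine ⟨hf.aemeasurable, hi2, (integral_mono hi2 (hi.const_mul _) hle).trans ?_⟩
  rw [integral_const_mul]
  have := Real.exp_one_lt_d9
  have hpos := Real.exp_pos 1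
  nlinarith

theorem expBound_gaussianReal {v : ℝ≥0} {c : ℝ} (hc : c ^ 2 * v ≤ 1) :
    ExpBound c (gaussianReal 0 v) id := by
  have h1 := integrable_exp_mul_gaussianReal (μ := 0) (v := v) c
  have h2 := integrable_exp_mul_gaussianReal (μ := 0) (v := v) (-c)
  have hmgf : ∀ t : ℝ, ∫ x, Real.exp (t * x) ∂(gaussianReal 0 v) = Real.exp (v * t ^ 2 / 2) := by
    intro t
    have := mgf_gaussianReal (p := gaussianReal 0 v) (X := id) (μ := 0) (v := v)
      (by simp) t
    simpa [mgf] using this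
  have hle : ∀ x : ℝ, Real.exp (c * |id x|) ≤ Real.exp (c * x) + Real.exp (-c * x) := by
    intro x
    rcases abs_cases x with ⟨h, _⟩ | ⟨h, _⟩
    · simp only [id, h]; linarith [Real.exp_pos (-c * x)]
    · simp only [id, h, mul_neg, neg_mul]; linarith [Real.exp_pos (c * x)]
  have hi : Integrable (fun x => Real.exp (c * |id x|)) (gaussianReal 0 v) := by
    refine (h1.add h2).mono' ?_ (ae_of_all _ fun x => ?_)
    · exact (by fun_prop : Measurable fun x : ℝ => Real.exp (c * |id x|)).aestronglyMeasurable
    · rw [Real.norm_of_nonneg (Real.exp_pos _).le]; exact hle x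
  refine ⟨measurable_id.aemeasurable, hi, (integral_mono hi (h1.add h2) hle).trans ?_⟩
  simp only [Pi.add_apply]
  rw [integral_add h1 h2, hmgf, hmgf, neg_sq]
  have h3 : Real.exp (v * c ^ 2 / 2) ≤ Real.exp 1 := by
    apply Real.exp_le_exp.2
    nlinarith [v.2, sq_nonneg c]
  have := Real.exp_one_lt_d9
  linarith

/-- Moving the self-adjoint square root onto `θ` leaves a linear functional of a standard Gaussian.
`CFC.sqrt` is nonnegative for every matrix, so no positivity of `Sg` is needed. -/
theorem map_inner_multivariateGaussian {p : ℕ} {Sg : Matrix (Fin p) (Fin p) ℝ} (θ : Feat p) :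
    (multivariateGaussian 0 Sg).map (fun x => ⟪θ, x⟫) =
      gaussianReal 0 (‖Matrix.toEuclideanCLM (𝕜 := ℝ) (CFC.sqrt Sg) θ‖₊ ^ 2) := by
  set L := Matrix.toEuclideanCLM (n := Fin p) (𝕜 := ℝ) (CFC.sqrt Sg) with hL
  have hsa : IsSelfAdjoint L := by
    have h1 : IsSelfAdjoint (CFC.sqrt Sg) := (CFC.sqrt_nonneg Sg).isSelfAdjoint
    exact h1.map _
  have hfun : ∀ x, ⟪θ, L x⟫ = ⟪L θ, x⟫ := by
    intro x
    have := ContinuousLinearMap.adjoint_inner_left L x θ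
    rw [← ContinuousLinearMap.star_eq_adjoint, hsa.star_eq] at this
    exact this.symm
  rw [multivariateGaussian, Measure.map_map (by fun_prop) (by fun_prop)]
  have hcomp : ((fun x : Feat p => ⟪θ, x⟫) ∘ fun x => 0 + L x) = innerSL ℝ (L θ) := by
    ext x; simp [hfun]
  rw [hcomp, IsGaussian.map_eq_gaussianReal, integral_strongDual_stdGaussian,
    variance_dual_stdGaussian]
  congr 1
  rw [innerSL_apply_norm]
  ext
  simp

namespace ERMModel

variable {k kstar : ℕ} {M : ERMModel k kstar} {R : ℝ} {K : ℝ≥0} {Kr : ℝ → ℝ≥0}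

theorem map_inner_lawG (p : ℕ) (θ : Feat p) :
    (M.lawG p).map (fun x => ⟪θ, x⟫) = gaussianReal 0 (‖M.sqrtSig p θ‖₊ ^ 2) :=
  map_inner_multivariateGaussian θ

instance (p : ℕ) : IsProbabilityMeasure (M.lawG p) := by
  unfold lawG; infer_instance

namespace Assumptions

theorem S_nonempty (hM : M.Assumptions R K Kr) (p : ℕ) : (M.S p).Nonempty :=
  (hM.C_nonempty p).mono (hM.C_subset p)

theorem zero_mem (hM : M.Assumptions R K Kr) (p : ℕ) : (0 : Feat p) ∈ M.S p := by
  obtain ⟨θ, hθ⟩ := hM.S_nonempty p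
  have := hM.S_convex p hθ (hM.S_symm p θ hθ) (a := 1/2) (b := 1/2) (by norm_num) (by norm_num)
    (by norm_num)
  simpa using this

theorem smul_mem (hM : M.Assumptions R K Kr) {p : ℕ} {θ : Feat p} (hθ : θ ∈ M.S p) {a : ℝ}
    (ha : |a| ≤ 1) : a • θ ∈ M.S p := by
  rcases le_total 0 a with h | h
  · have := hM.S_convex p hθ (hM.zero_mem p) h (sub_nonneg.2 (abs_of_nonneg h ▸ ha)) (by ring)
    simpa using this
  · rw [abs_of_nonpos h] at ha
    have := hM.S_convex p (hM.S_symm p θ hθ) (hM.zero_mem p) (neg_nonneg.2 h) (sub_nonneg.2 ha)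
      (by ring)
    simpa using this

/-- The common order of the exponential moments of the projections and of the noise. -/
noncomputable def rate (_ : M.Assumptions R K Kr) : ℝ := 1 / (2 * K * max 1 R)

theorem rate_pos (hM : M.Assumptions R K Kr) : 0 < hM.rate := by
  have : (0 : ℝ) < K := hM.K_pos
  unfold rate; positivity

/-- The moment assumptions concern only the unit ball. Dividing by `max 1 R` brings `θ` there
without leaving `S_p`, and the order of the moment drops by the same factor. -/
theorem expBound_of_unit (hM : M.Assumptions R K Kr) {p : ℕ} {θ : Feat p} (hθ : θ ∈ M.S p)
    {μ : Measure (Feat p)}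
    (h : ∀ θ ∈ M.S p, ‖θ‖ ≤ 1 → ExpBound (1 / (2 * (K : ℝ))) μ fun x => ⟪θ, x⟫) :
    ExpBound hM.rate μ fun x => ⟪θ, x⟫ := by
  have hr : (0 : ℝ) < max 1 R := by positivity
  have hn : ‖θ‖ ≤ max 1 R := by
    have := hM.S_subset p hθ
    rw [mem_closedBall_zero_iff] at this
    exact this.trans (le_max_right _ _)
  have h1 := h ((max 1 R)⁻¹ • θ)
    (hM.smul_mem hθ (by
      rw [abs_of_pos (by positivity)]; exact inv_le_one_of_one_le₀ (le_max_left _ _)))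
    (by
      rw [norm_smul, Real.norm_of_nonneg (by positivity), inv_mul_le_iff₀ hr]; simpa using hn)
  refine h1.mono (by fun_prop) fun x => le_of_eq ?_
  rw [real_inner_smul_left, abs_mul, abs_of_pos (a := (max 1 R)⁻¹) (by positivity), rate]
  have : (0 : ℝ) < K := hM.K_pos
  field_simp

theorem expBound_X (hM : M.Assumptions R K Kr) {p : ℕ} {θ : Feat p} (hθ : θ ∈ M.S p) :
    ExpBound hM.rate (M.lawX p) fun x => ⟪θ, x⟫ :=
  hM.expBound_of_unit hθ fun θ hθ hn =>
    expBound_of_psi2Norm_le (by fun_prop) hM.K_pos (hM.lawX_subgaussian p θ hθ hn)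

theorem expBound_G (hM : M.Assumptions R K Kr) {p : ℕ} {θ : Feat p} (hθ : θ ∈ M.S p) :
    ExpBound hM.rate (M.lawG p) fun x => ⟪θ, x⟫ := by
  refine hM.expBound_of_unit hθ fun θ hθ hn => ?_
  have hK : (0 : ℝ) < K := hM.K_pos
  have hb := hM.Sig_bound p θ hθ hn
  have h1 := expBound_gaussianReal (v := ‖M.sqrtSig p θ‖₊ ^ 2) (c := 1 / (2 * (K : ℝ))) (by
    push_cast
    rw [← mul_pow]
    apply pow_le_one₀ (by positivity)
    rw [one_div_mul_eq_div, div_le_one (by positivity)]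
    linarith)
  rw [← map_inner_lawG] at h1
  have hm : AEMeasurable (fun x : Feat p => ⟪θ, x⟫) (M.lawG p) := by fun_prop
  refine ⟨hm, ?_, ?_⟩
  · exact (integrable_map_measure h1.2.1.aestronglyMeasurable hm).1 h1.2.1
  · have := h1.2.2
    rwa [integral_map hm h1.2.1.aestronglyMeasurable] at this

theorem expBound_noise (hM : M.Assumptions R K Kr) : ExpBound hM.rate M.lawE id := by
  refine (expBound_of_psi2Norm_le measurable_id hM.K_pos hM.lawE_subgaussian).mono
    measurable_id.aemeasurable fun x => ?_
  have hK : (0 : ℝ) < K := hM.K_pos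
  unfold rate
  exact mul_le_mul_of_nonneg_right (one_div_le_one_div_of_le (by positivity)
    (le_mul_of_one_le_right (by positivity) (le_max_left _ _))) (abs_nonneg _)

end Assumptions

end ERMModel

/-! ### Uniform Gaussian approximation of several projections -/

/-- By symmetry the signs of the coefficients move into the vectors; what remains is a multiple of a
convex combination. This turns a linear combination of projections along `S` into a single
projection along `S`. -/
theorem exists_smul_eq_sum {E : Type*} [AddCommGroup E] [Module ℝ E] {S : Set E}
    (hconv : Convex ℝ S) (hsymm : ∀ θ ∈ S, -θ ∈ S) (h0 : (0 : E) ∈ S) {ι : Type*} [Fintype ι]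
    (t : ι → ℝ) (θ : ι → E) (hθ : ∀ i, θ i ∈ S) :
    ∃ s ∈ S, ∑ i, t i • θ i = (∑ i, |t i|) • s := by
  rcases eq_or_ne (∑ i, |t i|) 0 with hA | hA
  · refine ⟨0, h0, ?_⟩
    have : ∀ i, t i = 0 := fun i =>
      abs_eq_zero.1 ((Finset.sum_eq_zero_iff_of_nonneg fun j _ => abs_nonneg (t j)).1 hA i
        (Finset.mem_univ i))
    simp [this]
  · have hmem : ∀ i, (if 0 ≤ t i then θ i else -θ i) ∈ S := by
      intro i; split_ifs
      exacts [hθ i, hsymm _ (hθ i)]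
    have hpos : 0 ≤ ∑ i, |t i| := Finset.sum_nonneg fun i _ => abs_nonneg _
    refine ⟨∑ i, (|t i| / ∑ j, |t j|) • (if 0 ≤ t i then θ i else -θ i),
      hconv.sum_mem (fun i _ => by positivity) ?_ (fun i _ => hmem i), ?_⟩
    · rw [← Finset.sum_div, div_self hA]
    · rw [Finset.smul_sum]
      refine Finset.sum_congr rfl fun i _ => ?_
      rw [smul_smul, mul_div_cancel₀ _ hA]
      split_ifs with h
      · rw [abs_of_nonneg h]
      · rw [abs_of_neg (not_le.1 h)]; simp

/-- The vector of the inner products of `x` with a finite family of vectors. -/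
noncomputable def projVec {p : ℕ} {ι : Type*} [Fintype ι] (θ : ι → Feat p) (x : Feat p) :
    EuclideanSpace ℝ ι := WithLp.toLp 2 fun i => ⟪θ i, x⟫

@[fun_prop]
theorem continuous_projVec {p : ℕ} {ι : Type*} [Fintype ι] (θ : ι → Feat p) :
    Continuous (projVec θ) := by
  unfold projVec; fun_prop

theorem isTightMeasureSet_of_integral_norm_sq_le {E : Type*} [NormedAddCommGroup E]
    [ProperSpace E] [MeasurableSpace E] [BorelSpace E] {S : Set (Measure E)} {A : ℝ}
    (hS : ∀ μ ∈ S, Integrable (fun x => ‖x‖ ^ 2) μ ∧ ∫ x, ‖x‖ ^ 2 ∂μ ≤ A)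
    (hfin : ∀ μ ∈ S, IsProbabilityMeasure μ) :
    IsTightMeasureSet S := by
  apply isTightMeasureSet_of_tendsto_measure_norm_gt
  have hlim : Tendsto (fun r : ℝ => ENNReal.ofReal (A / r ^ 2)) atTop (𝓝 0) := by
    rw [← ENNReal.ofReal_zero]
    exact ENNReal.tendsto_ofReal (tendsto_const_nhds.div_atTop (tendsto_pow_atTop two_ne_zero))
  refine tendsto_of_tendsto_of_tendsto_of_le_of_le' tendsto_const_nhds hlim
    (Eventually.of_forall fun _ => zero_le) ?_
  filter_upwards [eventually_gt_atTop 0] with r hr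
  refine iSup₂_le fun μ hμ => ?_
  have := hfin μ hμ
  have h1 := mul_meas_ge_le_integral_of_nonneg (ae_of_all μ fun x => sq_nonneg ‖x‖) (hS μ hμ).1
    (r ^ 2)
  have h2 : μ {x | r < ‖x‖} ≤ μ {x | r ^ 2 ≤ ‖x‖ ^ 2} := by
    refine measure_mono fun x (hx : r < ‖x‖) => ?_
    simp only [Set.mem_ofPred_eq]; gcongr
  refine h2.trans ?_
  rw [← ENNReal.ofReal_toReal (measure_ne_top μ _)]
  apply ENNReal.ofReal_le_ofReal
  rw [le_div_iff₀ (by positivity), mul_comm]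
  exact h1.trans (hS μ hμ).2

namespace ERMModel.Assumptions

variable {k kstar : ℕ} {M : ERMModel k kstar} {R : ℝ} {K : ℝ≥0} {Kr : ℝ → ℝ≥0}

theorem abs_integral_sub_le_iSup (hM : M.Assumptions R K Kr) {φ : ℝ → ℝ} {B : ℝ}
    (hB : ∀ t, |φ t| ≤ B) {p : ℕ} {s : Feat p} (hs : s ∈ M.S p) :
    |∫ x, φ ⟪s, x⟫ ∂(M.lawX p) - ∫ g, φ ⟪s, g⟫ ∂(M.lawG p)| ≤ ⨆ θ : M.S p,
      |∫ x, φ ⟪(θ : Feat p), x⟫ ∂(M.lawX p) - ∫ g, φ ⟪(θ : Feat p), g⟫ ∂(M.lawG p)| := by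
  have := hM.lawX_prob p
  refine le_ciSup (f := fun θ : M.S p =>
    |∫ x, φ ⟪(θ : Feat p), x⟫ ∂(M.lawX p) - ∫ g, φ ⟪(θ : Feat p), g⟫ ∂(M.lawG p)|)
    ⟨B + B, ?_⟩ ⟨s, hs⟩
  rintro _ ⟨θ, rfl⟩
  have h1 := norm_integral_le_of_norm_le_const (μ := M.lawX p)
    (f := fun x => φ ⟪(θ : Feat p), x⟫) (ae_of_all _ fun x => hB _)
  have h2 := norm_integral_le_of_norm_le_const (μ := M.lawG p)
    (f := fun x => φ ⟪(θ : Feat p), x⟫) (ae_of_all _ fun x => hB _)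
  simp only [Measure.real, measure_univ, ENNReal.toReal_one, mul_one, Real.norm_eq_abs] at h1 h2
  exact (abs_sub _ _).trans (add_le_add h1 h2)

/-- The Cramér–Wold reduction. The combination in direction `t` is `A * ⟪s, x⟫` with `s ∈ S_p` and
`A` independent of `j`, so the one test function `u ↦ φ (A * u)` serves all dimensions. -/
theorem tendsto_integral_linear (hM : M.Assumptions R K Kr) {ι : Type*} [Fintype ι]
    {φ : ℝ → ℝ} (hφ : ∀ t, |φ t| ≤ 1) (hφL : LipschitzWith 1 φ) {q : ℕ → ℕ}
    (hq : Tendsto q atTop atTop) (θ : ∀ j, ι → Feat (q j)) (hθ : ∀ j i, θ j i ∈ M.S (q j))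
    (t : EuclideanSpace ℝ ι) :
    Tendsto (fun j => ∫ x, φ ⟪projVec (θ j) x, t⟫ ∂(M.lawX (q j)) -
      ∫ x, φ ⟪projVec (θ j) x, t⟫ ∂(M.lawG (q j))) atTop (𝓝 0) := by
  set A : ℝ≥0 := ∑ i, ‖t i‖₊ with hA
  have hA' : (A : ℝ) = ∑ i, |t i| := by simp [hA]
  have hlip : LipschitzWith A fun u => φ (A * u) := by
    have h1 : LipschitzWith A fun u : ℝ => (A : ℝ) * u := by
      apply LipschitzWith.of_dist_le_mul
      intro x y
      rw [Real.dist_eq, ← mul_sub, abs_mul, Real.dist_eq]; simp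
    have h2 := hφL.comp h1
    rwa [one_mul] at h2
  have hlim := (hM.gaussian_projections (fun u => φ (A * u)) ⟨1, fun u => hφ _⟩ ⟨A, hlip⟩).comp hq
  refine squeeze_zero_norm (fun j => ?_) hlim
  obtain ⟨s, hs, hsum⟩ := exists_smul_eq_sum (hM.S_convex (q j)) (hM.S_symm (q j))
    (hM.zero_mem (q j)) (fun i => t i) (θ j) (hθ j)
  have hin : ∀ x, ⟪projVec (θ j) x, t⟫ = A * ⟪s, x⟫ := by
    intro x
    rw [hA', ← real_inner_smul_left, ← hsum, sum_inner, PiLp.inner_apply]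
    refine Finset.sum_congr rfl fun i _ => ?_
    rw [real_inner_smul_left]
    simp [projVec]
  simp only [hin]
  exact hM.abs_integral_sub_le_iSup (φ := fun u => φ (A * u)) (fun u => hφ _) hs

theorem tight_projVec (hM : M.Assumptions R K Kr) {ι : Type*} [Fintype ι] {q : ℕ → ℕ}
    (θ : ∀ j, ι → Feat (q j)) (hθ : ∀ j i, θ j i ∈ M.S (q j)) (μ : ∀ p, Measure (Feat p))
    [∀ p, IsProbabilityMeasure (μ p)]
    (hμ : ∀ p, ∀ s ∈ M.S p, ExpBound hM.rate (μ p) fun x => ⟪s, x⟫) :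
    IsTightMeasureSet (Set.range fun j => (μ (q j)).map (projVec (θ j))) := by
  refine isTightMeasureSet_of_integral_norm_sq_le (A := Fintype.card ι * (12 / hM.rate ^ 2)) ?_ ?_
  · rintro _ ⟨j, rfl⟩
    have hm : AEMeasurable (projVec (θ j)) (μ (q j)) :=
      (continuous_projVec (θ j)).measurable.aemeasurable
    have hc : AEStronglyMeasurable (fun x : EuclideanSpace ℝ ι => ‖x‖ ^ 2)
        ((μ (q j)).map (projVec (θ j))) :=
      (by fun_prop : Continuous fun x : EuclideanSpace ℝ ι => ‖x‖ ^ 2).aestronglyMeasurable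
    have heq : ∀ x, ‖projVec (θ j) x‖ ^ 2 = ∑ i, ⟪θ j i, x⟫ ^ 2 := by
      intro x; rw [EuclideanSpace.real_norm_sq_eq]; rfl
    have hi : ∀ i, _ := fun i => (hμ (q j) (θ j i) (hθ j i)).sq hM.rate_pos
    constructor
    · rw [integrable_map_measure hc hm]
      refine (integrable_finsetSum Finset.univ fun i _ => (hi i).1).congr (ae_of_all _ fun x => ?_)
      exact (heq x).symm
    · rw [integral_map hm hc]
      simp only [heq]
      rw [integral_finsetSum _ fun i _ => (hi i).1]
      calc _ ≤ ∑ i : ι, 12 / hM.rate ^ 2 := Finset.sum_le_sum fun i _ => (hi i).2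
        _ = _ := by simp
  · rintro _ ⟨j, rfl⟩
    exact Measure.isProbabilityMeasure_map (continuous_projVec (θ j)).measurable.aemeasurable

/-- Uniform multivariate version of the Gaussian approximation of projections. -/
theorem uniform_gaussian_projections (hM : M.Assumptions R K Kr) {ι : Type*} [Fintype ι]
    (φ : BoundedContinuousFunction (EuclideanSpace ℝ ι) ℝ) {ε : ℝ} (hε : 0 < ε) :
    ∃ p₀, ∀ p, p₀ ≤ p → ∀ θ : ι → Feat p, (∀ i, θ i ∈ M.S p) →
      |∫ x, φ (projVec θ x) ∂(M.lawX p) - ∫ x, φ (projVec θ x) ∂(M.lawG p)| ≤ ε := by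
  -- Failure gives, for every lower bound, a larger dimension and a bad family `θ`: two tight
  -- sequences of projected laws whose integrals of `φ` stay apart.
  by_contra! hcon
  choose q hq θ hθ hbad using hcon
  have := hM.lawX_prob
  have hqt : Tendsto q atTop atTop := tendsto_atTop_mono hq tendsto_id
  have hm : ∀ j, Measurable (projVec (θ j)) := fun j => (continuous_projVec (θ j)).measurable
  let μ : ℕ → ProbabilityMeasure (EuclideanSpace ℝ ι) := fun j =>
    ⟨(M.lawX (q j)).map (projVec (θ j)), Measure.isProbabilityMeasure_map (hm j).aemeasurable⟩
  let ν : ℕ → ProbabilityMeasure (EuclideanSpace ℝ ι) := fun j =>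
    ⟨(M.lawG (q j)).map (projVec (θ j)), Measure.isProbabilityMeasure_map (hm j).aemeasurable⟩
  have hμt := hM.tight_projVec θ hθ M.lawX fun p s hs => hM.expBound_X hs
  have hνt := hM.tight_projVec θ hθ M.lawG fun p s hs => hM.expBound_G hs
  -- Prokhorov along one fixed ultrafilter gives both limits at once, without successive extraction
  -- of subsequences.
  have hlimit : ∀ (ξ : ℕ → ProbabilityMeasure (EuclideanSpace ℝ ι)),
      IsTightMeasureSet (Set.range fun j => (ξ j : Measure (EuclideanSpace ℝ ι))) →
      ∃ ξ₀, Tendsto ξ (hyperfilter ℕ : Filter ℕ) (𝓝 ξ₀) := by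
    intro ξ hξ
    have hc : IsCompact (closure (Set.range ξ)) := by
      apply isCompact_closure_of_isTightMeasureSet
      refine hξ.subset ?_
      rintro _ ⟨_, ⟨j, rfl⟩, rfl⟩
      exact ⟨j, rfl⟩
    obtain ⟨ξ₀, -, h⟩ := hc.ultrafilter_le_nhds ((hyperfilter ℕ).map ξ)
      (le_principal_iff.2 (mem_of_superset Filter.range_mem_map subset_closure))
    exact ⟨ξ₀, h⟩
  obtain ⟨μ₀, hμ₀⟩ := hlimit μ hμt
  obtain ⟨ν₀, hν₀⟩ := hlimit ν hνt
  rw [ProbabilityMeasure.tendsto_iff_forall_integral_tendsto] at hμ₀ hν₀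
  have hmapμ : ∀ j (f : BoundedContinuousFunction (EuclideanSpace ℝ ι) ℝ),
      ∫ y, f y ∂(μ j : Measure _) = ∫ x, f (projVec (θ j) x) ∂(M.lawX (q j)) := fun j f =>
    integral_map (hm j).aemeasurable f.continuous.aestronglyMeasurable
  have hmapν : ∀ j (f : BoundedContinuousFunction (EuclideanSpace ℝ ι) ℝ),
      ∫ y, f y ∂(ν j : Measure _) = ∫ x, f (projVec (θ j) x) ∂(M.lawG (q j)) := fun j f =>
    integral_map (hm j).aemeasurable f.continuous.aestronglyMeasurable
  have hle : (hyperfilter ℕ : Filter ℕ) ≤ atTop := Nat.hyperfilter_le_atTop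
  -- Used for cosine and sine: the limits then have equal characteristic functions and coincide.
  have htrig : ∀ (f : ℝ → ℝ), (∀ u, |f u| ≤ 1) → LipschitzWith 1 f →
      ∀ t : EuclideanSpace ℝ ι, ∫ y, f ⟪y, t⟫ ∂(μ₀ : Measure (EuclideanSpace ℝ ι)) =
        ∫ y, f ⟪y, t⟫ ∂(ν₀ : Measure (EuclideanSpace ℝ ι)) := by
    intro f hf hfL t
    have hfc := hfL.continuous
    let F : BoundedContinuousFunction (EuclideanSpace ℝ ι) ℝ :=
      BoundedContinuousFunction.ofNormedAddCommGroup (fun y => f ⟪y, t⟫) (by fun_prop) 1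
        fun y => hf _
    have h1 := (hμ₀ F).sub (hν₀ F)
    have h2 := (hM.tendsto_integral_linear hf hfL hqt θ hθ t).mono_left hle
    have h3 := tendsto_nhds_unique (h1.congr fun j => by rw [hmapμ, hmapν]; rfl) h2
    exact sub_eq_zero.1 h3
  have hEq : (μ₀ : Measure (EuclideanSpace ℝ ι)) = ν₀ := by
    apply Measure.ext_of_charFun
    ext t
    have hcf : ∀ ξ : ProbabilityMeasure (EuclideanSpace ℝ ι), charFun (ξ : Measure _) t =
        (∫ y, Real.cos ⟪y, t⟫ ∂(ξ : Measure _) : ℝ) +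
          (∫ y, Real.sin ⟪y, t⟫ ∂(ξ : Measure _) : ℝ) * Complex.I := by
      intro ξ
      rw [charFun_apply, ← integral_complex_ofReal, ← integral_complex_ofReal,
        ← integral_mul_const, ← integral_add]
      · refine integral_congr_ae (ae_of_all _ fun y => ?_)
        simp only [Complex.exp_mul_I, Complex.ofReal_cos, Complex.ofReal_sin]
      · refine Integrable.ofReal ((integrable_const (1 : ℝ)).mono' ?_ (ae_of_all _ fun y => ?_))
        · exact (by fun_prop : Continuous fun y : EuclideanSpace ℝ ι =>
            Real.cos ⟪y, t⟫).aestronglyMeasurable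
        · exact Real.abs_cos_le_one _
      · refine (Integrable.ofReal ((integrable_const (1 : ℝ)).mono' ?_
          (ae_of_all _ fun y => ?_))).mul_const _
        · exact (by fun_prop : Continuous fun y : EuclideanSpace ℝ ι =>
            Real.sin ⟪y, t⟫).aestronglyMeasurable
        · exact Real.abs_sin_le_one _
    rw [hcf, hcf, htrig _ Real.abs_cos_le_one Real.lipschitzWith_cos,
      htrig _ Real.abs_sin_le_one Real.lipschitzWith_sin]
  have hdiff := (hμ₀ φ).sub (hν₀ φ)
  rw [hEq, sub_self] at hdiff
  have hev := (hdiff.abs.eventually (gt_mem_nhds (by simpa using hε)))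
  obtain ⟨j, hj⟩ := hev.exists
  rw [hmapμ, hmapν] at hj
  exact absurd hj (not_lt.2 (hbad j).le)

end ERMModel.Assumptions

/-! ### Soft minima and their expectations -/

/-- The soft minimum `-β⁻¹ log ∑ π_i exp (-β d_i)` of `d` with weights `π`. -/
noncomputable def softMin {ι : Type*} [Fintype ι] (β : ℝ) (w d : ι → ℝ) : ℝ :=
  -(Real.log (∑ i, w i * Real.exp (-β * d i)) / β)

section softMin

variable {ι : Type*} [Fintype ι] {β : ℝ} {w d : ι → ℝ}

theorem partition_pos (hw : ∀ i, 0 ≤ w i) (hw1 : ∑ i, w i = 1) :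
    0 < ∑ i, w i * Real.exp (-β * d i) := by
  obtain ⟨i, -, hi⟩ := Finset.exists_ne_zero_of_sum_ne_zero (s := Finset.univ) (f := w)
    (by rw [hw1]; exact one_ne_zero)
  exact Finset.sum_pos' (fun j _ => mul_nonneg (hw j) (Real.exp_pos _).le)
    ⟨i, Finset.mem_univ i, mul_pos ((hw i).lt_of_ne' hi) (Real.exp_pos _)⟩

theorem partition_le_one (hβ : 0 ≤ β) (hw : ∀ i, 0 ≤ w i) (hw1 : ∑ i, w i = 1)
    (hd : ∀ i, 0 ≤ d i) : ∑ i, w i * Real.exp (-β * d i) ≤ 1 := by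
  rw [← hw1]
  refine Finset.sum_le_sum fun i _ => mul_le_of_le_one_right (hw i) (Real.exp_le_one_iff.2 ?_)
  nlinarith [hd i]

theorem softMin_nonneg (hβ : 0 < β) (hw : ∀ i, 0 ≤ w i) (hw1 : ∑ i, w i = 1)
    (hd : ∀ i, 0 ≤ d i) : 0 ≤ softMin β w d := by
  rw [softMin, ← neg_div]
  exact div_nonneg (neg_nonneg.2 (Real.log_nonpos (partition_pos hw hw1).le
    (partition_le_one hβ.le hw hw1 hd))) hβ.le

theorem softMin_le (hβ : 0 < β) (hw : ∀ i, 0 ≤ w i) (hw1 : ∑ i, w i = 1) :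
    softMin β w d ≤ ∑ i, w i * d i := by
  have h := strictConcaveOn_log_Ioi.concaveOn.le_map_sum (t := Finset.univ) (w := w)
    (p := fun i => Real.exp (-β * d i)) (fun i _ => hw i) hw1 (fun i _ => Real.exp_pos _)
  simp only [smul_eq_mul, Real.log_exp] at h
  rw [softMin, ← neg_div, div_le_iff₀ hβ, Finset.sum_mul]
  have : ∑ i, w i * (-β * d i) = -∑ i, w i * d i * β := by
    rw [← Finset.sum_neg_distrib]; exact Finset.sum_congr rfl fun i _ => by ring
  linarith

/-- The soft minimum lies between `0` and the weighted mean, and Jensen applies to the square. The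
bound on second moments is thus uniform in the weights, which vary with the sample in the
replacement argument. -/
theorem softMin_sq_le (hβ : 0 < β) (hw : ∀ i, 0 ≤ w i) (hw1 : ∑ i, w i = 1)
    (hd : ∀ i, 0 ≤ d i) : softMin β w d ^ 2 ≤ ∑ i, w i * d i ^ 2 := by
  have h := (convexOn_pow (𝕜 := ℝ) 2).map_sum_le (t := Finset.univ) (w := w) (p := d)
    (fun i _ => hw i) hw1 (fun i _ => hd i)
  simp only [smul_eq_mul] at h
  exact (pow_le_pow_left₀ (softMin_nonneg hβ hw hw1 hd) (softMin_le hβ hw hw1) 2).trans h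

theorem measurable_softMin {Z : Type*} [MeasurableSpace Z] {l : ι → Z → ℝ}
    (hl : ∀ i, Measurable (l i)) : Measurable fun z => softMin β w fun i => l i z := by
  unfold softMin
  fun_prop

theorem integrable_softMin_sq (hβ : 0 < β) (hw : ∀ i, 0 ≤ w i) (hw1 : ∑ i, w i = 1)
    {Z : Type*} [MeasurableSpace Z] {ν : Measure Z} {l : ι → Z → ℝ} {A : ℝ}
    (hl : ∀ i, Measurable (l i)) (hl0 : ∀ i z, 0 ≤ l i z)
    (hA : ∀ i, Integrable (fun z => l i z ^ 2) ν ∧ ∫ z, l i z ^ 2 ∂ν ≤ A) :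
    Integrable (fun z => softMin β w (fun i => l i z) ^ 2) ν ∧
      ∫ z, softMin β w (fun i => l i z) ^ 2 ∂ν ≤ A := by
  have hi : Integrable (fun z => ∑ i, w i * l i z ^ 2) ν :=
    integrable_finsetSum _ fun i _ => (hA i).1.const_mul _
  have hle : ∀ z, softMin β w (fun i => l i z) ^ 2 ≤ ∑ i, w i * l i z ^ 2 :=
    fun z => softMin_sq_le hβ hw hw1 fun i => hl0 i z
  have hi2 : Integrable (fun z => softMin β w (fun i => l i z) ^ 2) ν := by
    refine hi.mono' ((measurable_softMin hl).pow_const 2).aestronglyMeasurable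
      (ae_of_all _ fun z => ?_)
    rw [Real.norm_of_nonneg (sq_nonneg _)]; exact hle z
  refine ⟨hi2, (integral_mono hi2 hi hle).trans ?_⟩
  rw [integral_finsetSum _ fun i _ => (hA i).1.const_mul _]
  simp only [integral_const_mul]
  calc ∑ i, w i * ∫ z, l i z ^ 2 ∂ν ≤ ∑ i, w i * A :=
        Finset.sum_le_sum fun i _ => mul_le_mul_of_nonneg_left (hA i).2 (hw i)
    _ = A := by rw [← Finset.sum_mul, hw1, one_mul]

theorem integrable_of_sq {Z : Type*} [MeasurableSpace Z] {ν : Measure Z} [IsFiniteMeasure ν]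
    {f : Z → ℝ} (hf : AEStronglyMeasurable f ν) (h : Integrable (fun z => f z ^ 2) ν) :
    Integrable f ν :=
  ((memLp_two_iff_integrable_sq hf).2 h).integrable one_le_two

/-- Replicas: a power of the partition function is a partition function over `m`-tuples with product
weights. -/
theorem partition_pow (m : ℕ) :
    (∑ i, w i * Real.exp (-β * d i)) ^ m =
      ∑ t : Fin m → ι, (∏ l, w (t l)) * Real.exp (-β * ∑ l, d (t l)) := by
  rw [Fintype.sum_pow]
  refine Finset.sum_congr rfl fun t _ => ?_
  rw [Finset.prod_mul_distrib, ← Real.exp_sum, Finset.mul_sum]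

/-- The weights of the `m`-tuples sum to one, so the error `δ` does not grow with the number of
indices. This allows families of exponential size. -/
theorem abs_integral_partition_pow_sub_le (hβ : 0 < β) (hw : ∀ i, 0 ≤ w i) (hw1 : ∑ i, w i = 1)
    {Z : Type*} [MeasurableSpace Z] {ν ν' : Measure Z} [IsProbabilityMeasure ν]
    [IsProbabilityMeasure ν'] {l : ι → Z → ℝ} (hl : ∀ i, Measurable (l i))
    (hl0 : ∀ i z, 0 ≤ l i z) {m : ℕ} {δ : ℝ}
    (h : ∀ t : Fin m → ι, |∫ z, Real.exp (-β * ∑ a, l (t a) z) ∂ν -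
      ∫ z, Real.exp (-β * ∑ a, l (t a) z) ∂ν'| ≤ δ) :
    |∫ z, (∑ i, w i * Real.exp (-β * l i z)) ^ m ∂ν -
      ∫ z, (∑ i, w i * Real.exp (-β * l i z)) ^ m ∂ν'| ≤ δ := by
  have hint : ∀ (ξ : Measure Z) [IsProbabilityMeasure ξ] (t : Fin m → ι),
      Integrable (fun z => (∏ a, w (t a)) * Real.exp (-β * ∑ a, l (t a) z)) ξ := by
    intro ξ _ t
    refine Integrable.const_mul ((integrable_const (1 : ℝ)).mono' ?_ (ae_of_all _ fun z => ?_)) _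
    · exact (by fun_prop : Measurable fun z =>
        Real.exp (-β * ∑ a, l (t a) z)).aestronglyMeasurable
    · rw [Real.norm_of_nonneg (Real.exp_pos _).le, Real.exp_le_one_iff]
      have := Finset.sum_nonneg fun a (_ : a ∈ Finset.univ) => hl0 (t a) z
      nlinarith
  simp only [partition_pow (d := fun i => l i _)]
  rw [integral_finsetSum _ fun t _ => hint ν t, integral_finsetSum _ fun t _ => hint ν' t,
    ← Finset.sum_sub_distrib]
  simp only [integral_const_mul, ← mul_sub]
  calc _ ≤ ∑ t : Fin m → ι, |(∏ a, w (t a)) * (∫ z, Real.exp (-β * ∑ a, l (t a) z) ∂ν -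
      ∫ z, Real.exp (-β * ∑ a, l (t a) z) ∂ν')| := Finset.abs_sum_le_sum_abs _ _
    _ ≤ ∑ t : Fin m → ι, (∏ a, w (t a)) * δ := by
      refine Finset.sum_le_sum fun t _ => ?_
      have hp : 0 ≤ ∏ a, w (t a) := Finset.prod_nonneg fun a _ => hw _
      rw [abs_mul, abs_of_nonneg hp]
      exact mul_le_mul_of_nonneg_left (h t) hp
    _ = δ := by rw [← Finset.sum_mul, ← Fintype.sum_pow, hw1, one_pow, one_mul]

end softMin

/-- The expectation of a soft minimum of nonnegative functions with bounded second moments is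
determined, up to a small error, by finitely many of the expectations of the products of their
exponentials; the required precision does not depend on the functions or on the weights. -/
theorem exists_softMin_tolerance {β A ε : ℝ} (hβ : 0 < β) (hA : 0 ≤ A) (hε : 0 < ε) :
    ∃ m₀ : ℕ, ∃ δ > 0, ∀ (Z : Type) [MeasurableSpace Z] (ν ν' : Measure Z)
      [IsProbabilityMeasure ν] [IsProbabilityMeasure ν'] (ι : Type) [Fintype ι] (w : ι → ℝ)
      (l : ι → Z → ℝ), (∀ i, 0 ≤ w i) → ∑ i, w i = 1 → (∀ i, Measurable (l i)) →
      (∀ i z, 0 ≤ l i z) →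
      (∀ i, Integrable (fun z => l i z ^ 2) ν ∧ ∫ z, l i z ^ 2 ∂ν ≤ A) →
      (∀ i, Integrable (fun z => l i z ^ 2) ν' ∧ ∫ z, l i z ^ 2 ∂ν' ≤ A) →
      (∀ m < m₀, ∀ t : Fin m → ι, |∫ z, Real.exp (-β * ∑ a, l (t a) z) ∂ν -
        ∫ z, Real.exp (-β * ∑ a, l (t a) z) ∂ν'| ≤ δ) →
      |∫ z, softMin β w (fun i => l i z) ∂ν - ∫ z, softMin β w (fun i => l i z) ∂ν'| ≤ ε := by
  -- Truncation level for the soft minimum: its excess over `B` is at most its square divided by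
  -- `B`, hence at most `A / B ≤ ε / 6` in mean.
  set B : ℝ := 6 * A / ε + 1 with hB
  have hBpos : 0 < B := by positivity
  have hAB : A / B ≤ ε / 6 := by
    rw [div_le_iff₀ hBpos, hB]
    have : ε / 6 * (6 * A / ε + 1) = A + ε / 6 := by field_simp
    rw [this]; linarith
  set τ : ℝ := Real.exp (-(β * B)) with hτ
  have hτpos : 0 < τ := Real.exp_pos _
  -- The logarithm is singular at `0`; cut off at `τ = exp (-β * B)` it is continuous on `[0, 1]`,
  -- where the partition function takes its values, and Weierstrass applies.
  obtain ⟨P, hP⟩ := exists_polynomial_near_of_continuousOn 0 1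
    (fun s => -(Real.log (max s τ) / β))
    (by
      refine ContinuousOn.neg (ContinuousOn.div_const (ContinuousOn.log (by fun_prop) ?_) β)
      intro s _
      exact (lt_max_of_lt_right hτpos).ne') (ε / 6) (by positivity)
  set C : ℝ := ∑ m ∈ Finset.range (P.natDegree + 1), |P.coeff m| with hC
  have hC0 : 0 ≤ C := Finset.sum_nonneg fun _ _ => abs_nonneg _
  refine ⟨P.natDegree + 1, ε / (3 * (1 + C)), by positivity, ?_⟩
  intro Z _ ν ν' _ _ ι _ w l hw hw1 hl hl0 hν hν' hprod
  set S : Z → ℝ := fun z => ∑ i, w i * Real.exp (-β * l i z) with hS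
  have hS0 : ∀ z, 0 < S z := fun z => partition_pos hw hw1
  have hS1 : ∀ z, S z ≤ 1 := fun z => partition_le_one hβ.le hw hw1 fun i => hl0 i z
  have hSm : Measurable S := by fun_prop
  have hpt : ∀ z, |softMin β w (fun i => l i z) - P.eval (S z)| ≤
      ε / 6 + softMin β w (fun i => l i z) ^ 2 / B := by
    intro z
    set L := softMin β w (fun i => l i z) with hL
    have hLS : L = -(Real.log (S z) / β) := rfl
    have h1 := (hP (S z) ⟨(hS0 z).le, hS1 z⟩).le
    have h2 : |L - -(Real.log (max (S z) τ) / β)| ≤ L ^ 2 / B := by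
      rcases le_total τ (S z) with h | h
      · rw [max_eq_left h, ← hLS, sub_self, abs_zero]; positivity
      · have hBL : B ≤ L := by
          rw [hLS, ← neg_div, le_div_iff₀ hβ]
          have := Real.log_le_log (hS0 z) h
          rw [hτ, Real.log_exp] at this
          linarith
        rw [max_eq_right h, hτ, Real.log_exp]
        have h3 : -(-(β * B) / β) = B := by field_simp
        rw [h3, abs_of_nonneg (by linarith), le_div_iff₀ hBpos]
        nlinarith
    rw [abs_sub_comm] at h1
    have h4 := abs_add_le (L - -(Real.log (max (S z) τ) / β))
      (-(Real.log (max (S z) τ) / β) - P.eval (S z))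
    rw [sub_add_sub_cancel] at h4
    linarith
  have hpow : ∀ (ξ : Measure Z) [IsProbabilityMeasure ξ] (m : ℕ),
      Integrable (fun z => S z ^ m) ξ := by
    intro ξ _ m
    refine (integrable_const (1 : ℝ)).mono' (hSm.pow_const m).aestronglyMeasurable
      (ae_of_all _ fun z => ?_)
    rw [Real.norm_of_nonneg (pow_nonneg (hS0 z).le m)]
    exact pow_le_one₀ (hS0 z).le (hS1 z)
  have hpoly : ∀ (ξ : Measure Z) [IsProbabilityMeasure ξ],
      Integrable (fun z => P.eval (S z)) ξ := by
    intro ξ _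
    simp only [Polynomial.eval_eq_sum_range]
    exact integrable_finsetSum _ fun m _ => (hpow ξ m).const_mul _
  have hclose : ∀ (ξ : Measure Z) [IsProbabilityMeasure ξ],
      (∀ i, Integrable (fun z => l i z ^ 2) ξ ∧ ∫ z, l i z ^ 2 ∂ξ ≤ A) →
      |∫ z, softMin β w (fun i => l i z) ∂ξ - ∫ z, P.eval (S z) ∂ξ| ≤ ε / 3 := by
    intro ξ _ hξ
    obtain ⟨hi2, hle2⟩ := integrable_softMin_sq hβ hw hw1 hl hl0 hξ
    have hi1 := integrable_of_sq (measurable_softMin hl).aestronglyMeasurable hi2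
    rw [← integral_sub hi1 (hpoly ξ)]
    refine (abs_integral_le_integral_abs).trans ?_
    refine (integral_mono (hi1.sub (hpoly ξ)).abs
      ((integrable_const (ε / 6)).add (hi2.div_const B)) hpt).trans ?_
    simp only [Pi.add_apply]
    rw [integral_add (integrable_const _) (hi2.div_const B), integral_const, integral_div]
    simp only [Measure.real, measure_univ, ENNReal.toReal_one, one_smul]
    have : (∫ z, softMin β w (fun i => l i z) ^ 2 ∂ξ) / B ≤ A / B := by gcongr
    linarith
  have hmid : |∫ z, P.eval (S z) ∂ν - ∫ z, P.eval (S z) ∂ν'| ≤ ε / 3 := by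
    simp only [Polynomial.eval_eq_sum_range]
    rw [integral_finsetSum _ fun m _ => (hpow ν m).const_mul _,
      integral_finsetSum _ fun m _ => (hpow ν' m).const_mul _, ← Finset.sum_sub_distrib]
    simp only [integral_const_mul, ← mul_sub]
    calc _ ≤ ∑ m ∈ Finset.range (P.natDegree + 1), |P.coeff m *
          (∫ z, S z ^ m ∂ν - ∫ z, S z ^ m ∂ν')| := Finset.abs_sum_le_sum_abs _ _
      _ ≤ ∑ m ∈ Finset.range (P.natDegree + 1), |P.coeff m| * (ε / (3 * (1 + C))) := by
        refine Finset.sum_le_sum fun m hm => ?_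
        rw [abs_mul]
        exact mul_le_mul_of_nonneg_left (abs_integral_partition_pow_sub_le hβ hw hw1 hl hl0
          (hprod m (Finset.mem_range.1 hm))) (abs_nonneg _)
      _ = C * (ε / (3 * (1 + C))) := by rw [← Finset.sum_mul]
      _ ≤ ε / 3 := by
        have : ε / 3 = (1 + C) * (ε / (3 * (1 + C))) := by field_simp
        rw [this]
        exact mul_le_mul_of_nonneg_right (by linarith) (by positivity)
  have ha := hclose ν hν
  have hb := hclose ν' hν'
  rw [abs_le] at *
  constructor <;> linarith [ha.1, ha.2, hb.1, hb.2, hmid.1, hmid.2]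

/-! ### Moments of the loss and single-sample comparison -/

namespace ERMModel

variable {k kstar : ℕ} (M : ERMModel k kstar)

/-- The loss of `Θ` on a sample `z` consisting of a feature vector and a noise variable. -/
noncomputable def sampleLoss {p : ℕ} (Θ : Param p k) (z : Feat p × ℝ) : ℝ :=
  M.lossAt (project Θ z.1) (M.response z.1 z.2)

variable {M} {R : ℝ} {K : ℝ≥0} {Kr : ℝ → ℝ≥0}

theorem norm_project_sq {p m : ℕ} (Θ : Param p m) (x : Feat p) :
    ‖project Θ x‖ ^ 2 = ∑ j, ⟪Θ j, x⟫ ^ 2 := by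
  rw [EuclideanSpace.real_norm_sq_eq]; rfl

theorem norm_project_le {p m : ℕ} (Θ : Param p m) (x : Feat p) :
    ‖project Θ x‖ ≤ ∑ j, |⟪Θ j, x⟫| := by
  rw [EuclideanSpace.norm_eq]
  refine (Real.sqrt_le_sqrt (Finset.sum_sq_le_sq_sum_of_nonneg fun j _ => norm_nonneg _)).trans ?_
  rw [Real.sqrt_sq (Finset.sum_nonneg fun j _ => norm_nonneg _)]
  rfl

theorem norm_toLp_prod_le {E F : Type*} [SeminormedAddCommGroup E] [SeminormedAddCommGroup F]
    (x : E) (y : F) : ‖(WithLp.toLp 2 (x, y) : WithLp 2 (E × F))‖ ≤ ‖x‖ + ‖y‖ := by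
  rw [WithLp.prod_norm_eq_of_L2]
  refine Real.sqrt_le_iff.2 ⟨by positivity, ?_⟩
  change ‖x‖ ^ 2 + ‖y‖ ^ 2 ≤ _
  nlinarith [norm_nonneg x, norm_nonneg y]

theorem project_sub {p m : ℕ} (Θ Θ' : Param p m) (x : Feat p) :
    project Θ x - project Θ' x = project (Θ - Θ') x := by
  ext j
  simp [project, inner_sub_left]

/-- The Laplace functional of finitely many losses, as a function of the projections of the feature
vector. -/
noncomputable def laplaceFun (M : ERMModel k kstar) (β : ℝ) (m : ℕ)
    (u : EuclideanSpace ℝ ((Fin m × Fin k) ⊕ Fin kstar)) : ℝ :=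
  ∫ e, Real.exp (-β * ∑ a, M.lossAt (WithLp.toLp 2 fun j => u (Sum.inl (a, j)))
    (M.label (WithLp.toLp 2 (WithLp.toLp 2 fun j => u (Sum.inr j), e)))) ∂M.lawE

namespace Assumptions

theorem sampleLoss_nonneg (hM : M.Assumptions R K Kr) {p : ℕ} (Θ : Param p k)
    (z : Feat p × ℝ) : 0 ≤ M.sampleLoss Θ z := hM.loss_nonneg _

theorem continuous_sampleLoss (hM : M.Assumptions R K Kr) {p : ℕ} (Θ : Param p k) :
    Continuous (M.sampleLoss Θ) := by
  have h1 := hM.loss_lipschitz.continuous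
  have h2 := hM.label_lipschitz.continuous
  unfold sampleLoss lossAt response project
  fun_prop

theorem abs_sampleLoss_sub_le (hM : M.Assumptions R K Kr) {p : ℕ} (Θ Θ' : Param p k)
    (z : Feat p × ℝ) :
    |M.sampleLoss Θ z - M.sampleLoss Θ' z| ≤ K * ‖project (Θ - Θ') z.1‖ := by
  have h := hM.loss_lipschitz.dist_le_mul (WithLp.toLp 2 (project Θ z.1, M.response z.1 z.2))
    (WithLp.toLp 2 (project Θ' z.1, M.response z.1 z.2))
  rw [Real.dist_eq, dist_eq_norm] at h
  refine h.trans (mul_le_mul_of_nonneg_left ?_ K.2)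
  rw [← WithLp.toLp_sub, Prod.mk_sub_mk, sub_self, project_sub]
  exact (norm_toLp_prod_le _ _).trans_eq (by simp)

theorem sampleLoss_le (hM : M.Assumptions R K Kr) {p : ℕ} (Θ : Param p k) (z : Feat p × ℝ) :
    M.sampleLoss Θ z ≤ (|M.loss 0| + K * |M.label 0|) + K * ‖project Θ z.1‖ +
      K ^ 2 * ‖project (M.Θstar p) z.1‖ + K ^ 2 * |z.2| := by
  have hK : (0 : ℝ) ≤ K := K.2
  have h1 := hM.loss_lipschitz.dist_le_mul
    (WithLp.toLp 2 (project Θ z.1, M.response z.1 z.2)) 0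
  have h2 := hM.label_lipschitz.dist_le_mul
    (WithLp.toLp 2 (project (M.Θstar p) z.1, z.2)) 0
  rw [Real.dist_eq, dist_zero_right] at h1 h2
  have h3 := norm_toLp_prod_le (project Θ z.1) (M.response z.1 z.2)
  have h4 := norm_toLp_prod_le (project (M.Θstar p) z.1) z.2
  have h5 : |M.response z.1 z.2| ≤
      |M.label 0| + K * (‖project (M.Θstar p) z.1‖ + |z.2|) := by
    have := abs_sub_abs_le_abs_sub (M.response z.1 z.2) (M.label 0)
    have h6 := h2.trans (mul_le_mul_of_nonneg_left h4 hK)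
    rw [Real.norm_eq_abs] at h6
    change |M.response z.1 z.2 - M.label 0| ≤ _ at h6
    linarith
  have h7 : M.sampleLoss Θ z ≤ |M.loss 0| + K * (‖project Θ z.1‖ + |M.response z.1 z.2|) := by
    have := le_abs_self (M.sampleLoss Θ z - M.loss 0)
    have h6 := h1.trans (mul_le_mul_of_nonneg_left h3 hK)
    rw [Real.norm_eq_abs] at h6
    change |M.sampleLoss Θ z - M.loss 0| ≤ _ at h6
    linarith [le_abs_self (M.loss 0)]
  have h8 := mul_le_mul_of_nonneg_left h5 hK
  linarith

/-- A common bound on the second moments of the loss. -/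
noncomputable def secondMoment (hM : M.Assumptions R K Kr) : ℝ :=
  4 * (|M.loss 0| + K * |M.label 0|) ^ 2 + 4 * K ^ 2 * (k * (12 / hM.rate ^ 2)) +
    4 * K ^ 4 * (kstar * (12 / hM.rate ^ 2)) + 4 * K ^ 4 * (12 / hM.rate ^ 2)

theorem secondMoment_nonneg (hM : M.Assumptions R K Kr) : 0 ≤ hM.secondMoment := by
  unfold secondMoment; positivity

theorem norm_project_sq_integral (hM : M.Assumptions R K Kr) {p m : ℕ} {μ : Measure (Feat p)}
    (hμ : ∀ s ∈ M.S p, ExpBound hM.rate μ fun x => ⟪s, x⟫) {Θ : Param p m}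
    (hΘ : ∀ j, Θ j ∈ M.S p) :
    Integrable (fun x => ‖project Θ x‖ ^ 2) μ ∧
      ∫ x, ‖project Θ x‖ ^ 2 ∂μ ≤ m * (12 / hM.rate ^ 2) := by
  have hi := fun j => (hμ (Θ j) (hΘ j)).sq hM.rate_pos
  simp only [norm_project_sq]
  refine ⟨integrable_finsetSum _ fun j _ => (hi j).1, ?_⟩
  rw [integral_finsetSum _ fun j _ => (hi j).1]
  calc _ ≤ ∑ j : Fin m, 12 / hM.rate ^ 2 := Finset.sum_le_sum fun j _ => (hi j).2
    _ = _ := by simp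

theorem sampleLoss_sq (hM : M.Assumptions R K Kr) {p : ℕ} {μ : Measure (Feat p)}
    [IsProbabilityMeasure μ] (hμ : ∀ s ∈ M.S p, ExpBound hM.rate μ fun x => ⟪s, x⟫)
    {Θ : Param p k} (hΘ : ∀ j, Θ j ∈ M.S p) :
    Integrable (fun z => M.sampleLoss Θ z ^ 2) (μ.prod M.lawE) ∧
      ∫ z, M.sampleLoss Θ z ^ 2 ∂(μ.prod M.lawE) ≤ hM.secondMoment := by
  have := hM.lawE_prob
  have h1 := hM.norm_project_sq_integral hμ hΘ
  have h2 := hM.norm_project_sq_integral hμ (hM.Θstar_mem p)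
  have h3 := hM.expBound_noise.sq hM.rate_pos
  have hle : ∀ z : Feat p × ℝ, M.sampleLoss Θ z ^ 2 ≤
      4 * (|M.loss 0| + K * |M.label 0|) ^ 2 + 4 * K ^ 2 * ‖project Θ z.1‖ ^ 2 +
        4 * K ^ 4 * ‖project (M.Θstar p) z.1‖ ^ 2 + 4 * K ^ 4 * id z.2 ^ 2 := by
    intro z
    refine (pow_le_pow_left₀ (hM.sampleLoss_nonneg Θ z) (hM.sampleLoss_le Θ z) 2).trans ?_
    have h4 : ∀ a b c d : ℝ, (a + b + c + d) ^ 2 ≤ 4 * a ^ 2 + 4 * b ^ 2 + 4 * c ^ 2 + 4 * d ^ 2 :=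
      fun a b c d => by
        nlinarith [sq_nonneg (a - b), sq_nonneg (a - c), sq_nonneg (a - d), sq_nonneg (b - c),
          sq_nonneg (b - d), sq_nonneg (c - d)]
    refine (h4 _ _ _ _).trans_eq ?_
    simp only [mul_pow, sq_abs, id]
    ring
  have i1 : Integrable (fun z : Feat p × ℝ => 4 * (K : ℝ) ^ 2 * ‖project Θ z.1‖ ^ 2)
      (μ.prod M.lawE) := (h1.1.comp_fst M.lawE).const_mul _
  have i2 : Integrable (fun z : Feat p × ℝ => 4 * (K : ℝ) ^ 4 * ‖project (M.Θstar p) z.1‖ ^ 2)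
      (μ.prod M.lawE) := (h2.1.comp_fst M.lawE).const_mul _
  have i3 : Integrable (fun z : Feat p × ℝ => 4 * (K : ℝ) ^ 4 * id z.2 ^ 2)
      (μ.prod M.lawE) := (h3.1.comp_snd μ).const_mul _
  have i0 : Integrable (fun _ : Feat p × ℝ => 4 * (|M.loss 0| + K * |M.label 0|) ^ 2)
      (μ.prod M.lawE) := integrable_const _
  have hi := ((i0.add i1).add i2).add i3
  have hi' : Integrable (fun z => M.sampleLoss Θ z ^ 2) (μ.prod M.lawE) := by
    refine hi.mono' ((hM.continuous_sampleLoss Θ).pow 2).aestronglyMeasurable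
      (ae_of_all _ fun z => ?_)
    rw [Real.norm_of_nonneg (sq_nonneg _)]; exact hle z
  have e := integral_add' ((i0.add i1).add i2) i3
  rw [integral_add' (i0.add i1) i2, integral_add' i0 i1] at e
  refine ⟨hi', (integral_mono hi' hi hle).trans (e.le.trans ?_)⟩
  have e1 := integral_fun_fst (μ := μ) (ν := M.lawE) fun x => ‖project Θ x‖ ^ 2
  have e2 := integral_fun_fst (μ := μ) (ν := M.lawE) fun x => ‖project (M.Θstar p) x‖ ^ 2
  have e3 := integral_fun_snd (μ := μ) (ν := M.lawE) fun x => id x ^ 2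
  simp only [Measure.real, measure_univ, ENNReal.toReal_one, one_smul] at e1 e2 e3
  rw [integral_const, integral_const_mul, integral_const_mul, integral_const_mul, e1, e2, e3]
  simp only [Measure.real, measure_univ, ENNReal.toReal_one, one_smul]
  unfold secondMoment
  gcongr
  exacts [h1.2, h2.2, h3.2]

/-- Integrating out the noise first leaves a bounded continuous function of `m * k + kstar`
projections. The columns of `Θstar` belong to `S_p` too, so the labels are covered. -/
theorem exists_laplace_close (hM : M.Assumptions R K Kr) {β δ : ℝ} (hβ : 0 < β) (hδ : 0 < δ)
    (m : ℕ) : ∃ p₀, ∀ p, p₀ ≤ p → ∀ Θ : Fin m → Param p k, (∀ a j, Θ a j ∈ M.S p) →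
      |∫ z, Real.exp (-β * ∑ a, M.sampleLoss (Θ a) z) ∂((M.lawX p).prod M.lawE) -
        ∫ z, Real.exp (-β * ∑ a, M.sampleLoss (Θ a) z) ∂((M.lawG p).prod M.lawE)| ≤ δ := by
  have := hM.lawE_prob
  have := hM.lawX_prob
  have hl := hM.loss_lipschitz.continuous
  have hη := hM.label_lipschitz.continuous
  have hexp : ∀ (n : ℕ) (f : Fin n → ℝ), (∀ a, 0 ≤ f a) → Real.exp (-β * ∑ a, f a) ≤ 1 := by
    intro n f hf
    rw [Real.exp_le_one_iff]
    nlinarith [Finset.sum_nonneg fun a (_ : a ∈ Finset.univ) => hf a]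
  have hc : Continuous (laplaceFun M β m) := by
    refine continuous_of_dominated (bound := fun _ => 1) (fun u => ?_) (fun u => ?_)
      (integrable_const _) (ae_of_all _ fun e => ?_)
    · exact (by unfold lossAt; fun_prop : Continuous fun e => Real.exp (-β * ∑ a,
        M.lossAt (WithLp.toLp 2 fun j => u (Sum.inl (a, j)))
        (M.label (WithLp.toLp 2 (WithLp.toLp 2 fun j => u (Sum.inr j), e))))).aestronglyMeasurable
    · refine ae_of_all _ fun e => ?_
      rw [Real.norm_of_nonneg (Real.exp_pos _).le]
      exact hexp _ _ fun a => hM.loss_nonneg _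
    · unfold lossAt; fun_prop
  have hbd : ∀ u, ‖laplaceFun M β m u‖ ≤ 1 := by
    intro u
    have := norm_integral_le_of_norm_le_const (μ := M.lawE) (C := 1)
      (f := fun e => Real.exp (-β * ∑ a, M.lossAt (WithLp.toLp 2 fun j => u (Sum.inl (a, j)))
        (M.label (WithLp.toLp 2 (WithLp.toLp 2 fun j => u (Sum.inr j), e)))))
      (ae_of_all _ fun e => by
        rw [Real.norm_of_nonneg (Real.exp_pos _).le]
        exact hexp _ _ fun a => hM.loss_nonneg _)
    rwa [probReal_univ, mul_one] at this
  obtain ⟨p₀, hp₀⟩ := hM.uniform_gaussian_projections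
    (BoundedContinuousFunction.ofNormedAddCommGroup (laplaceFun M β m) hc 1 hbd) hδ
  refine ⟨p₀, fun p hp Θ hΘ => ?_⟩
  let θ : (Fin m × Fin k) ⊕ Fin kstar → Feat p := Sum.elim (fun a => Θ a.1 a.2) (M.Θstar p)
  have hθ : ∀ i, θ i ∈ M.S p := by
    rintro (⟨a, j⟩ | j)
    exacts [hΘ a j, hM.Θstar_mem p j]
  have key : ∀ (μ : Measure (Feat p)) [IsProbabilityMeasure μ],
      ∫ z, Real.exp (-β * ∑ a, M.sampleLoss (Θ a) z) ∂(μ.prod M.lawE) =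
        ∫ x, laplaceFun M β m (projVec θ x) ∂μ := by
    intro μ _
    have hcs := fun a => hM.continuous_sampleLoss (Θ a)
    rw [integral_prod]
    · rfl
    · refine (integrable_const (1 : ℝ)).mono'
        (by fun_prop : Continuous fun z => Real.exp (-β * ∑ a,
          M.sampleLoss (Θ a) z)).aestronglyMeasurable (ae_of_all _ fun z => ?_)
      rw [Real.norm_of_nonneg (Real.exp_pos _).le]
      exact hexp _ _ fun a => hM.sampleLoss_nonneg _ _
  rw [key, key]
  exact hp₀ p hp θ hθ

/-- The expected soft minimum of the losses of a family of parameters under the law of the features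
and under its Gaussian equivalent are close in high dimension, uniformly in the family. -/
theorem exists_softMin_close (hM : M.Assumptions R K Kr) {β ε : ℝ} (hβ : 0 < β) (hε : 0 < ε) :
    ∃ p₀, ∀ p, p₀ ≤ p → ∀ (ι : Type) [Fintype ι] (w : ι → ℝ) (Θ : ι → Param p k),
      (∀ i, 0 ≤ w i) → ∑ i, w i = 1 → (∀ i j, Θ i j ∈ M.S p) →
      |∫ z, softMin β w (fun i => M.sampleLoss (Θ i) z) ∂((M.lawX p).prod M.lawE) -
        ∫ z, softMin β w (fun i => M.sampleLoss (Θ i) z) ∂((M.lawG p).prod M.lawE)| ≤ ε := by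
  have := hM.lawE_prob
  have := hM.lawX_prob
  obtain ⟨m₀, δ, hδ, h⟩ := exists_softMin_tolerance hβ hM.secondMoment_nonneg hε
  choose p₀ hp₀ using fun m => hM.exists_laplace_close hβ hδ m
  refine ⟨(Finset.range m₀).sup p₀, fun p hp ι _ w Θ hw hw1 hΘ => ?_⟩
  refine h _ _ _ ι w _ hw hw1 (fun i => (hM.continuous_sampleLoss _).measurable)
    (fun i z => hM.sampleLoss_nonneg _ z)
    (fun i => hM.sampleLoss_sq (fun s hs => hM.expBound_X hs) (hΘ i))
    (fun i => hM.sampleLoss_sq (fun s hs => hM.expBound_G hs) (hΘ i)) ?_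
  intro m hm t
  exact hp₀ m p ((Finset.le_sup (Finset.mem_range.2 hm)).trans hp) (fun a => Θ (t a))
    fun a j => hΘ (t a) j

/-- A soft minimum over a single index is the loss itself, so its expectation is the test error. -/
theorem exists_testError_close (hM : M.Assumptions R K Kr) {ε : ℝ} (hε : 0 < ε) :
    ∃ p₀, ∀ p, p₀ ≤ p → ∀ Θ : Param p k, (∀ j, Θ j ∈ M.S p) →
      |M.testErrorX Θ - M.testErrorG Θ| ≤ ε := by
  obtain ⟨p₀, h⟩ := hM.exists_softMin_close one_pos hε
  refine ⟨p₀, fun p hp Θ hΘ => ?_⟩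
  have := h p hp Unit (fun _ => 1) (fun _ => Θ) (fun _ => zero_le_one) (by simp) fun _ => hΘ
  simpa [softMin, testErrorX, testErrorG, testError, sampleLoss] using this

end Assumptions

end ERMModel

/-! ### Smooth test functions -/

/-- Bounded functions with bounded Lipschitz derivative `D`. -/
structure IsSmoothTest (C : ℝ) (ψ D : ℝ → ℝ) : Prop where
  nonneg : 0 ≤ C
  bound : ∀ u, |ψ u| ≤ C
  bound_deriv : ∀ u, |D u| ≤ C
  lipschitz : ∀ u v, |ψ u - ψ v| ≤ C * |u - v|
  taylor : ∀ u h, |ψ (u + h) - ψ u - D u * h| ≤ C * h ^ 2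

theorem IsSmoothTest.continuous {C : ℝ} {ψ D : ℝ → ℝ} (h : IsSmoothTest C ψ D) : Continuous ψ :=
  (LipschitzWith.of_dist_le_mul (K := ⟨C, h.nonneg⟩) fun u v => h.lipschitz u v).continuous

theorem exists_bound_of_eq_zero {f : ℝ → ℝ} (hf : Continuous f)
    (h0 : ∀ u, u ∉ Set.Icc (0 : ℝ) 1 → f u = 0) : ∃ C, 0 ≤ C ∧ ∀ u, |f u| ≤ C := by
  obtain ⟨C, hC⟩ := isCompact_Icc.exists_bound_of_continuousOn (s := Set.Icc (0 : ℝ) 1)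
    hf.continuousOn
  refine ⟨max C 0, le_max_right _ _, fun u => ?_⟩
  by_cases hu : u ∈ Set.Icc (0 : ℝ) 1
  · exact (hC u hu).trans (le_max_left _ _)
  · rw [h0 u hu, abs_zero]; exact le_max_right _ _

theorem deriv_eq_zero_off_Icc {f : ℝ → ℝ} {a b : ℝ} (h1 : ∀ u < 0, f u = a)
    (h2 : ∀ u > 1, f u = b) {u : ℝ} (hu : u ∉ Set.Icc (0 : ℝ) 1) : deriv f u = 0 := by
  rw [Set.mem_Icc, not_and_or, not_le, not_le] at hu
  rcases hu with hu | hu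
  · have : f =ᶠ[𝓝 u] fun _ => a := by
      filter_upwards [gt_mem_nhds hu] with v hv using h1 v hv
    rw [this.deriv_eq, deriv_const]
  · have : f =ᶠ[𝓝 u] fun _ => b := by
      filter_upwards [lt_mem_nhds hu] with v hv using h2 v hv
    rw [this.deriv_eq, deriv_const]

/-- A smooth step from `0` on `(-∞, a]` to `1` on `[a + δ, ∞)`. -/
theorem exists_smoothTest (a : ℝ) {δ : ℝ} (hδ : 0 < δ) :
    ∃ C ψ D, IsSmoothTest C ψ D ∧ (∀ u, 0 ≤ ψ u) ∧ (∀ u, ψ u ≤ 1) ∧ (∀ u ≤ a, ψ u = 0) ∧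
      ∀ u, a + δ ≤ u → ψ u = 1 := by
  set f := Real.smoothTransition
  have hf : ContDiff ℝ 2 f := Real.smoothTransition.contDiff (n := 2)
  have hf1 : ContDiff ℝ 1 (deriv f) := by
    have : ContDiff ℝ (1 + 1) f := by norm_num; exact hf
    exact (contDiff_succ_iff_deriv.1 this).2.2
  have hd0 : Differentiable ℝ f := hf.differentiable (by norm_num)
  have hd1 : Differentiable ℝ (deriv f) := hf1.differentiable (by norm_num)
  have hz1 : ∀ u, u ∉ Set.Icc (0 : ℝ) 1 → deriv f u = 0 := fun u hu =>
    deriv_eq_zero_off_Icc (a := 0) (b := 1)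
      (fun u hu => Real.smoothTransition.zero_of_nonpos hu.le)
      (fun u hu => Real.smoothTransition.one_of_one_le (le_of_lt hu)) hu
  have hz2 : ∀ u, u ∉ Set.Icc (0 : ℝ) 1 → deriv (deriv f) u = 0 := fun u hu =>
    deriv_eq_zero_off_Icc (a := 0) (b := 0)
      (fun u hu => hz1 u fun h => absurd h.1 (not_le.2 hu))
      (fun u hu => hz1 u fun h => absurd h.2 (not_le.2 hu)) hu
  obtain ⟨C1, hC1, hb1⟩ := exists_bound_of_eq_zero hf1.continuous hz1
  obtain ⟨C2, hC2, hb2⟩ := exists_bound_of_eq_zero (hf1.continuous_deriv le_rfl) hz2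
  have hl0 : ∀ u v, |f u - f v| ≤ C1 * |u - v| := fun u v =>
    Convex.norm_image_sub_le_of_norm_deriv_le (s := Set.univ) (fun x _ => hd0 x)
      (fun x _ => hb1 x) convex_univ (Set.mem_univ v) (Set.mem_univ u)
  have hl1 : ∀ u v, |deriv f u - deriv f v| ≤ C2 * |u - v| := fun u v =>
    Convex.norm_image_sub_le_of_norm_deriv_le (s := Set.univ) (fun x _ => hd1 x)
      (fun x _ => hb2 x) convex_univ (Set.mem_univ v) (Set.mem_univ u)
  -- Mean value inequality for `x ↦ f x - f' u * x` between `u` and `u + h`; the sharp factor `1 /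
  -- 2` is not needed.
  have htay : ∀ u h, |f (u + h) - f u - deriv f u * h| ≤ C2 * h ^ 2 := by
    intro u h
    have hdg : ∀ x ∈ Set.uIcc u (u + h), DifferentiableAt ℝ (fun x => f x - deriv f u * x) x :=
      fun x _ => (hd0 x).sub ((differentiableAt_id).const_mul _)
    have hder : ∀ x ∈ Set.uIcc u (u + h), ‖deriv (fun x => f x - deriv f u * x) x‖ ≤ C2 * |h| := by
      intro x hx
      have h1 : deriv (fun x => f x - deriv f u * x) x = deriv f x - deriv f u := by
        have h2 := (hd0 x).hasDerivAt.fun_sub ((hasDerivAt_id x).const_mul (deriv f u))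
        simpa using h2.deriv
      rw [h1]
      refine (hl1 x u).trans (mul_le_mul_of_nonneg_left ?_ hC2)
      have := Set.abs_sub_left_of_mem_uIcc hx
      simpa using this
    have := Convex.norm_image_sub_le_of_norm_deriv_le hdg hder (convex_uIcc u (u + h))
      Set.left_mem_uIcc Set.right_mem_uIcc
    rw [Real.norm_eq_abs, add_sub_cancel_left, Real.norm_eq_abs] at this
    calc _ = |f (u + h) - deriv f u * (u + h) - (f u - deriv f u * u)| := by congr 1; ring
      _ ≤ C2 * |h| * |h| := this
      _ = C2 * h ^ 2 := by rw [mul_assoc, ← sq, sq_abs]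
  -- Compressing the step to width `δ` multiplies the first derivative by `1 / δ` and the second by
  -- `1 / δ ^ 2`.
  set C := max 1 (max (C1 / δ) (C2 / δ ^ 2))
  have e1 : (1 : ℝ) ≤ C := le_max_left _ _
  have e2 : C1 / δ ≤ C := (le_max_left _ _).trans (le_max_right _ _)
  have e3 : C2 / δ ^ 2 ≤ C := (le_max_right _ _).trans (le_max_right _ _)
  refine ⟨C, fun u => f ((u - a) / δ), fun u => deriv f ((u - a) / δ) / δ,
    ⟨zero_le_one.trans e1, fun u => ?_, fun u => ?_, fun u v => ?_, fun u h => ?_⟩,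
    fun u => Real.smoothTransition.nonneg _, fun u => Real.smoothTransition.le_one _,
    fun u hu => ?_, fun u hu => ?_⟩
  · rw [abs_of_nonneg (Real.smoothTransition.nonneg _)]
    exact (Real.smoothTransition.le_one _).trans e1
  · rw [abs_div, abs_of_pos hδ]
    exact (div_le_div_of_nonneg_right (hb1 _) hδ.le).trans e2
  · have := hl0 ((u - a) / δ) ((v - a) / δ)
    rw [← sub_div, sub_sub_sub_cancel_right, abs_div, abs_of_pos hδ] at this
    calc _ ≤ C1 * (|u - v| / δ) := this
      _ = C1 / δ * |u - v| := by ring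
      _ ≤ _ := mul_le_mul_of_nonneg_right e2 (abs_nonneg _)
  · have := htay ((u - a) / δ) (h / δ)
    rw [← add_div, show u - a + h = u + h - a by ring] at this
    calc _ = |f ((u + h - a) / δ) - f ((u - a) / δ) - deriv f ((u - a) / δ) * (h / δ)| := by
          congr 1; ring
      _ ≤ C2 * (h / δ) ^ 2 := this
      _ = C2 / δ ^ 2 * h ^ 2 := by ring
      _ ≤ _ := mul_le_mul_of_nonneg_right e3 (sq_nonneg _)
  · exact Real.smoothTransition.zero_of_nonpos (div_nonpos_of_nonpos_of_nonneg (by linarith) hδ.le)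
  · refine Real.smoothTransition.one_of_one_le ?_
    rw [le_div_iff₀ hδ]; linarith

/-! ### Exchanging the samples one at a time -/

section Lindeberg

variable {ι Z : Type*} [Fintype ι] [DecidableEq ι] [MeasurableSpace Z]

/-- Resampling coordinate `i` replaces the `i`-th factor. The factors may differ, as they do in the
hybrid laws between the two samples. -/
theorem measurePreserving_update (μ : ι → Measure Z) [∀ i, IsProbabilityMeasure (μ i)]
    (ν : Measure Z) [IsProbabilityMeasure ν] (i : ι) :
    MeasurePreserving (fun q : (ι → Z) × Z => Function.update q.1 i q.2)
      ((Measure.pi μ).prod ν) (Measure.pi (Function.update μ i ν)) := by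
  have hm : Measurable fun q : (ι → Z) × Z => Function.update q.1 i q.2 := by
    refine measurable_pi_iff.2 fun j => ?_
    rcases eq_or_ne j i with rfl | h
    · simpa using measurable_snd
    · simp only [Function.update_of_ne h]
      exact (measurable_pi_apply j).comp measurable_fst
  refine ⟨hm, ?_⟩
  have : ∀ j, IsProbabilityMeasure (Function.update μ i ν j) := by
    intro j
    rcases eq_or_ne j i with rfl | h
    · simpa
    · rw [Function.update_of_ne h]; infer_instance
  symm
  apply Measure.pi_eq
  intro s hs
  rw [Measure.map_apply hm (MeasurableSet.univ_pi hs)]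
  have hpre : (fun q : (ι → Z) × Z => Function.update q.1 i q.2) ⁻¹' (Set.univ.pi s) =
      (Set.univ.pi (Function.update s i Set.univ)) ×ˢ s i := by
    ext ⟨z, w⟩
    simp only [Set.mem_preimage, Set.mem_univ_pi, Set.mem_prod]
    constructor
    · intro h
      refine ⟨fun j => ?_, by simpa using h i⟩
      rcases eq_or_ne j i with rfl | hj
      · simp
      · simpa [Function.update_of_ne hj] using h j
    · rintro ⟨h, hw⟩ j
      rcases eq_or_ne j i with rfl | hj
      · simpa using hw
      · simpa [Function.update_of_ne hj] using h j
  rw [hpre, Measure.prod_prod, Measure.pi_pi, ← Finset.mul_prod_erase _ _ (Finset.mem_univ i),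
    ← Finset.mul_prod_erase _ (fun j => (Function.update μ i ν j) (s j)) (Finset.mem_univ i)]
  simp only [Function.update_self, measure_univ, one_mul]
  rw [mul_comm]
  congr 1
  refine Finset.prod_congr rfl fun j hj => ?_
  rw [Function.update_of_ne (Finset.ne_of_mem_erase hj),
    Function.update_of_ne (Finset.ne_of_mem_erase hj)]

theorem integral_pi_update (μ : ι → Measure Z) [∀ i, IsProbabilityMeasure (μ i)]
    (ν : Measure Z) [IsProbabilityMeasure ν] (i : ι) {F : (ι → Z) → ℝ} (hF : Measurable F)
    {B : ℝ} (hB : ∀ z, |F z| ≤ B) :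
    ∫ z, F z ∂(Measure.pi (Function.update μ i ν)) =
      ∫ z, ∫ u, F (Function.update z i u) ∂ν ∂(Measure.pi μ) := by
  have hmp := measurePreserving_update μ ν i
  rw [← hmp.map_eq, integral_map hmp.measurable.aemeasurable hF.aestronglyMeasurable,
    integral_prod]
  exact (integrable_const B).mono' (hF.comp hmp.measurable).aestronglyMeasurable
    (ae_of_all _ fun q => hB _)

/-- The Lindeberg replacement principle. -/
theorem abs_integral_pi_sub_le (ν ν' : Measure Z) [IsProbabilityMeasure ν]
    [IsProbabilityMeasure ν'] {F : (ι → Z) → ℝ} (hF : Measurable F) {B : ℝ}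
    (hB : ∀ z, |F z| ≤ B) {c : ℝ}
    (hc : ∀ z i, |∫ u, F (Function.update z i u) ∂ν - ∫ u, F (Function.update z i u) ∂ν'| ≤ c) :
    |∫ z, F z ∂(Measure.pi fun _ : ι => ν) - ∫ z, F z ∂(Measure.pi fun _ : ι => ν')| ≤
      Fintype.card ι * c := by
  have key : ∀ s : Finset ι, |∫ z, F z ∂(Measure.pi fun _ : ι => ν) -
      ∫ z, F z ∂(Measure.pi fun i : ι => if i ∈ s then ν' else ν)| ≤ s.card * c := by
    intro s
    induction s using Finset.induction_on with
    | empty => simp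
    | insert i s hi ih =>
      set μ : ι → Measure Z := fun i => if i ∈ s then ν' else ν with hμ
      have hp : ∀ j, IsProbabilityMeasure (μ j) := by
        intro j; rw [hμ]; dsimp only; split_ifs <;> infer_instance
      have h1 : (fun j : ι => if j ∈ insert i s then ν' else ν) = Function.update μ i ν' := by
        funext j
        rcases eq_or_ne j i with rfl | h
        · simp
        · simp [hμ, h]
      -- Coordinate `i` still has law `ν`. Writing `μ` as its own update puts both hybrid integrals
      -- over the same outer measure, where `hc` compares the inner ones.
      have h2 : μ = Function.update μ i ν := by
        funext j
        rcases eq_or_ne j i with rfl | h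
        · simp [hμ, hi]
        · simp [Function.update_of_ne h]
      have hint : ∀ (ξ : Measure Z) [IsProbabilityMeasure ξ],
          Integrable (fun z => ∫ u, F (Function.update z i u) ∂ξ) (Measure.pi μ) := by
        intro ξ _
        refine Integrable.integral_prod_left (f := fun q : (ι → Z) × Z =>
          F (Function.update q.1 i q.2)) ?_
        exact (integrable_const B).mono'
          (hF.comp (measurePreserving_update μ ξ i).measurable).aestronglyMeasurable
          (ae_of_all _ fun q => hB _)
      have h3 : |∫ z, F z ∂(Measure.pi μ) - ∫ z, F z ∂(Measure.pi (Function.update μ i ν'))| ≤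
          c := by
        have e1 := integral_pi_update μ ν i hF hB
        rw [← h2] at e1
        rw [e1, integral_pi_update μ ν' i hF hB, ← integral_sub (hint ν) (hint ν')]
        have := norm_integral_le_of_norm_le_const (μ := Measure.pi μ) (C := c)
          (f := fun z => ∫ u, F (Function.update z i u) ∂ν - ∫ u, F (Function.update z i u) ∂ν')
          (ae_of_all _ fun z => hc z i)
        rwa [probReal_univ, mul_one] at this
      rw [h1, Finset.card_insert_of_notMem hi]
      push_cast
      have := abs_sub_le (∫ z, F z ∂(Measure.pi fun _ : ι => ν)) (∫ z, F z ∂(Measure.pi μ))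
        (∫ z, F z ∂(Measure.pi (Function.update μ i ν')))
      linarith
  simpa using key Finset.univ

end Lindeberg

/-- The offsets tilt the weights to the Gibbs weights `w i * exp (-β * c i) / T`, which do not
depend on `d`. -/
theorem softMin_add {ι : Type*} [Fintype ι] {β : ℝ} {w : ι → ℝ}
    (hw : ∀ i, 0 ≤ w i) (hw1 : ∑ i, w i = 1) (c : ι → ℝ) :
    ∃ w' : ι → ℝ, (∀ i, 0 ≤ w' i) ∧ ∑ i, w' i = 1 ∧
      (∀ d, softMin β w (fun i => c i + d i) = softMin β w c + softMin β w' d) := by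
  set T := ∑ i, w i * Real.exp (-β * c i) with hT
  have hTpos : 0 < T := partition_pos hw hw1
  have hw' : ∀ i, 0 ≤ w i * Real.exp (-β * c i) / T := fun i =>
    div_nonneg (mul_nonneg (hw i) (Real.exp_pos _).le) hTpos.le
  have hw1' : ∑ i, w i * Real.exp (-β * c i) / T = 1 := by
    rw [← Finset.sum_div, div_self hTpos.ne']
  refine ⟨fun i => w i * Real.exp (-β * c i) / T, hw', hw1', fun d => ?_⟩
  have h : ∑ i, w i * Real.exp (-β * (c i + d i)) =
      T * ∑ i, w i * Real.exp (-β * c i) / T * Real.exp (-β * d i) := by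
    rw [Finset.mul_sum]
    refine Finset.sum_congr rfl fun i _ => ?_
    rw [mul_add, Real.exp_add]
    field_simp
  rw [softMin, softMin, softMin, h, Real.log_mul hTpos.ne' (partition_pos hw' hw1').ne']
  ring

/-- Universality of smooth statistics of a soft minimum of sums of losses over a sample. -/
theorem abs_integral_softMin_sum_sub_le {ι Z : Type*} [Fintype ι] [MeasurableSpace Z]
    {ν ν' : Measure Z} [IsProbabilityMeasure ν] [IsProbabilityMeasure ν'] {β A C ε : ℝ}
    (hβ : 0 < β) {ψ D : ℝ → ℝ} (hψ : IsSmoothTest C ψ D) {l : ι → Z → ℝ}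
    (hl : ∀ i, Measurable (l i)) (hl0 : ∀ i z, 0 ≤ l i z)
    (hν : ∀ i, Integrable (fun z => l i z ^ 2) ν ∧ ∫ z, l i z ^ 2 ∂ν ≤ A)
    (hν' : ∀ i, Integrable (fun z => l i z ^ 2) ν' ∧ ∫ z, l i z ^ 2 ∂ν' ≤ A)
    (hε : ∀ w : ι → ℝ, (∀ i, 0 ≤ w i) → ∑ i, w i = 1 →
      |∫ z, softMin β w (fun i => l i z) ∂ν - ∫ z, softMin β w (fun i => l i z) ∂ν'| ≤ ε)
    {w : ι → ℝ} (hw : ∀ i, 0 ≤ w i) (hw1 : ∑ i, w i = 1) (b : ι → ℝ) {n : ℕ} (hn : 0 < n) :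
    |∫ z, ψ (1 / n * softMin β w fun i => b i + ∑ a, l i (z a)) ∂(Measure.pi fun _ : Fin n => ν) -
      ∫ z, ψ (1 / n * softMin β w fun i => b i + ∑ a, l i (z a))
        ∂(Measure.pi fun _ : Fin n => ν')| ≤ C * ε + 2 * C * A / n := by
  have hn' : (0 : ℝ) < n := by exact_mod_cast hn
  have hψc := hψ.continuous
  have hmF : Measurable fun z : Fin n → Z => ψ (1 / n * softMin β w fun i => b i + ∑ a, l i (z a)) := by
    refine hψc.measurable.comp (Measurable.const_mul (measurable_softMin fun i => ?_) _)
    fun_prop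
  -- Cost of one exchange: a first-order part of order `ε / n` and two Taylor remainders of order `1
  -- / n ^ 2`; there are `n` exchanges.
  have hstep := abs_integral_pi_sub_le ν ν' hmF (B := C) (fun z => hψ.bound _)
    (c := C * ε / n + 2 * C * A / n ^ 2) (fun z j => ?_)
  · refine hstep.trans_eq ?_
    rw [Fintype.card_fin]
    field_simp
  -- With all samples except the `j`-th frozen, their losses are offsets. Only the soft minimum `L`
  -- of the losses of sample `j`, under tilted weights, is still random.
  · obtain ⟨w', hw', hw1', hadd⟩ := softMin_add (β := β) hw hw1
      (fun i => b i + ∑ a ∈ Finset.univ.erase j, l i (z a))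
    set c0 := softMin β w (fun i => b i + ∑ a ∈ Finset.univ.erase j, l i (z a)) with hc0
    set L : Z → ℝ := fun u => softMin β w' fun i => l i u with hL
    have hF : ∀ u, (1 / n * softMin β w fun i => b i + ∑ a, l i (Function.update z j u a)) =
        1 / n * c0 + 1 / n * L u := by
      intro u
      rw [← mul_add, hL, hc0, ← hadd]
      congr 2
      funext i
      rw [← Finset.add_sum_erase _ _ (Finset.mem_univ j), Function.update_self, add_assoc]
      congr 1
      rw [add_comm]
      congr 1
      exact Finset.sum_congr rfl fun a ha => by
        rw [Function.update_of_ne (Finset.ne_of_mem_erase ha)]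
    simp only [hF]
    have hmL : Measurable L := measurable_softMin hl
    have htay : ∀ (ξ : Measure Z) [IsProbabilityMeasure ξ],
        (∀ i, Integrable (fun z => l i z ^ 2) ξ ∧ ∫ z, l i z ^ 2 ∂ξ ≤ A) →
        |∫ u, ψ (1 / n * c0 + 1 / n * L u) ∂ξ -
          (ψ (1 / n * c0) + D (1 / n * c0) * (1 / n) * ∫ u, L u ∂ξ)| ≤ C * A / n ^ 2 := by
      intro ξ _ hξ
      obtain ⟨hi2, hle2⟩ := integrable_softMin_sq hβ hw' hw1' hl hl0 hξ
      have hi1 : Integrable L ξ := integrable_of_sq hmL.aestronglyMeasurable hi2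
      have hiψ : Integrable (fun u => ψ (1 / n * c0 + 1 / n * L u)) ξ :=
        (integrable_const C).mono'
          (hψc.measurable.comp ((hmL.const_mul _).const_add _)).aestronglyMeasurable
          (ae_of_all _ fun u => hψ.bound _)
      have hic : Integrable (fun u => ψ (1 / n * c0) + D (1 / n * c0) * (1 / n) * L u) ξ :=
        (integrable_const _).add (hi1.const_mul _)
      have e : ψ (1 / n * c0) + D (1 / n * c0) * (1 / n) * ∫ u, L u ∂ξ =
          ∫ u, (ψ (1 / n * c0) + D (1 / n * c0) * (1 / n) * L u) ∂ξ := by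
        rw [integral_add (integrable_const _) (hi1.const_mul _), integral_const_mul,
          integral_const, probReal_univ, one_smul]
      rw [e, ← integral_sub hiψ hic]
      refine abs_integral_le_integral_abs.trans ?_
      refine (integral_mono (hiψ.sub hic).abs (hi2.const_mul (C / n ^ 2)) fun u => ?_).trans ?_
      · have := hψ.taylor (1 / n * c0) (1 / n * L u)
        refine le_trans (le_of_eq ?_) (this.trans (le_of_eq ?_))
        · simp only [Pi.sub_apply]
          congr 1; ring
        · simp only [hL]; ring
      · rw [integral_const_mul, div_mul_eq_mul_div]
        exact div_le_div_of_nonneg_right (mul_le_mul_of_nonneg_left hle2 hψ.nonneg) (by positivity)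
    have h1 := htay ν hν
    have h2 := htay ν' hν'
    have h3 : |D (1 / n * c0) * (1 / n) * (∫ u, L u ∂ν - ∫ u, L u ∂ν')| ≤ C * ε / n := by
      rw [abs_mul, abs_mul, abs_of_pos (a := 1 / (n : ℝ)) (by positivity)]
      calc _ ≤ C * (1 / n) * ε :=
            mul_le_mul (mul_le_mul_of_nonneg_right (hψ.bound_deriv _) (by positivity))
              (hε w' hw' hw1') (abs_nonneg _) (mul_nonneg hψ.nonneg (by positivity))
        _ = C * ε / n := by ring
    have e4 : 2 * C * A / n ^ 2 = C * A / n ^ 2 + C * A / n ^ 2 := by ring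
    rw [mul_sub] at h3
    rw [abs_le] at *
    constructor <;> linarith [h1.1, h1.2, h2.1, h2.2, h3.1, h3.2]

/-! ### Nets for the gauge of a symmetric convex set -/

section Packing

open scoped Pointwise

variable {E : Type*} [NormedAddCommGroup E] [NormedSpace ℝ E] [FiniteDimensional ℝ E]

/-- A subset of `S` is separated at scale `a` if the differences of its distinct elements do not
belong to `a • S`. -/
def GaugeSeparated (S : Set E) (a : ℝ) (N : Finset E) : Prop :=
  (N : Set E) ⊆ S ∧ (N : Set E).Pairwise fun x y => x - y ∉ a • S

/-- Volume packing: by symmetry and convexity the translates of `(a / 2) • interior S` by the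
separated points are disjoint, and all lie in `(1 + a / 2) • interior S`. The Haar measures then
compare. -/
theorem card_le_of_gaugeSeparated_of_interior [MeasurableSpace E] [BorelSpace E] {S : Set E}
    (hconv : Convex ℝ S)
    (hsymm : ∀ x ∈ S, -x ∈ S) (hbdd : Bornology.IsBounded S) (hint : (interior S).Nonempty)
    {a : ℝ} (ha : 0 < a) {N : Finset E} (hN : GaugeSeparated S a N) :
    (N.card : ℝ) ≤ (1 + 2 / a) ^ Module.finrank ℝ E := by
  set d := Module.finrank ℝ E
  set U := interior S
  have hUo : IsOpen U := isOpen_interior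
  let μ : Measure E := Measure.addHaar
  have hpos : 0 < μ U := hUo.measure_pos μ hint
  have hfin : μ U ≠ ∞ := (hbdd.subset interior_subset).measure_lt_top.ne
  have hdisj : (N : Set E).PairwiseDisjoint fun x => x +ᵥ ((a / 2) • U) := by
    intro x hx y hy hxy
    refine Set.disjoint_left.2 fun v hv hv' => hN.2 hx hy hxy ?_
    obtain ⟨_, ⟨u, hu, rfl⟩, rfl⟩ := hv
    obtain ⟨_, ⟨u', hu', rfl⟩, h⟩ := hv'
    simp only [vadd_eq_add] at h
    refine ⟨(1 / 2 : ℝ) • u' + (1 / 2 : ℝ) • (-u),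
      hconv (interior_subset hu') (hsymm _ (interior_subset hu)) (by norm_num) (by norm_num)
        (by norm_num), ?_⟩
    have h' : x - y = (a / 2) • u' - (a / 2) • u := by
      rw [sub_eq_sub_iff_add_eq_add, ← h, add_comm]
    rw [h']
    dsimp only
    module
  have hsub : (⋃ x ∈ N, x +ᵥ ((a / 2) • U)) ⊆ (1 + a / 2) • U := by
    refine Set.iUnion₂_subset fun x hx => ?_
    rintro _ ⟨_, ⟨u, hu, rfl⟩, rfl⟩
    have hden : (0 : ℝ) < 1 + a / 2 := by positivity
    refine ⟨(1 / (1 + a / 2)) • x + ((a / 2) / (1 + a / 2)) • u,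
      hconv.combo_self_interior_mem_interior (hN.1 hx) hu (by positivity) (by positivity) ?_, ?_⟩
    · field_simp
    · simp only [vadd_eq_add]
      rw [smul_add, smul_smul, smul_smul, mul_one_div_cancel hden.ne', mul_div_cancel₀ _ hden.ne',
        one_smul]
  have hm := measure_mono (μ := μ) hsub
  rw [measure_biUnion_finset hdisj fun x _ =>
    ((hUo.smul₀ (by positivity : a / 2 ≠ 0)).vadd x).measurableSet] at hm
  simp only [measure_vadd, Measure.addHaar_smul, Finset.sum_const, nsmul_eq_mul] at hm
  rw [← mul_assoc] at hm
  have hm2 := (ENNReal.mul_le_mul_iff_left hpos.ne' hfin).1 hm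
  rw [← ENNReal.ofReal_natCast, ← ENNReal.ofReal_mul (by positivity),
    ENNReal.ofReal_le_ofReal_iff (abs_nonneg _), abs_of_pos (by positivity),
    abs_of_pos (by positivity)] at hm2
  have : (1 + 2 / a) ^ d = (1 + a / 2) ^ d / (a / 2) ^ d := by
    rw [← div_pow]; congr 1; field_simp; ring
  rw [this, le_div_iff₀ (by positivity)]
  exact hm2

/-- `S` may have empty interior. In its linear span it does not, and passing to the span only lowers
the dimension in the bound. -/
theorem card_le_of_gaugeSeparated {S : Set E} (hconv : Convex ℝ S) (h0 : (0 : E) ∈ S)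
    (hsymm : ∀ x ∈ S, -x ∈ S) (hbdd : Bornology.IsBounded S)
    {a : ℝ} (ha : 0 < a) {N : Finset E} (hN : GaugeSeparated S a N) :
    (N.card : ℝ) ≤ (1 + 2 / a) ^ Module.finrank ℝ E := by
  let V := Submodule.span ℝ S
  borelize ↥V
  let S' : Set V := Subtype.val ⁻¹' S
  have hS' : S' = V.subtype ⁻¹' S := rfl
  have himg : V.subtype '' S' = S := by
    rw [hS', Set.image_preimage_eq_iff]
    intro x hx
    exact ⟨⟨x, Submodule.subset_span hx⟩, rfl⟩
  have hconv' : Convex ℝ S' := hconv.linear_preimage V.subtype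
  have hint : (interior S').Nonempty := by
    rw [hconv'.interior_nonempty_iff_affineSpan_eq_top]
    have h0' : (0 : V) ∈ S' := h0
    apply (AffineSubspace.affineSpan_eq_top_iff_vectorSpan_eq_top_of_nonempty ℝ V V ⟨0, h0'⟩).2
    rw [vectorSpan_eq_span_vsub_set_right ℝ h0']
    have h1 : (fun x : V => x -ᵥ (0 : V)) '' S' = S' := by simp
    rw [h1]
    apply Submodule.map_injective_of_injective V.injective_subtype
    rw [Submodule.map_span, himg, Submodule.map_top, Submodule.range_subtype]
  have hbdd' : Bornology.IsBounded S' := by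
    obtain ⟨r, hr⟩ := hbdd.exists_norm_le
    exact isBounded_iff_forall_norm_le.2 ⟨r, fun x hx => hr x hx⟩
  classical
  let N' : Finset V := N.attach.image fun x => ⟨x.1, Submodule.subset_span (hN.1 x.2)⟩
  have hmem : ∀ x : V, x ∈ N' → (x : E) ∈ N := by
    intro x hx
    obtain ⟨y, -, rfl⟩ := Finset.mem_image.1 hx
    exact y.2
  have hcard : N'.card = N.card := by
    rw [Finset.card_image_of_injective _ (fun x y h => Subtype.ext (by simpa using h)),
      Finset.card_attach]
  have hN' : GaugeSeparated S' a N' := by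
    refine ⟨fun x hx => hN.1 (hmem x hx), fun x hx y hy hxy => ?_⟩
    rintro ⟨s, hs, h⟩
    refine hN.2 (hmem x hx) (hmem y hy) (fun h => hxy (Subtype.ext h)) ⟨s, hs, ?_⟩
    have := congrArg Subtype.val h
    simpa using this
  have := card_le_of_gaugeSeparated_of_interior hconv' (fun x hx => hsymm x hx) hbdd' hint ha hN'
  rw [hcard] at this
  refine this.trans (pow_le_pow_right₀ ?_ (Submodule.finrank_le V))
  have : 0 < 2 / a := by positivity
  linarith

/-- Subsets of a bounded symmetric convex set `S` have finite nets with respect to the gauge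
of `S`, of at most exponential size in the dimension. -/
theorem exists_gauge_net {S : Set E} (hconv : Convex ℝ S) (h0 : (0 : E) ∈ S)
    (hsymm : ∀ x ∈ S, -x ∈ S) (hbdd : Bornology.IsBounded S)
    {a : ℝ} (ha : 0 < a) {T : Set E} (hT : T ⊆ S) :
    ∃ N : Finset E, (N : Set E) ⊆ T ∧ (∀ x ∈ T, ∃ y ∈ N, ∃ s ∈ S, x - y = a • s) ∧
      (N.card : ℝ) ≤ (1 + 2 / a) ^ Module.finrank ℝ E := by
  classical
  let Q : Set ℕ := {m | ∃ N : Finset E, (N : Set E) ⊆ T ∧ GaugeSeparated S a N ∧ N.card = m}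
  have hne : Q.Nonempty := ⟨0, ∅, by simp, ⟨by simp, by simp⟩, rfl⟩
  have hbd : BddAbove Q := by
    refine ⟨⌊(1 + 2 / a) ^ Module.finrank ℝ E⌋₊, ?_⟩
    rintro _ ⟨N, -, hN, rfl⟩
    exact Nat.le_floor (card_le_of_gaugeSeparated hconv h0 hsymm hbdd ha hN)
  -- A separated subset of `T` of maximal cardinality is a net: an uncovered point could be added to
  -- it.
  obtain ⟨N, hNT, hN, hcard⟩ := Nat.sSup_mem hne hbd
  refine ⟨N, hNT, fun x hx => ?_, card_le_of_gaugeSeparated hconv h0 hsymm hbdd ha hN⟩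
  by_contra! hcon
  have hxN : x ∉ N := fun h => hcon x h 0 h0 (by simp)
  have hx1 : ∀ y ∈ N, x - y ∉ a • S := by
    rintro y hy ⟨s, hs, h⟩
    exact hcon y hy s hs h.symm
  have hx2 : ∀ y ∈ N, y - x ∉ a • S := by
    rintro y hy ⟨s, hs, h⟩
    refine hcon y hy (-s) (hsymm s hs) ?_
    rw [smul_neg, ← neg_sub y x, ← h]
  have : (insert x N).card ∈ Q := by
    refine ⟨insert x N, ?_, ⟨?_, ?_⟩, rfl⟩
    · rw [Finset.coe_insert]; exact Set.insert_subset hx hNT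
    · rw [Finset.coe_insert]; exact Set.insert_subset (hT hx) hN.1
    · rw [Finset.coe_insert]
      exact hN.2.insert fun y hy _ => ⟨hx1 y hy, hx2 y hy⟩
  have hle := le_csSup hbd this
  rw [Finset.card_insert_of_notMem hxN, hcard] at hle
  omega

end Packing

/-! ### Control of the empirical first moments -/

/-- Jensen's inequality, through the tangent of the logarithm at `m`; `1 ≤ Y` makes the logarithm
integrable. -/
theorem integral_log_le {Ω : Type*} [MeasurableSpace Ω] {P : Measure Ω} [IsProbabilityMeasure P]
    {Y : Ω → ℝ} (hY : Integrable Y P) (h1 : ∀ ω, 1 ≤ Y ω) {m : ℝ} (hm : 0 < m)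
    (hle : ∫ ω, Y ω ∂P ≤ m) :
    Integrable (fun ω => Real.log (Y ω)) P ∧ ∫ ω, Real.log (Y ω) ∂P ≤ Real.log m := by
  have hi : Integrable (fun ω => Real.log (Y ω)) P := by
    refine hY.mono' (Real.measurable_log.comp_aemeasurable hY.aemeasurable).aestronglyMeasurable
      (ae_of_all _ fun ω => ?_)
    rw [Real.norm_of_nonneg (Real.log_nonneg (h1 ω))]
    exact Real.log_le_self (zero_le_one.trans (h1 ω))
  have hpt : ∀ ω, Real.log (Y ω) ≤ Y ω / m + (Real.log m - 1) := by
    intro ω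
    have hpos := zero_lt_one.trans_le (h1 ω)
    have := Real.log_le_sub_one_of_pos (div_pos hpos hm)
    rw [Real.log_div hpos.ne' hm.ne'] at this
    linarith
  refine ⟨hi, (integral_mono hi ((hY.div_const m).add (integrable_const _)) hpt).trans ?_⟩
  have e := integral_add' (hY.div_const m) (integrable_const (μ := P) (Real.log m - 1))
  refine e.le.trans ?_
  rw [integral_div, integral_const, probReal_univ, one_smul]
  have : (∫ ω, Y ω ∂P) / m ≤ 1 := (div_le_one hm).2 hle
  linarith

namespace ERMModel.Assumptions

variable {k kstar : ℕ} {M : ERMModel k kstar} {R : ℝ} {K : ℝ≥0} {Kr : ℝ → ℝ≥0}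

theorem isBounded_S (hM : M.Assumptions R K Kr) (p : ℕ) : Bornology.IsBounded (M.S p) :=
  Metric.isBounded_closedBall.subset (hM.S_subset p)

/-- The empirical first absolute moments of all projections along `S_p` are dominated by a single
random variable with bounded expectation. -/
theorem exists_dominating (hM : M.Assumptions R K Kr) {p n : ℕ} (hn : 0 < n)
    {μ : Measure (Feat p)} [IsProbabilityMeasure μ]
    (hμ : ∀ s ∈ M.S p, ExpBound hM.rate μ fun x => ⟪s, x⟫) :
    ∃ H : (Fin n → Feat p × ℝ) → ℝ,
      Integrable H (Measure.pi fun _ => μ.prod M.lawE) ∧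
      (∀ z, ∀ s ∈ M.S p, 1 / (n : ℝ) * ∑ a, |⟪s, (z a).1⟫| ≤ H z) ∧
      ∫ z, H z ∂(Measure.pi fun _ => μ.prod M.lawE) ≤
        2 / hM.rate * (p / n * Real.log 5 + Real.log 6) := by
  have := hM.lawE_prob
  have hn' : (0 : ℝ) < n := by exact_mod_cast hn
  have hc := hM.rate_pos
  set c := hM.rate
  obtain ⟨N, hNS, hnet, hcard⟩ := exists_gauge_net (hM.S_convex p) (hM.zero_mem p) (hM.S_symm p)
    (hM.isBounded_S p) (a := 1 / 2) (by norm_num) subset_rfl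
  have hcard' : (N.card : ℝ) ≤ 5 ^ p := by
    rw [finrank_euclideanSpace_fin] at hcard
    convert! hcard using 2
    norm_num
  obtain ⟨t₀, ht₀, -⟩ := hnet 0 (hM.zero_mem p)
  -- A sum over the net dominates the maximum over it. Its mean is at most `5 ^ p * 6 ^ n`, where `5
  -- = 1 + 2 / (1 / 2)`, so its logarithm has mean of order `p + n`.
  set Y : (Fin n → Feat p × ℝ) → ℝ := fun z => ∑ s ∈ N, ∏ a, Real.exp (c * |⟪s, (z a).1⟫|)
    with hY
  have hterm : ∀ z, ∀ s ∈ N, ∏ a, Real.exp (c * |⟪s, (z a).1⟫|) ≤ Y z := fun z s hs =>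
    Finset.single_le_sum (f := fun s => ∏ a, Real.exp (c * |⟪s, (z a).1⟫|))
      (fun t _ => Finset.prod_nonneg fun a _ => (Real.exp_pos _).le) hs
  have hY1 : ∀ z, 1 ≤ Y z := by
    intro z
    refine le_trans ?_ (hterm z t₀ ht₀)
    rw [← Real.exp_sum]
    exact Real.one_le_exp (Finset.sum_nonneg fun a _ => by positivity)
  have hif : ∀ s ∈ N, Integrable (fun u : Feat p × ℝ => Real.exp (c * |⟪s, u.1⟫|))
      (μ.prod M.lawE) := fun s hs => (hμ s (hNS hs)).2.1.comp_fst M.lawE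
  have hip : ∀ s ∈ N, Integrable (fun z : Fin n → Feat p × ℝ =>
      ∏ a, Real.exp (c * |⟪s, (z a).1⟫|)) (Measure.pi fun _ => μ.prod M.lawE) := fun s hs =>
    Integrable.fintype_prod (f := fun (_ : Fin n) (u : Feat p × ℝ) => Real.exp (c * |⟪s, u.1⟫|))
      fun _ => hif s hs
  have hYi : Integrable Y (Measure.pi fun _ => μ.prod M.lawE) := integrable_finsetSum _ hip
  have hYm : ∫ z, Y z ∂(Measure.pi fun _ => μ.prod M.lawE) ≤ 5 ^ p * 6 ^ n := by
    rw [hY, integral_finsetSum _ hip]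
    calc _ ≤ ∑ s ∈ N, (6 : ℝ) ^ n := by
          refine Finset.sum_le_sum fun s hs => ?_
          rw [integral_fintype_prod_eq_prod (𝕜 := ℝ)
            (f := fun (_ : Fin n) (u : Feat p × ℝ) => Real.exp (c * |⟪s, u.1⟫|))]
          have e := integral_fun_fst (μ := μ) (ν := M.lawE) fun x => Real.exp (c * |⟪s, x⟫|)
          rw [probReal_univ, one_smul] at e
          rw [e, Finset.prod_const, Finset.card_univ, Fintype.card_fin]
          exact pow_le_pow_left₀ (integral_nonneg fun x => (Real.exp_pos _).le)
            (hμ s (hNS hs)).2.2 n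
      _ = N.card * 6 ^ n := by rw [Finset.sum_const, nsmul_eq_mul]
      _ ≤ 5 ^ p * 6 ^ n := by gcongr
  obtain ⟨hlogi, hlogle⟩ := integral_log_le hYi hY1 (by positivity) hYm
  -- The dominating variable is built from the finite sum `Y`, so the measurability of a supremum
  -- over `S_p` never arises.
  refine ⟨fun z => 2 / (c * n) * Real.log (Y z), hlogi.const_mul _, ?_, ?_⟩
  · intro z
    set F : Feat p → ℝ := fun s => 1 / (n : ℝ) * ∑ a, |⟪s, (z a).1⟫| with hF
    have hFN : ∀ s ∈ N, F s ≤ 1 / (c * n) * Real.log (Y z) := by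
      intro s hs
      have h1 := hterm z s hs
      rw [← Real.exp_sum, ← Finset.mul_sum] at h1
      have h2 := (Real.le_log_iff_exp_le (zero_lt_one.trans_le (hY1 z))).2 h1
      calc F s = 1 / (c * n) * (c * ∑ a, |⟪s, (z a).1⟫|) := by rw [hF]; field_simp
        _ ≤ _ := mul_le_mul_of_nonneg_left h2 (by positivity)
    have hFadd : ∀ s t : Feat p, F (s + t) ≤ F s + F t := by
      intro s t
      rw [hF, ← mul_add, ← Finset.sum_add_distrib]
      refine mul_le_mul_of_nonneg_left (Finset.sum_le_sum fun a _ => ?_) (by positivity)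
      rw [inner_add_left]; exact abs_add_le _ _
    have hFsmul : ∀ (b : ℝ) (s : Feat p), F (b • s) = |b| * F s := by
      intro b s
      simp only [hF, real_inner_smul_left, abs_mul, ← Finset.mul_sum]
      ring
    have hbdd : BddAbove (F '' M.S p) := by
      refine ⟨1 / (n : ℝ) * ∑ a, R * ‖(z a).1‖, ?_⟩
      rintro _ ⟨s, hs, rfl⟩
      refine mul_le_mul_of_nonneg_left (Finset.sum_le_sum fun a _ => ?_) (by positivity)
      refine (abs_real_inner_le_norm _ _).trans (mul_le_mul_of_nonneg_right ?_ (norm_nonneg _))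
      simpa using hM.S_subset p hs
    set W := sSup (F '' M.S p) with hW
    have hFW : ∀ s ∈ M.S p, F s ≤ W := fun s hs => le_csSup hbdd ⟨s, hs, rfl⟩
    -- The half-net leaves a remainder of at most half the supremum, which is finite and can be
    -- absorbed; hence the factor `2` in the dominating variable.
    have hWle : W ≤ 1 / (c * n) * Real.log (Y z) + 1 / 2 * W := by
      refine csSup_le ((hM.S_nonempty p).image F) ?_
      rintro _ ⟨s, hs, rfl⟩
      obtain ⟨t, ht, u, hu, h⟩ := hnet s hs
      have hst : s = t + (1 / 2 : ℝ) • u := by rw [← h]; abel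
      rw [hst]
      refine (hFadd _ _).trans (add_le_add (hFN t ht) ?_)
      rw [hFsmul, abs_of_pos (by norm_num : (0 : ℝ) < 1 / 2)]
      exact mul_le_mul_of_nonneg_left (hFW u hu) (by norm_num)
    intro s hs
    refine (hFW s hs).trans ?_
    have : 2 / (c * n) * Real.log (Y z) = 2 * (1 / (c * n) * Real.log (Y z)) := by ring
    linarith
  · rw [integral_const_mul]
    rw [Real.log_mul (by positivity) (by positivity), Real.log_pow, Real.log_pow] at hlogle
    calc _ ≤ 2 / (c * n) * (p * Real.log 5 + n * Real.log 6) :=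
          mul_le_mul_of_nonneg_left hlogle (by positivity)
      _ = _ := by field_simp

end ERMModel.Assumptions

/-! ### From the infimum over a set to a soft minimum over a net -/

section SoftMinBounds

variable {ι : Type*} [Fintype ι] {β : ℝ} {w d : ι → ℝ}

theorem le_softMin (hβ : 0 < β) (hw : ∀ i, 0 ≤ w i) (hw1 : ∑ i, w i = 1) {m : ℝ}
    (hm : ∀ i, m ≤ d i) : m ≤ softMin β w d := by
  have h1 : ∑ i, w i * Real.exp (-β * d i) ≤ Real.exp (-β * m) := by
    calc _ ≤ ∑ i, w i * Real.exp (-β * m) := by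
          refine Finset.sum_le_sum fun i _ => mul_le_mul_of_nonneg_left ?_ (hw i)
          apply Real.exp_le_exp.2
          nlinarith [hm i]
      _ = _ := by rw [← Finset.sum_mul, hw1, one_mul]
  have h2 := (Real.log_le_iff_le_exp (partition_pos hw hw1)).2 h1
  rw [softMin, ← neg_div, le_div_iff₀ hβ]
  linarith

/-- One term of the partition function is kept. For uniform weights the loss is the logarithm of the
number of indices divided by `β`. -/
theorem softMin_le_add_log (hβ : 0 < β) (hw : ∀ i, 0 ≤ w i) {i : ι}
    (hi : 0 < w i) : softMin β w d ≤ d i - Real.log (w i) / β := by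
  have h1 : w i * Real.exp (-β * d i) ≤ ∑ j, w j * Real.exp (-β * d j) :=
    Finset.single_le_sum (f := fun j => w j * Real.exp (-β * d j))
      (fun j _ => mul_nonneg (hw j) (Real.exp_pos _).le) (Finset.mem_univ i)
  have h2 := Real.log_le_log (mul_pos hi (Real.exp_pos _)) h1
  rw [Real.log_mul hi.ne' (Real.exp_pos _).ne', Real.log_exp] at h2
  have h3 : d i - Real.log (w i) / β = (d i * β - Real.log (w i)) / β := by field_simp
  rw [softMin, ← neg_div, h3]
  apply div_le_div_of_nonneg_right _ hβ.le
  linarith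

end SoftMinBounds

namespace ERMModel

variable {k kstar : ℕ} (M : ERMModel k kstar) {R : ℝ} {K : ℝ≥0} {Kr : ℝ → ℝ≥0}

/-- The parameter matrices all columns of which lie in `S_p`. -/
def paramSet (p : ℕ) : Set (Param p k) := {Θ | ∀ j, Θ j ∈ M.S p}

/-- The empirical loss plus a penalty `q`. -/
noncomputable def penalizedRisk {p n : ℕ} (q : Param p k → ℝ) (z : Fin n → Feat p × ℝ)
    (Θ : Param p k) : ℝ :=
  1 / (n : ℝ) * ∑ a, M.sampleLoss Θ (z a) + q Θ

/-- The infimum over `T` of the penalized risk. -/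
noncomputable def infRisk {p n : ℕ} (q : Param p k → ℝ) (T : Set (Param p k))
    (z : Fin n → Feat p × ℝ) : ℝ :=
  sInf (M.penalizedRisk q z '' T)

/-- `q` is Lipschitz on `T` with respect to the gauge of `S_p ^ k`. -/
def GaugeLipschitz {p : ℕ} (L : ℝ) (q : Param p k → ℝ) (T : Set (Param p k)) : Prop :=
  ∀ Θ ∈ T, ∀ Θ' ∈ T, ∀ Δ ∈ M.paramSet p, ∀ a : ℝ, 0 ≤ a → Θ - Θ' = a • Δ → |q Θ - q Θ'| ≤ L * a

/-- The law of a sample with feature law `μ`. -/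
noncomputable def sampleLaw {p : ℕ} (μ : Measure (Feat p)) (n : ℕ) :
    Measure (Fin n → Feat p × ℝ) := Measure.pi fun _ => μ.prod M.lawE

variable {M}

theorem finrank_param (p : ℕ) : Module.finrank ℝ (Param p k) = k * p := by
  rw [(WithLp.linearEquiv 2 ℝ (Fin k → Feat p)).finrank_eq, Module.finrank_pi_fintype]
  simp

namespace Assumptions

theorem convex_paramSet (hM : M.Assumptions R K Kr) (p : ℕ) : Convex ℝ (M.paramSet p) := by
  intro Θ hΘ Θ' hΘ' a b ha hb hab j
  exact hM.S_convex p (hΘ j) (hΘ' j) ha hb hab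

theorem zero_mem_paramSet (hM : M.Assumptions R K Kr) (p : ℕ) : (0 : Param p k) ∈ M.paramSet p :=
  fun _ => hM.zero_mem p

theorem neg_mem_paramSet (hM : M.Assumptions R K Kr) {p : ℕ} {Θ : Param p k}
    (hΘ : Θ ∈ M.paramSet p) : -Θ ∈ M.paramSet p :=
  fun j => hM.S_symm p _ (hΘ j)

theorem norm_le_of_mem_paramSet (hM : M.Assumptions R K Kr) {p : ℕ} {Θ : Param p k}
    (hΘ : Θ ∈ M.paramSet p) : ‖Θ‖ ≤ k * R := by
  rw [PiLp.norm_eq_of_L2]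
  refine (Real.sqrt_le_sqrt (Finset.sum_sq_le_sq_sum_of_nonneg fun j _ => norm_nonneg _)).trans ?_
  rw [Real.sqrt_sq (Finset.sum_nonneg fun j _ => norm_nonneg _)]
  calc _ ≤ ∑ j : Fin k, R := Finset.sum_le_sum fun j _ => by simpa using hM.S_subset p (hΘ j)
    _ = k * R := by simp

theorem isBounded_paramSet (hM : M.Assumptions R K Kr) (p : ℕ) :
    Bornology.IsBounded (M.paramSet p) :=
  isBounded_iff_forall_norm_le.2 ⟨k * R, fun _ hΘ => hM.norm_le_of_mem_paramSet hΘ⟩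

theorem exists_sub_eq (hM : M.Assumptions R K Kr) {p : ℕ} {Θ Θ' : Param p k}
    (hΘ : Θ ∈ M.paramSet p) (hΘ' : Θ' ∈ M.paramSet p) :
    ∃ Δ ∈ M.paramSet p, Θ - Θ' = (2 : ℝ) • Δ := by
  refine ⟨(1 / 2 : ℝ) • Θ + (1 / 2 : ℝ) • (-Θ'), hM.convex_paramSet p hΘ (hM.neg_mem_paramSet hΘ')
    (by norm_num) (by norm_num) (by norm_num), by module⟩

theorem continuous_penalizedRisk (hM : M.Assumptions R K Kr) {p n : ℕ} (q : Param p k → ℝ)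
    (Θ : Param p k) : Continuous fun z : Fin n → Feat p × ℝ => M.penalizedRisk q z Θ := by
  have := hM.continuous_sampleLoss Θ
  unfold penalizedRisk
  fun_prop

theorem bddBelow_penalizedRisk (hM : M.Assumptions R K Kr) {p n : ℕ} {L : ℝ}
    {q : Param p k → ℝ} {T : Set (Param p k)} (hT : T ⊆ M.paramSet p)
    (hq : M.GaugeLipschitz L q T) (z : Fin n → Feat p × ℝ) :
    BddBelow (M.penalizedRisk q z '' T) := by
  rcases T.eq_empty_or_nonempty with rfl | ⟨Θ₀, h₀⟩
  · simp
  · refine ⟨q Θ₀ - L * 2, ?_⟩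
    rintro _ ⟨Θ, hΘ, rfl⟩
    obtain ⟨Δ, hΔ, h⟩ := hM.exists_sub_eq (hT hΘ) (hT h₀)
    have h1 := hq Θ hΘ Θ₀ h₀ Δ hΔ 2 zero_le_two h
    have h2 : 0 ≤ 1 / (n : ℝ) * ∑ a, M.sampleLoss Θ (z a) :=
      mul_nonneg (by positivity) (Finset.sum_nonneg fun a _ => hM.sampleLoss_nonneg _ _)
    have := (abs_le.1 h1).1
    unfold penalizedRisk
    linarith

/-- The sets `{inf < c}` are unions of open sets, so `T` may be uncountable and arbitrary. -/
theorem measurable_infRisk (hM : M.Assumptions R K Kr) {p n : ℕ} {L : ℝ}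
    {q : Param p k → ℝ} {T : Set (Param p k)} (hne : T.Nonempty) (hT : T ⊆ M.paramSet p)
    (hq : M.GaugeLipschitz L q T) :
    Measurable (M.infRisk q T : (Fin n → Feat p × ℝ) → ℝ) := by
  refine measurable_of_Iio fun c => IsOpen.measurableSet ?_
  have : M.infRisk q T ⁻¹' Set.Iio c =
      ⋃ Θ ∈ T, {z : Fin n → Feat p × ℝ | M.penalizedRisk q z Θ < c} := by
    ext z
    simp only [Set.mem_preimage, Set.mem_Iio, Set.mem_iUnion, Set.mem_ofPred_eq, exists_prop]
    rw [infRisk, csInf_lt_iff (hM.bddBelow_penalizedRisk hT hq z) (hne.image _)]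
    simp
  rw [this]
  exact isOpen_biUnion fun Θ _ => isOpen_lt (hM.continuous_penalizedRisk q Θ) continuous_const

theorem abs_penalizedRisk_sub_le (hM : M.Assumptions R K Kr) {p n : ℕ} {L : ℝ}
    {q : Param p k → ℝ} {T : Set (Param p k)}
    (hq : M.GaugeLipschitz L q T) {z : Fin n → Feat p × ℝ} {h : ℝ}
    (hh : ∀ s ∈ M.S p, 1 / (n : ℝ) * ∑ a, |⟪s, (z a).1⟫| ≤ h) {Θ Θ' Δ : Param p k} (hΘ : Θ ∈ T)
    (hΘ' : Θ' ∈ T) (hΔ : Δ ∈ M.paramSet p) {b : ℝ} (hb : 0 ≤ b) (hsub : Θ - Θ' = b • Δ) :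
    |M.penalizedRisk q z Θ - M.penalizedRisk q z Θ'| ≤ b * (K * k * h + L) := by
  have hK : (0 : ℝ) ≤ K := K.2
  have h1 : ∀ a, |M.sampleLoss Θ (z a) - M.sampleLoss Θ' (z a)| ≤
      K * (b * ∑ j, |⟪Δ j, (z a).1⟫|) := by
    intro a
    refine (hM.abs_sampleLoss_sub_le Θ Θ' (z a)).trans (mul_le_mul_of_nonneg_left ?_ hK)
    rw [hsub]
    refine (norm_project_le _ _).trans_eq ?_
    rw [Finset.mul_sum]
    refine Finset.sum_congr rfl fun j _ => ?_
    rw [PiLp.smul_apply, real_inner_smul_left, abs_mul, abs_of_nonneg hb]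
  have h2 : |1 / (n : ℝ) * ∑ a, M.sampleLoss Θ (z a) - 1 / (n : ℝ) * ∑ a, M.sampleLoss Θ' (z a)|
      ≤ K * b * (k * h) := by
    rw [← mul_sub, ← Finset.sum_sub_distrib, abs_mul, abs_of_nonneg (by positivity)]
    calc _ ≤ 1 / (n : ℝ) * ∑ a, K * (b * ∑ j, |⟪Δ j, (z a).1⟫|) :=
          mul_le_mul_of_nonneg_left ((Finset.abs_sum_le_sum_abs _ _).trans
            (Finset.sum_le_sum fun a _ => h1 a)) (by positivity)
      _ = K * b * ∑ j, 1 / (n : ℝ) * ∑ a, |⟪Δ j, (z a).1⟫| := by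
          simp only [← Finset.mul_sum]
          rw [Finset.sum_comm]
          ring
      _ ≤ K * b * ∑ j : Fin k, h :=
          mul_le_mul_of_nonneg_left (Finset.sum_le_sum fun j _ => hh _ (hΔ j)) (by positivity)
      _ = K * b * (k * h) := by simp
  have h3 := hq Θ hΘ Θ' hΘ' Δ hΔ b hb hsub
  have h4 := abs_add_le
    (1 / (n : ℝ) * ∑ a, M.sampleLoss Θ (z a) - 1 / (n : ℝ) * ∑ a, M.sampleLoss Θ' (z a))
    (q Θ - q Θ')
  calc _ = |1 / (n : ℝ) * ∑ a, M.sampleLoss Θ (z a) - 1 / (n : ℝ) * ∑ a, M.sampleLoss Θ' (z a) +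
        (q Θ - q Θ')| := by unfold penalizedRisk; congr 1; ring
    _ ≤ K * b * (k * h) + L * b := h4.trans (add_le_add h2 h3)
    _ = _ := by ring

/-- The infimum of the penalized risk is approximated by a soft minimum over a finite net. -/
theorem abs_infRisk_sub_softMin_le (hM : M.Assumptions R K Kr) {p n : ℕ} (hn : 0 < n) {L : ℝ}
    {q : Param p k → ℝ} {T : Set (Param p k)} (hne : T.Nonempty) (hT : T ⊆ M.paramSet p)
    (hq : M.GaugeLipschitz L q T) {α β : ℝ} (hα : 0 < α) (hβ : 0 < β)
    {N : Finset (Param p k)} (hNT : (N : Set (Param p k)) ⊆ T)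
    (hnet : ∀ Θ ∈ T, ∃ Θ' ∈ N, ∃ Δ ∈ M.paramSet p, Θ - Θ' = α • Δ)
    (hcard : (N.card : ℝ) ≤ (1 + 2 / α) ^ (k * p)) {z : Fin n → Feat p × ℝ} {h : ℝ}
    (hh : ∀ s ∈ M.S p, 1 / (n : ℝ) * ∑ a, |⟪s, (z a).1⟫| ≤ h) :
    |M.infRisk q T z - 1 / n * softMin β (fun _ : N => 1 / (N.card : ℝ))
        (fun i => n * q i + ∑ a, M.sampleLoss i.1 (z a))| ≤
      α * (K * k * h + L) + k * (p / n) * Real.log (1 + 2 / α) / β := by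
  have hn' : (0 : ℝ) < n := by exact_mod_cast hn
  have hbdd := hM.bddBelow_penalizedRisk hT hq z
  obtain ⟨Θ₀, h₀⟩ := hne
  obtain ⟨Θ₁, h₁, -⟩ := hnet Θ₀ h₀
  have hN : (0 : ℝ) < N.card := by exact_mod_cast Finset.card_pos.2 ⟨Θ₁, h₁⟩
  have hw : ∀ _ : N, (0 : ℝ) ≤ 1 / (N.card : ℝ) := fun _ => by positivity
  have hw1 : ∑ _ : N, 1 / (N.card : ℝ) = 1 := by
    simp [hN.ne']
  have hd : ∀ Θ : Param p k, n * q Θ + ∑ a, M.sampleLoss Θ (z a) = n * M.penalizedRisk q z Θ := by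
    intro Θ; unfold penalizedRisk; field_simp; ring
  simp only [hd]
  have hα' : 0 ≤ Real.log (1 + 2 / α) := Real.log_nonneg (by
    have : 0 < 2 / α := by positivity
    linarith)
  have hS : 0 ≤ h := by
    have := hh 0 (hM.zero_mem p)
    simpa using this
  have hlow : M.infRisk q T z ≤ 1 / n * softMin β (fun _ : N => 1 / (N.card : ℝ))
      (fun i => n * M.penalizedRisk q z i) := by
    rw [one_div_mul_eq_div, le_div_iff₀ hn', mul_comm]
    refine le_softMin hβ hw hw1 fun i => ?_
    exact mul_le_mul_of_nonneg_left (csInf_le hbdd ⟨i, hNT i.2, rfl⟩) hn'.le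
  have hup : ∀ i : N, 1 / n * softMin β (fun _ : N => 1 / (N.card : ℝ))
      (fun i => n * M.penalizedRisk q z i) ≤
        M.penalizedRisk q z i + k * (p / n) * Real.log (1 + 2 / α) / β := by
    intro i
    have e1 := softMin_le_add_log hβ hw (d := fun i : N => n * M.penalizedRisk q z i)
      (i := i) (by positivity)
    rw [one_div, Real.log_inv, neg_div, sub_neg_eq_add] at e1
    have e2 : Real.log N.card ≤ k * p * Real.log (1 + 2 / α) := by
      have := Real.log_le_log hN hcard
      rw [Real.log_pow] at this
      exact_mod_cast this
    have e3 : Real.log N.card / β ≤ k * p * Real.log (1 + 2 / α) / β := by gcongr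
    simp only [one_div] at *
    rw [inv_mul_le_iff₀ hn']
    calc _ ≤ n * M.penalizedRisk q z i + k * p * Real.log (1 + 2 / α) / β := by linarith
      _ = _ := by field_simp
  -- A point of `T` is moved to the net at cost `α * (K * k * h + L)`, and there the entropy bound
  -- `hup` applies.
  have hmain : 1 / n * softMin β (fun _ : N => 1 / (N.card : ℝ))
      (fun i => n * M.penalizedRisk q z i) -
      (α * (K * k * h + L) + k * (p / n) * Real.log (1 + 2 / α) / β) ≤ M.infRisk q T z := by
    refine le_csInf (Set.Nonempty.image _ ⟨Θ₀, h₀⟩) ?_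
    rintro _ ⟨Θ, hΘ, rfl⟩
    obtain ⟨Θ', hΘ', Δ, hΔ, hsub⟩ := hnet Θ hΘ
    have e1 := hM.abs_penalizedRisk_sub_le hq hh hΘ (hNT hΘ') hΔ hα.le hsub
    have e2 := hup ⟨Θ', hΘ'⟩
    have := (abs_le.1 e1).1
    simp only at e2
    linarith
  rw [abs_sub_comm, abs_of_nonneg (by linarith)]
  linarith

theorem abs_integral_infRisk_sub_softMin_le (hM : M.Assumptions R K Kr) {p n : ℕ} (hn : 0 < n)
    {L : ℝ} {q : Param p k → ℝ} {T : Set (Param p k)} (hne : T.Nonempty)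
    (hT : T ⊆ M.paramSet p) (hq : M.GaugeLipschitz L q T) {α β : ℝ} (hα : 0 < α) (hβ : 0 < β)
    {N : Finset (Param p k)} (hNT : (N : Set (Param p k)) ⊆ T)
    (hnet : ∀ Θ ∈ T, ∃ Θ' ∈ N, ∃ Δ ∈ M.paramSet p, Θ - Θ' = α • Δ)
    (hcard : (N.card : ℝ) ≤ (1 + 2 / α) ^ (k * p)) {C : ℝ} {ψ D : ℝ → ℝ}
    (hψ : IsSmoothTest C ψ D) {μ : Measure (Feat p)} [IsProbabilityMeasure μ]
    (hμ : ∀ s ∈ M.S p, ExpBound hM.rate μ fun x => ⟪s, x⟫) :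
    |∫ z, ψ (M.infRisk q T z) ∂(sampleLaw M μ n) -
      ∫ z, ψ (1 / n * softMin β (fun _ : N => 1 / (N.card : ℝ))
        (fun i => n * q i + ∑ a, M.sampleLoss i.1 (z a))) ∂(sampleLaw M μ n)| ≤
      C * (α * (K * k * (2 / hM.rate * (p / n * Real.log 5 + Real.log 6)) + L) +
        k * (p / n) * Real.log (1 + 2 / α) / β) := by
  have := hM.lawE_prob
  obtain ⟨H, hHi, hH, hHle⟩ := hM.exists_dominating hn hμ
  change Integrable H (sampleLaw M μ n) at hHi
  change ∫ z, H z ∂(sampleLaw M μ n) ≤ _ at hHle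
  have : IsProbabilityMeasure (sampleLaw M μ n) := by unfold sampleLaw; infer_instance
  have hψm := hψ.continuous.measurable
  have hbd : ∀ {f : (Fin n → Feat p × ℝ) → ℝ}, Measurable f →
      Integrable (fun z => ψ (f z)) (sampleLaw M μ n) := fun hf =>
    (integrable_const C).mono' (hψm.comp hf).aestronglyMeasurable (ae_of_all _ fun _ => hψ.bound _)
  have hm1 : Measurable (M.infRisk q T : (Fin n → Feat p × ℝ) → ℝ) :=
    hM.measurable_infRisk hne hT hq
  have hm2 : Measurable fun z : Fin n → Feat p × ℝ =>
      1 / (n : ℝ) * softMin β (fun _ : N => 1 / (N.card : ℝ))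
        (fun i => n * q i + ∑ a, M.sampleLoss i.1 (z a)) := by
    refine Measurable.const_mul (measurable_softMin fun i => ?_) _
    have := (hM.continuous_sampleLoss i.1).measurable
    fun_prop
  set c := k * (p / n) * Real.log (1 + 2 / α) / β with hc
  have hi1 : Integrable (fun z => K * k * H z) (sampleLaw M μ n) := hHi.const_mul _
  have hi2 : Integrable (fun z => α * (K * k * H z + L)) (sampleLaw M μ n) :=
    (hi1.add (integrable_const L)).const_mul α
  have hi : Integrable (fun z => α * (K * k * H z + L) + c) (sampleLaw M μ n) :=
    hi2.add (integrable_const c)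
  rw [← integral_sub (hbd hm1) (hbd hm2)]
  refine abs_integral_le_integral_abs.trans ?_
  refine (integral_mono ((hbd hm1).sub (hbd hm2)).abs (hi.const_mul C) fun z => ?_).trans ?_
  · exact (hψ.lipschitz _ _).trans (mul_le_mul_of_nonneg_left
      (hM.abs_infRisk_sub_softMin_le hn hne hT hq hα hβ hNT hnet hcard (hH z)) hψ.nonneg)
  · rw [integral_const_mul]
    refine mul_le_mul_of_nonneg_left ?_ hψ.nonneg
    rw [integral_add hi2 (integrable_const c), integral_const_mul, integral_add hi1
      (integrable_const L), integral_const_mul, integral_const, integral_const, probReal_univ,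
      one_smul, one_smul]
    gcongr

end Assumptions

end ERMModel

/-! ### Universality of penalized minima -/

theorem tendsto_dimension_atTop {p : ℕ → ℕ} {γ : ℝ} (hγ : 0 < γ)
    (hp : Tendsto (fun n : ℕ => (p n : ℝ) / (n : ℝ)) atTop (𝓝 γ)) : Tendsto p atTop atTop := by
  have h := hp.pos_mul_atTop hγ (tendsto_natCast_atTop_atTop (R := ℝ))
  rw [← tendsto_natCast_atTop_iff (R := ℝ)]
  refine h.congr' ?_
  filter_upwards [eventually_gt_atTop 0] with n hn
  have : (n : ℝ) ≠ 0 := by exact_mod_cast hn.ne'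
  field_simp

theorem measureReal_le_integral_le {Z : Type*} [MeasurableSpace Z] {μ : Measure Z}
    [IsProbabilityMeasure μ] {f : Z → ℝ} (hf : Measurable f) {A B : Set Z} (hA : MeasurableSet A)
    (hB : MeasurableSet B) (h0 : ∀ z, 0 ≤ f z) (h1 : ∀ z, f z ≤ 1) (hfA : ∀ z ∈ A, f z = 1)
    (hfB : ∀ z ∉ B, f z = 0) : μ.real A ≤ ∫ z, f z ∂μ ∧ ∫ z, f z ∂μ ≤ μ.real B := by
  have hi : Integrable f μ := (integrable_const (1 : ℝ)).mono' hf.aestronglyMeasurable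
    (ae_of_all _ fun z => by rw [Real.norm_of_nonneg (h0 z)]; exact h1 z)
  rw [← integral_indicator_one hA, ← integral_indicator_one hB]
  refine ⟨integral_mono ((integrable_const (1 : ℝ)).indicator hA) hi fun z => ?_,
    integral_mono hi ((integrable_const (1 : ℝ)).indicator hB) fun z => ?_⟩
  · by_cases h : z ∈ A
    · simp [h, hfA z h]
    · simpa [h] using h0 z
  · by_cases h : z ∈ B
    · simpa [h] using h1 z
    · simp [h, hfB z h]

namespace ERMModel.Assumptions

variable {k kstar : ℕ} {M : ERMModel k kstar} {R : ℝ} {K : ℝ≥0} {Kr : ℝ → ℝ≥0}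

/-- Universality of smooth statistics of the minimum of the penalized risk. -/
theorem exists_abs_integral_infRisk_sub_le (hM : M.Assumptions R K Kr) {p : ℕ → ℕ} {γ : ℝ}
    (hγ : 0 < γ) (hp : Tendsto (fun n : ℕ => (p n : ℝ) / (n : ℝ)) atTop (𝓝 γ)) {C : ℝ}
    {ψ D : ℝ → ℝ} (hψ : IsSmoothTest C ψ D) {L : ℝ} (hL : 0 ≤ L) {ε : ℝ} (hε : 0 < ε) :
    ∀ᶠ n in atTop, ∀ T : Set (Param (p n) k), T.Nonempty → T ⊆ M.paramSet (p n) →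
      ∀ q, M.GaugeLipschitz L q T →
        |∫ z, ψ (M.infRisk q T z) ∂(sampleLaw M (M.lawX (p n)) n) -
          ∫ z, ψ (M.infRisk q T z) ∂(sampleLaw M (M.lawG (p n)) n)| ≤ ε := by
  have := hM.lawE_prob
  have := hM.lawX_prob
  have hC := hψ.nonneg
  have hrate := hM.rate_pos
  have hK : (0 : ℝ) ≤ K := K.2
  have hl5 : 0 < Real.log 5 := Real.log_pos (by norm_num)
  have hl6 : 0 < Real.log 6 := Real.log_pos (by norm_num)
  set Q : ℝ := 2 / hM.rate * ((γ + 1) * Real.log 5 + Real.log 6) with hQ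
  have hQ0 : 0 ≤ Q := by positivity
  set U : ℝ := C * (K * k * Q + L) with hU
  have hU0 : 0 ≤ U := by positivity
  -- The order of choices matters: the mesh `α` first, then `β` large against the entropy of that
  -- mesh, then the single-sample accuracy `ε'` for that `β`, and `n` last. The bound `γ + 1` stands
  -- for `p n / n`.
  set α : ℝ := ε / (10 * (U + 1)) with hα
  have hα0 : 0 < α := by positivity
  have hαU : α * U ≤ ε / 10 := by
    have : ε / 10 = α * (U + 1) := by rw [hα]; field_simp
    rw [this]; exact mul_le_mul_of_nonneg_left (by linarith) hα0.le
  have hlog : 0 ≤ Real.log (1 + 2 / α) := Real.log_nonneg (by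
    have : 0 < 2 / α := by positivity
    linarith)
  set V : ℝ := C * (k * (γ + 1) * Real.log (1 + 2 / α)) with hV
  have hV0 : 0 ≤ V := by positivity
  set β : ℝ := 10 * (V + 1) / ε with hβ
  have hβ0 : 0 < β := by positivity
  have hVβ : V / β ≤ ε / 10 := by
    rw [div_le_iff₀ hβ0, hβ]
    have : ε / 10 * (10 * (V + 1) / ε) = V + 1 := by field_simp
    rw [this]; linarith
  set ε' : ℝ := ε / (10 * (C + 1)) with hε'
  have hε'0 : 0 < ε' := by positivity
  have hCε' : C * ε' ≤ ε / 10 := by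
    have : ε / 10 = (C + 1) * ε' := by rw [hε']; field_simp
    rw [this]; exact mul_le_mul_of_nonneg_right (by linarith) hε'0.le
  obtain ⟨p₀, hp₀⟩ := hM.exists_softMin_close hβ0 hε'0
  have hlim : Tendsto (fun n : ℕ => 2 * C * hM.secondMoment / n) atTop (𝓝 0) :=
    tendsto_const_div_atTop_nhds_zero_nat _
  filter_upwards [(tendsto_dimension_atTop hγ hp).eventually_ge_atTop p₀,
    hlim.eventually (ge_mem_nhds (by positivity : (0 : ℝ) < ε / 10)), eventually_gt_atTop 0,
    hp.eventually (ge_mem_nhds (lt_add_one γ))] with n hn1 hn2 hn3 hn4 T hne hT q hq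
  obtain ⟨N, hNT, hnet, hcard⟩ := exists_gauge_net (hM.convex_paramSet (p n))
    (hM.zero_mem_paramSet _) (fun _ h => hM.neg_mem_paramSet h) (hM.isBounded_paramSet _) hα0 hT
  rw [finrank_param] at hcard
  have hstep : ∀ (μ : Measure (Feat (p n))) [IsProbabilityMeasure μ],
      (∀ s ∈ M.S (p n), ExpBound hM.rate μ fun x => ⟪s, x⟫) →
      |∫ z, ψ (M.infRisk q T z) ∂(sampleLaw M μ n) -
        ∫ z, ψ (1 / n * softMin β (fun _ : N => 1 / (N.card : ℝ))
          (fun i => n * q i + ∑ a, M.sampleLoss i.1 (z a))) ∂(sampleLaw M μ n)| ≤ ε / 5 := by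
    intro μ _ hμ
    refine (hM.abs_integral_infRisk_sub_softMin_le hn3 hne hT hq hα0 hβ0 hNT hnet hcard hψ
      hμ).trans ?_
    calc _ ≤ C * (α * (K * k * (2 / hM.rate * ((γ + 1) * Real.log 5 + Real.log 6)) + L) +
          k * (γ + 1) * Real.log (1 + 2 / α) / β) := by gcongr
      _ = α * U + V / β := by rw [hU, hV, hQ]; ring
      _ ≤ ε / 5 := by linarith
  have hX := hstep (M.lawX (p n)) fun s hs => hM.expBound_X hs
  have hG := hstep (M.lawG (p n)) fun s hs => hM.expBound_G hs
  obtain ⟨Θ₀, h₀⟩ := hne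
  obtain ⟨Θ₁, h₁, -⟩ := hnet Θ₀ h₀
  have hN : (0 : ℝ) < N.card := by exact_mod_cast Finset.card_pos.2 ⟨Θ₁, h₁⟩
  have hNS : ∀ (i : N) j, i.1 j ∈ M.S (p n) := fun i => hT (hNT i.2)
  have hmid := abs_integral_softMin_sum_sub_le (ν := (M.lawX (p n)).prod M.lawE)
    (ν' := (M.lawG (p n)).prod M.lawE) (A := hM.secondMoment) (ε := ε') hβ0 hψ
    (l := fun i : N => M.sampleLoss i.1)
    (fun i => (hM.continuous_sampleLoss _).measurable) (fun i z => hM.sampleLoss_nonneg _ z)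
    (fun i => hM.sampleLoss_sq (fun s hs => hM.expBound_X hs) (hNS i))
    (fun i => hM.sampleLoss_sq (fun s hs => hM.expBound_G hs) (hNS i))
    (fun w hw hw1 => hp₀ (p n) hn1 N w (fun i => i.1) hw hw1 hNS)
    (w := fun _ : N => 1 / (N.card : ℝ)) (fun _ => by positivity) (by simp [hN.ne'])
    (fun i => n * q i) hn3
  change |∫ z, _ ∂(sampleLaw M (M.lawX (p n)) n) - ∫ z, _ ∂(sampleLaw M (M.lawG (p n)) n)| ≤ _
    at hmid
  rw [abs_le] at *
  constructor <;> linarith [hX.1, hX.2, hG.1, hG.2, hmid.1, hmid.2]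

theorem isProbabilityMeasure_sampleLaw (hM : M.Assumptions R K Kr) {p : ℕ}
    (μ : Measure (Feat p)) [IsProbabilityMeasure μ] (n : ℕ) :
    IsProbabilityMeasure (sampleLaw M μ n) := by
  have := hM.lawE_prob
  unfold sampleLaw; infer_instance

/-- A smooth step from `a - δ` to `a` lies between the two indicators. `T` and `q` are quantified
after `n`, since both are allowed to change with `n`. -/
theorem eventually_lower (hM : M.Assumptions R K Kr) {p : ℕ → ℕ} {γ : ℝ}
    (hγ : 0 < γ) (hp : Tendsto (fun n : ℕ => (p n : ℝ) / (n : ℝ)) atTop (𝓝 γ)) {L : ℝ}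
    (hL : 0 ≤ L) {ε δ : ℝ} (hε : 0 < ε) (hδ : 0 < δ) (a : ℝ) :
    ∀ᶠ n in atTop, ∀ T : Set (Param (p n) k), T.Nonempty → T ⊆ M.paramSet (p n) →
      ∀ q, M.GaugeLipschitz L q T →
        (sampleLaw M (M.lawX (p n)) n).real {z | M.infRisk q T z < a - δ} ≤
          (sampleLaw M (M.lawG (p n)) n).real {z | M.infRisk q T z < a} + ε := by
  have := hM.lawX_prob
  obtain ⟨C, ψ, D, hψ, h0, h1, hle, hge⟩ := exists_smoothTest (a - δ) hδ
  filter_upwards [hM.exists_abs_integral_infRisk_sub_le hγ hp hψ hL hε] with n hn T hne hT q hq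
  have hm : Measurable (M.infRisk q T : (Fin n → Feat (p n) × ℝ) → ℝ) :=
    hM.measurable_infRisk hne hT hq
  have key : ∀ (μ : Measure (Feat (p n))) [IsProbabilityMeasure μ],
      (sampleLaw M μ n).real {z | M.infRisk q T z < a - δ} ≤
        1 - ∫ z, ψ (M.infRisk q T z) ∂(sampleLaw M μ n) ∧
      1 - ∫ z, ψ (M.infRisk q T z) ∂(sampleLaw M μ n) ≤
        (sampleLaw M μ n).real {z | M.infRisk q T z < a} := by
    intro μ _
    have := hM.isProbabilityMeasure_sampleLaw μ n
    have hmψ := hψ.continuous.measurable.comp hm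
    have hi : Integrable (fun z => ψ (M.infRisk q T z)) (sampleLaw M μ n) :=
      (integrable_const C).mono' hmψ.aestronglyMeasurable (ae_of_all _ fun _ => hψ.bound _)
    have e : 1 - ∫ z, ψ (M.infRisk q T z) ∂(sampleLaw M μ n) =
        ∫ z, (1 - ψ (M.infRisk q T z)) ∂(sampleLaw M μ n) := by
      rw [integral_sub (integrable_const _) hi, integral_const, probReal_univ, one_smul]
    rw [e]
    refine measureReal_le_integral_le (f := fun z => 1 - ψ (M.infRisk q T z))
      (measurable_const.sub hmψ)
      (measurableSet_lt hm measurable_const) (measurableSet_lt hm measurable_const)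
      (fun z => sub_nonneg.2 (h1 _)) (fun z => by linarith [h0 (M.infRisk q T z)])
      (fun z hz => ?_) (fun z hz => ?_)
    · rw [hle _ (le_of_lt hz), sub_zero]
    · rw [hge _ (by simpa using hz), sub_self]
  have hX := (key (M.lawX (p n))).1
  have hG := (key (M.lawG (p n))).2
  have := abs_le.1 (hn T hne hT q hq)
  linarith [this.1]

theorem eventually_upper (hM : M.Assumptions R K Kr) {p : ℕ → ℕ} {γ : ℝ}
    (hγ : 0 < γ) (hp : Tendsto (fun n : ℕ => (p n : ℝ) / (n : ℝ)) atTop (𝓝 γ)) {L : ℝ}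
    (hL : 0 ≤ L) {ε δ : ℝ} (hε : 0 < ε) (hδ : 0 < δ) (a : ℝ) :
    ∀ᶠ n in atTop, ∀ T : Set (Param (p n) k), T.Nonempty → T ⊆ M.paramSet (p n) →
      ∀ q, M.GaugeLipschitz L q T →
        (sampleLaw M (M.lawX (p n)) n).real {z | a + δ < M.infRisk q T z} ≤
          (sampleLaw M (M.lawG (p n)) n).real {z | a < M.infRisk q T z} + ε := by
  have := hM.lawX_prob
  obtain ⟨C, ψ, D, hψ, h0, h1, hle, hge⟩ := exists_smoothTest a hδ
  filter_upwards [hM.exists_abs_integral_infRisk_sub_le hγ hp hψ hL hε] with n hn T hne hT q hq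
  have hm : Measurable (M.infRisk q T : (Fin n → Feat (p n) × ℝ) → ℝ) :=
    hM.measurable_infRisk hne hT hq
  have key : ∀ (μ : Measure (Feat (p n))) [IsProbabilityMeasure μ],
      (sampleLaw M μ n).real {z | a + δ < M.infRisk q T z} ≤
        ∫ z, ψ (M.infRisk q T z) ∂(sampleLaw M μ n) ∧
      ∫ z, ψ (M.infRisk q T z) ∂(sampleLaw M μ n) ≤
        (sampleLaw M μ n).real {z | a < M.infRisk q T z} := by
    intro μ _
    have := hM.isProbabilityMeasure_sampleLaw μ n
    refine measureReal_le_integral_le (hψ.continuous.measurable.comp hm)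
      (measurableSet_lt measurable_const hm) (measurableSet_lt measurable_const hm)
      (fun z => h0 _) (fun z => h1 _) (fun z hz => hge _ (le_of_lt hz)) (fun z hz => ?_)
    exact hle _ (by simpa using hz)
  have hX := (key (M.lawX (p n))).1
  have hG := (key (M.lawG (p n))).2
  have := abs_le.1 (hn T hne hT q hq)
  linarith [this.2]

end ERMModel.Assumptions

/-! ### Lipschitz properties of the penalties -/

theorem ExpBound.abs {E : Type*} [MeasurableSpace E] {c : ℝ} (hc : 0 < c) {μ : Measure E}
    {f : E → ℝ} (h : ExpBound c μ f) :
    Integrable (fun x => |f x|) μ ∧ ∫ x, |f x| ∂μ ≤ 6 / c := by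
  have hle : ∀ x, |f x| ≤ Real.exp (c * |f x|) / c := by
    intro x
    rw [le_div_iff₀ hc]
    linarith [Real.add_one_le_exp (c * |f x|)]
  have hi : Integrable (fun x => |f x|) μ := by
    refine (h.2.1.div_const c).mono' h.1.norm.aestronglyMeasurable (ae_of_all _ fun x => ?_)
    rw [Real.norm_eq_abs, abs_abs]; exact hle x
  refine ⟨hi, (integral_mono hi (h.2.1.div_const c) hle).trans ?_⟩
  rw [integral_div]
  exact div_le_div_of_nonneg_right h.2.2 hc.le

namespace ERMModel

variable {k kstar : ℕ} {M : ERMModel k kstar} {R : ℝ} {K : ℝ≥0} {Kr : ℝ → ℝ≥0}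

theorem GaugeLipschitz.mono {p : ℕ} {L : ℝ} {q : Param p k → ℝ} {T T' : Set (Param p k)}
    (h : M.GaugeLipschitz L q T) (hT : T' ⊆ T) : M.GaugeLipschitz L q T' :=
  fun Θ hΘ Θ' hΘ' => h Θ (hT hΘ) Θ' (hT hΘ')

theorem GaugeLipschitz.add_mul {p : ℕ} {L L' : ℝ} {q q' : Param p k → ℝ} {T : Set (Param p k)}
    (h : M.GaugeLipschitz L q T) (h' : M.GaugeLipschitz L' q' T) (s : ℝ) :
    M.GaugeLipschitz (L + |s| * L') (fun Θ => q Θ + s * q' Θ) T := by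
  intro Θ hΘ Θ' hΘ' Δ hΔ a ha hsub
  have h1 := h Θ hΘ Θ' hΘ' Δ hΔ a ha hsub
  have h2 := mul_le_mul_of_nonneg_left (h' Θ hΘ Θ' hΘ' Δ hΔ a ha hsub) (abs_nonneg s)
  rw [← abs_mul] at h2
  calc _ = |(q Θ - q Θ') + s * (q' Θ - q' Θ')| := by congr 1; ring
    _ ≤ |q Θ - q Θ'| + |s * (q' Θ - q' Θ')| := abs_add_le _ _
    _ ≤ _ := by linarith

namespace Assumptions

theorem feasible_subset (hM : M.Assumptions R K Kr) (p : ℕ) : M.feasible p ⊆ M.paramSet p :=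
  fun _ hΘ j => hM.C_subset p (hΘ j)

theorem feasible_nonempty (hM : M.Assumptions R K Kr) (p : ℕ) : (M.feasible p).Nonempty := by
  obtain ⟨θ, hθ⟩ := hM.C_nonempty p
  exact ⟨WithLp.toLp 2 fun _ => θ, fun _ => hθ⟩

theorem exists_gaugeLipschitz_r (hM : M.Assumptions R K Kr) :
    ∃ L, 0 ≤ L ∧ ∀ p, M.GaugeLipschitz L (M.r p) (M.paramSet p) := by
  have hR := hM.R_pos
  refine ⟨Kr (k * R + 1) * (k * R), by positivity, fun p Θ hΘ Θ' hΘ' Δ hΔ a ha hsub => ?_⟩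
  have hmem : ∀ Θ ∈ M.paramSet p, Θ ∈ Metric.closedBall (0 : Param p k) (k * R + 1) := by
    intro Θ hΘ
    rw [mem_closedBall_zero_iff]
    linarith [hM.norm_le_of_mem_paramSet hΘ]
  have h := (hM.r_lipschitz p (k * R + 1) (by positivity)).dist_le_mul Θ (hmem Θ hΘ) Θ' (hmem Θ' hΘ')
  rw [Real.dist_eq, dist_eq_norm, hsub, norm_smul, Real.norm_of_nonneg ha] at h
  calc _ ≤ (Kr (k * R + 1) : ℝ) * (a * ‖Δ‖) := h
    _ ≤ Kr (k * R + 1) * (a * (k * R)) := by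
      gcongr; exact hM.norm_le_of_mem_paramSet hΔ
    _ = _ := by ring

/-- The variation of the Gaussian test error is controlled by the first absolute moments of the
projections along the columns of the difference. -/
theorem abs_testErrorG_sub_le (hM : M.Assumptions R K Kr) {p : ℕ} {Θ Θ' : Param p k}
    (hΘ : Θ ∈ M.paramSet p) (hΘ' : Θ' ∈ M.paramSet p) {b : Fin k → ℝ}
    (hb : ∀ j, Integrable (fun x => |⟪(Θ - Θ') j, x⟫|) (M.lawG p) ∧
      ∫ x, |⟪(Θ - Θ') j, x⟫| ∂(M.lawG p) ≤ b j) :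
    |M.testErrorG Θ - M.testErrorG Θ'| ≤ K * ∑ j, b j := by
  have := hM.lawE_prob
  have hint : ∀ Θ ∈ M.paramSet p, Integrable (M.sampleLoss Θ) ((M.lawG p).prod M.lawE) :=
    fun Θ hΘ => integrable_of_sq (hM.continuous_sampleLoss Θ).aestronglyMeasurable
      (hM.sampleLoss_sq (fun s hs => hM.expBound_G hs) hΘ).1
  have hi : Integrable (fun x => K * ∑ j, |⟪(Θ - Θ') j, x⟫|) (M.lawG p) :=
    (integrable_finsetSum _ fun j _ => (hb j).1).const_mul _
  change |∫ z, M.sampleLoss Θ z ∂((M.lawG p).prod M.lawE) -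
    ∫ z, M.sampleLoss Θ' z ∂((M.lawG p).prod M.lawE)| ≤ _
  rw [← integral_sub (hint Θ hΘ) (hint Θ' hΘ')]
  refine abs_integral_le_integral_abs.trans ?_
  refine (integral_mono ((hint Θ hΘ).sub (hint Θ' hΘ')).abs (hi.comp_fst M.lawE) fun z =>
    (hM.abs_sampleLoss_sub_le Θ Θ' z).trans
      (mul_le_mul_of_nonneg_left (norm_project_le _ _) K.2)).trans ?_
  have e := integral_fun_fst (μ := M.lawG p) (ν := M.lawE)
    fun x => K * ∑ j, |⟪(Θ - Θ') j, x⟫|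
  rw [probReal_univ, one_smul] at e
  rw [e, integral_const_mul, integral_finsetSum _ fun j _ => (hb j).1]
  exact mul_le_mul_of_nonneg_left (Finset.sum_le_sum fun j _ => (hb j).2) K.2

/-- This makes `r + s * R^g` an admissible penalty, as condition (c) requires. -/
theorem gaugeLipschitz_testErrorG (hM : M.Assumptions R K Kr) (p : ℕ) :
    M.GaugeLipschitz (K * (k * (6 / hM.rate))) (M.testErrorG (p := p)) (M.paramSet p) := by
  intro Θ hΘ Θ' hΘ' Δ hΔ a ha hsub
  have hb := fun j => (hM.expBound_G (hΔ j)).abs hM.rate_pos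
  refine (hM.abs_testErrorG_sub_le hΘ hΘ' (b := fun _ => a * (6 / hM.rate)) fun j => ?_).trans_eq
    (by simp; ring)
  have e : ∀ x, |⟪(Θ - Θ') j, x⟫| = a * |⟪Δ j, x⟫| := fun x => by
    rw [hsub, PiLp.smul_apply, real_inner_smul_left, abs_mul, abs_of_nonneg ha]
  simp only [e]
  refine ⟨(hb j).1.const_mul a, ?_⟩
  rw [integral_const_mul]
  exact mul_le_mul_of_nonneg_left (hb j).2 ha

/-- Strong convexity controls the Frobenius distance rather than the gauge, so condition (a) needs
this version; its bound on the covariance is homogeneous in `θ` and passes to differences, which are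
twice elements of `S_p^k`. -/
theorem abs_testErrorG_sub_le_norm (hM : M.Assumptions R K Kr) {p : ℕ}
    (hS : ∀ θ ∈ M.S p, ‖M.sqrtSig p θ‖ ≤ K * ‖θ‖) {Θ Θ' : Param p k}
    (hΘ : Θ ∈ M.paramSet p) (hΘ' : Θ' ∈ M.paramSet p) :
    |M.testErrorG Θ - M.testErrorG Θ'| ≤ K * (k * (6 * K)) * ‖Θ - Θ'‖ := by
  have hK : (0 : ℝ) < K := hM.K_pos
  obtain ⟨Δ, hΔ, hsub⟩ := hM.exists_sub_eq hΘ hΘ'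
  refine (hM.abs_testErrorG_sub_le hΘ hΘ' (b := fun _ => 6 * K * ‖Θ - Θ'‖) fun j => ?_).trans_eq
    (by simp; ring)
  set v := (Θ - Θ') j with hv
  have hnv : ‖v‖ ≤ ‖Θ - Θ'‖ := PiLp.norm_apply_le (Θ - Θ') j
  have hσ : ‖M.sqrtSig p v‖ ≤ K * ‖v‖ := by
    have : v = (2 : ℝ) • Δ j := by rw [hv, hsub]; rfl
    rw [this, map_smul, norm_smul, norm_smul]
    have := hS _ (hΔ j)
    nlinarith [norm_nonneg (2 : ℝ)]
  rcases eq_or_ne v 0 with h0 | h0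
  · simp only [h0, inner_zero_left, abs_zero, integral_zero]
    exact ⟨integrable_zero _ _ _, by positivity⟩
  · have hvpos : 0 < ‖v‖ := norm_pos_iff.2 h0
    have h1 := expBound_gaussianReal (v := ‖M.sqrtSig p v‖₊ ^ 2) (c := 1 / (K * ‖v‖)) (by
      push_cast
      rw [← mul_pow]
      apply pow_le_one₀ (by positivity)
      rw [one_div_mul_eq_div, div_le_one (by positivity)]
      exact hσ)
    have h2 := h1.abs (by positivity)
    rw [← map_inner_lawG] at h2
    have hm : AEMeasurable (fun x : Feat p => ⟪v, x⟫) (M.lawG p) := by fun_prop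
    refine ⟨(integrable_map_measure h2.1.aestronglyMeasurable hm).1 h2.1, ?_⟩
    have h3 := h2.2
    rw [integral_map hm h2.1.aestronglyMeasurable] at h3
    refine h3.trans ?_
    rw [div_div_eq_mul_div, div_one]
    nlinarith

end Assumptions

/-! ### The joint law of a sample -/

/-- The sample made of the pairs of a feature vector and a noise variable. -/
def pairSample {Ω : Type*} {p n : ℕ} (z : Fin n → Ω → Feat p) (e : Fin n → Ω → ℝ) (ω : Ω) :
    Fin n → Feat p × ℝ := fun i => (z i ω, e i ω)

theorem _root_.IsSample.hasLaw {Ω : Type*} [MeasurableSpace Ω] {P : Measure Ω}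
    [IsProbabilityMeasure P] {p n : ℕ} {μ : Measure (Feat p)}
    {z : Fin n → Ω → Feat p} {e : Fin n → Ω → ℝ} (M : ERMModel k kstar)
    [IsProbabilityMeasure μ] [IsProbabilityMeasure M.lawE] (h : IsSample P μ M.lawE z e) :
    HasLaw (pairSample z e) (sampleLaw M μ n) P := by
  have hz : ∀ i, AEMeasurable (z i) P := fun i => (h.law_feature i).aemeasurable
  have he : ∀ i, AEMeasurable (e i) P := fun i => (h.law_noise i).aemeasurable
  have hz' : AEMeasurable (fun ω i => z i ω) P := aemeasurable_pi_lambda _ hz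
  have he' : AEMeasurable (fun ω i => e i ω) P := aemeasurable_pi_lambda _ he
  have h1 := (iIndepFun_iff_map_fun_eq_pi_map hz).1 h.indep_feature
  have h2 := (iIndepFun_iff_map_fun_eq_pi_map he).1 h.indep_noise
  simp only [(h.law_feature _).map_eq] at h1
  simp only [(h.law_noise _).map_eq] at h2
  have h3 := (indepFun_iff_map_prod_eq_prod_map_map hz' he').1 h.indep
  rw [h1, h2] at h3
  refine ⟨aemeasurable_pi_lambda _ fun i => (hz i).prodMk (he i), ?_⟩
  have hmp := (measurePreserving_arrowProdEquivProdArrow (Feat p) ℝ (Fin n) (fun _ => μ)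
    (fun _ => M.lawE)).symm
  have hc : pairSample z e = (MeasurableEquiv.arrowProdEquivProdArrow (Feat p) ℝ (Fin n)).symm ∘
      fun ω => (fun i => z i ω, fun i => e i ω) := rfl
  rw [hc, ← AEMeasurable.map_map_of_aemeasurable hmp.measurable.aemeasurable (hz'.prodMk he'), h3]
  exact hmp.map_eq

end ERMModel

/-! ### Convergence in probability -/

/-- Convergence in probability to a constant. -/
def TendstoInProb {Ω : Type*} [MeasurableSpace Ω] (P : Measure Ω) (f : ℕ → Ω → ℝ) (c : ℝ) : Prop :=
  ∀ ε > 0, Tendsto (fun n => P.real {ω | ε ≤ |f n ω - c|}) atTop (𝓝 0)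

section Negligible

variable {Ω : Type*} [MeasurableSpace Ω] {P : Measure Ω} [IsProbabilityMeasure P]

theorem tendsto_measureReal_zero_iff {A : ℕ → Set Ω} :
    Tendsto (fun n => P.real (A n)) atTop (𝓝 0) ↔ Tendsto (fun n => P (A n)) atTop (𝓝 0) := by
  rw [← ENNReal.toReal_zero]
  exact ENNReal.tendsto_toReal_iff (fun n => measure_ne_top P _) ENNReal.zero_ne_top

theorem tendstoInMeasure_const_iff {f : ℕ → Ω → ℝ} {c : ℝ} :
    TendstoInMeasure P f atTop (fun _ => c) ↔ TendstoInProb P f c := by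
  rw [tendstoInMeasure_iff_norm]
  refine forall₂_congr fun ε _ => ?_
  rw [tendsto_measureReal_zero_iff]
  rfl

/-- Monotonicity and subadditivity hold for arbitrary sets. This matters because the minimizers are
not assumed measurable in `ω`. -/
theorem tendsto_measureReal_zero_of_union {A B C : ℕ → Set Ω}
    (hB : Tendsto (fun n => P.real (B n)) atTop (𝓝 0))
    (hC : Tendsto (fun n => P.real (C n)) atTop (𝓝 0))
    (h : ∀ᶠ n in atTop, ∀ᵐ ω ∂P, ω ∈ A n → ω ∈ B n ∨ ω ∈ C n) :
    Tendsto (fun n => P.real (A n)) atTop (𝓝 0) := by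
  have hBC := hB.add hC
  rw [add_zero] at hBC
  refine squeeze_zero' (Eventually.of_forall fun n => measureReal_nonneg) ?_ hBC
  filter_upwards [h] with n hn
  have h1 : P (A n) ≤ P (B n ∪ C n) := measure_mono_ae hn
  exact (ENNReal.toReal_mono (measure_ne_top P _) h1).trans (measureReal_union_le _ _)

theorem tendsto_measureReal_zero_of_subset {A B : ℕ → Set Ω}
    (hB : Tendsto (fun n => P.real (B n)) atTop (𝓝 0))
    (h : ∀ᶠ n in atTop, ∀ᵐ ω ∂P, ω ∈ A n → ω ∈ B n) :
    Tendsto (fun n => P.real (A n)) atTop (𝓝 0) :=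
  tendsto_measureReal_zero_of_union hB hB (h.mono fun _ hn => hn.mono fun _ hω hA => Or.inl (hω hA))

/-- If perturbed minima converge in probability to a differentiable function of the perturbation
parameter, the perturbing functional at the minimizers converges to the derivative. -/
theorem tendstoInProb_deriv_of_perturbation {f : ℝ → ℕ → Ω → ℝ} {t : ℕ → Ω → ℝ} {ρ : ℝ → ℝ}
    (hρ : DifferentiableAt ℝ ρ 0) (hf : ∀ᶠ s in 𝓝 (0 : ℝ), TendstoInProb P (f s) (ρ s))
    (hle : ∀ s n, ∀ᵐ ω ∂P, f s n ω ≤ f 0 n ω + s * t n ω) :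
    TendstoInProb P t (deriv ρ 0) := by
  intro ε hε
  set d := deriv ρ 0
  have hsl := hasDerivAt_iff_tendsto_slope_zero.1 hρ.hasDerivAt
  have hev : ∀ᶠ s in 𝓝[≠] (0 : ℝ), |s⁻¹ • (ρ (0 + s) - ρ 0) - d| < ε / 3 := by
    have := hsl.sub_const d |>.abs
    rw [sub_self, abs_zero] at this
    exact this.eventually (gt_mem_nhds (by positivity))
  have hev2 : ∀ᶠ s in 𝓝[>] (0 : ℝ), (|s⁻¹ • (ρ (0 + s) - ρ 0) - d| < ε / 3 ∧
      TendstoInProb P (f s) (ρ s)) ∧ (|(-s)⁻¹ • (ρ (0 + -s) - ρ 0) - d| < ε / 3 ∧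
      TendstoInProb P (f (-s)) (ρ (-s))) := by
    have h1 := hev.and (hf.filter_mono nhdsWithin_le_nhds)
    refine (h1.filter_mono (nhdsWithin_mono _ fun s (hs : 0 < s) => hs.ne')).and ?_
    have hneg : Tendsto (fun s : ℝ => -s) (𝓝[>] 0) (𝓝[≠] 0) := by
      refine tendsto_nhdsWithin_iff.2 ⟨?_, ?_⟩
      · have : Tendsto (fun s : ℝ => -s) (𝓝 0) (𝓝 (-0)) := tendsto_id.neg
        rw [neg_zero] at this
        exact this.mono_left nhdsWithin_le_nhds
      · filter_upwards [self_mem_nhdsWithin] with s (hs : 0 < s)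
        exact neg_ne_zero.2 hs.ne'
    exact hneg.eventually h1
  -- A single `s` works for both one-sided quotients.
  obtain ⟨s, ⟨⟨h1, hf1⟩, h2, hf2⟩, hs : 0 < s⟩ := (hev2.and self_mem_nhdsWithin).exists
  have hf0 := hf.self_of_nhds
  -- Two such errors, divided by `s`, give `ε / 3`; with the slope error `ε / 3` the total `2 * ε /
  -- 3` stays below `ε`.
  have hη : 0 < s * ε / 6 := by positivity
  refine tendsto_measureReal_zero_of_union (hf0 _ hη)
    (C := fun n => {ω | s * ε / 6 ≤ |f s n ω - ρ s|} ∪ {ω | s * ε / 6 ≤ |f (-s) n ω - ρ (-s)|}) ?_ ?_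
  · exact tendsto_measureReal_zero_of_union (hf1 _ hη) (hf2 _ hη)
      (Eventually.of_forall fun n => ae_of_all _ fun ω h => h)
  refine Eventually.of_forall fun n => ?_
  filter_upwards [hle s n, hle (-s) n] with ω hle1 hle2 hω
  by_contra! hcon
  simp only [Set.mem_union, Set.mem_ofPred_eq, not_or, not_le] at hcon hω
  obtain ⟨g0, g1, g2⟩ := hcon
  rw [zero_add, smul_eq_mul, abs_lt] at h1 h2
  rw [abs_lt] at g0 g1 g2
  have e1 : s * (s⁻¹ * (ρ s - ρ 0)) = ρ s - ρ 0 := by field_simp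
  have e2 : s * ((-s)⁻¹ * (ρ (-s) - ρ 0)) = -(ρ (-s) - ρ 0) := by
    rw [inv_neg, neg_mul, mul_neg]; congr 1; field_simp
  have i1 := mul_lt_mul_of_pos_left h1.1 hs
  have i2 := mul_lt_mul_of_pos_left h2.2 hs
  rw [mul_sub, e1] at i1
  rw [mul_sub, e2] at i2
  -- The perturbation `s` bounds `t` from below and the perturbation `-s` bounds it from above.
  have j1 : s * d - s * (2 * ε / 3) < s * t n ω := by nlinarith
  have j2 : s * t n ω < s * d + s * (2 * ε / 3) := by nlinarith
  rcases le_abs.1 hω with h | h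
  · have := mul_le_mul_of_nonneg_left h hs.le
    nlinarith
  · have := mul_le_mul_of_nonneg_left h hs.le
    nlinarith

end Negligible

/-! ### Transfer from Gaussian to general features -/

namespace ERMModel

variable {k kstar : ℕ} {M : ERMModel k kstar} {R : ℝ} {K : ℝ≥0} {Kr : ℝ → ℝ≥0}
  {p : ℕ → ℕ} {γ : ℝ} {Ω : Type*} [MeasurableSpace Ω] {P : Measure Ω} [IsProbabilityMeasure P]
  {x g z : (n : ℕ) → Fin n → Ω → Feat (p n)} {e : (n : ℕ) → Fin n → Ω → ℝ}

theorem IsERM.empRisk_eq {q n : ℕ} {x : Fin n → Feat q} {e : Fin n → ℝ} {Θ : Param q k}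
    (h : M.IsERM x e Θ) : M.empRisk x e Θ = M.minRisk x e := by
  have hl : IsLeast (M.empRisk x e '' M.feasible q) (M.empRisk x e Θ) := by
    refine ⟨⟨Θ, h.1, rfl⟩, ?_⟩
    rintro _ ⟨Θ', hΘ', rfl⟩
    exact h.2 hΘ'
  exact hl.csInf_eq.symm

theorem minPerturbedRisk_eq_infRisk {Ω' : Type*} {q n : ℕ} (s : ℝ) (z : Fin n → Ω' → Feat q)
    (e : Fin n → Ω' → ℝ) (ω : Ω') :
    M.minPerturbedRisk s (fun i => z i ω) (fun i => e i ω) =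
      M.infRisk (fun Θ => M.r q Θ + s * M.testErrorG Θ) (M.feasible q) (pairSample z e ω) := by
  unfold minPerturbedRisk infRisk
  congr 1
  refine Set.image_congr fun Θ _ => ?_
  exact add_assoc _ _ _

namespace Assumptions

/-- The events are phrased by existence of a parameter rather than by an infimum because `T n` may
be empty, as the set of parameters with a wrong test error can be. -/
theorem tendsto_lower (hM : M.Assumptions R K Kr) (hγ : 0 < γ)
    (hp : Tendsto (fun n : ℕ => (p n : ℝ) / (n : ℝ)) atTop (𝓝 γ))
    (hx : ∀ n, IsSample P (M.lawX (p n)) M.lawE (x n) (e n))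
    (hg : ∀ n, IsSample P (M.lawG (p n)) M.lawE (g n) (e n)) {L : ℝ} (hL : 0 ≤ L)
    {T : ∀ n, Set (Param (p n) k)} (hT : ∀ n, T n ⊆ M.paramSet (p n))
    {q : ∀ n, Param (p n) k → ℝ} (hq : ∀ n, M.GaugeLipschitz L (q n) (T n)) {a δ : ℝ}
    (hδ : 0 < δ) (h : Tendsto (fun n => P.real {ω | ∃ Θ ∈ T n,
      M.penalizedRisk (q n) (pairSample (g n) (e n) ω) Θ < a}) atTop (𝓝 0)) :
    Tendsto (fun n => P.real {ω | ∃ Θ ∈ T n,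
      M.penalizedRisk (q n) (pairSample (x n) (e n) ω) Θ < a - δ}) atTop (𝓝 0) := by
  have := hM.lawX_prob
  have := hM.lawE_prob
  rw [Metric.tendsto_atTop] at h ⊢
  intro ε hε
  obtain ⟨n₁, hn₁⟩ := h (ε / 2) (by positivity)
  obtain ⟨n₂, hn₂⟩ := eventually_atTop.1
    (hM.eventually_lower hγ hp hL (by positivity : 0 < ε / 4) hδ a)
  refine ⟨max n₁ n₂, fun n hn => ?_⟩
  have hG := hn₁ n ((le_max_left _ _).trans hn)
  rw [Real.dist_0_eq_abs, abs_of_nonneg measureReal_nonneg] at hG ⊢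
  rcases (T n).eq_empty_or_nonempty with he | hne
  · simp [he, hε]
  have hkey : ∀ (μ : Measure (Feat (p n))) [IsProbabilityMeasure μ]
      (z : Fin n → Ω → Feat (p n)), IsSample P μ M.lawE z (e n) → ∀ b : ℝ,
      P.real {ω | ∃ Θ ∈ T n, M.penalizedRisk (q n) (pairSample z (e n) ω) Θ < b} =
        (sampleLaw M μ n).real {z | M.infRisk (q n) (T n) z < b} := by
    intro μ _ z hz b
    have hm : Measurable (M.infRisk (q n) (T n) : (Fin n → Feat (p n) × ℝ) → ℝ) :=
      hM.measurable_infRisk hne (hT n) (hq n)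
    have hl := (hz.hasLaw M).measure_eq (p := fun z => M.infRisk (q n) (T n) z < b)
      (measurableSet_lt hm measurable_const)
    rw [Measure.real, Measure.real, ← hl]
    congr 2
    ext ω
    simp only [Set.mem_ofPred_eq]
    rw [infRisk, csInf_lt_iff (hM.bddBelow_penalizedRisk (hT n) (hq n) _) (hne.image _)]
    simp
  have hX := hn₂ n ((le_max_right _ _).trans hn) (T n) hne (hT n) (q n) (hq n)
  rw [hkey _ _ (hx n)]
  rw [hkey _ _ (hg n)] at hG
  linarith

theorem tendsto_upper (hM : M.Assumptions R K Kr) (hγ : 0 < γ)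
    (hp : Tendsto (fun n : ℕ => (p n : ℝ) / (n : ℝ)) atTop (𝓝 γ))
    (hx : ∀ n, IsSample P (M.lawX (p n)) M.lawE (x n) (e n))
    (hg : ∀ n, IsSample P (M.lawG (p n)) M.lawE (g n) (e n)) {L : ℝ} (hL : 0 ≤ L)
    {T : ∀ n, Set (Param (p n) k)} (hne : ∀ n, (T n).Nonempty)
    (hT : ∀ n, T n ⊆ M.paramSet (p n))
    {q : ∀ n, Param (p n) k → ℝ} (hq : ∀ n, M.GaugeLipschitz L (q n) (T n)) {a δ : ℝ}
    (hδ : 0 < δ) (h : Tendsto (fun n => P.real {ω |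
      a < M.infRisk (q n) (T n) (pairSample (g n) (e n) ω)}) atTop (𝓝 0)) :
    Tendsto (fun n => P.real {ω |
      a + δ < M.infRisk (q n) (T n) (pairSample (x n) (e n) ω)}) atTop (𝓝 0) := by
  have := hM.lawX_prob
  have := hM.lawE_prob
  rw [Metric.tendsto_atTop] at h ⊢
  intro ε hε
  obtain ⟨n₁, hn₁⟩ := h (ε / 2) (by positivity)
  obtain ⟨n₂, hn₂⟩ := eventually_atTop.1
    (hM.eventually_upper hγ hp hL (by positivity : 0 < ε / 4) hδ a)
  refine ⟨max n₁ n₂, fun n hn => ?_⟩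
  have hG := hn₁ n ((le_max_left _ _).trans hn)
  rw [Real.dist_0_eq_abs, abs_of_nonneg measureReal_nonneg] at hG ⊢
  have hm : Measurable (M.infRisk (q n) (T n) : (Fin n → Feat (p n) × ℝ) → ℝ) :=
    hM.measurable_infRisk (hne n) (hT n) (hq n)
  have hX := hn₂ n ((le_max_right _ _).trans hn) (T n) (hne n) (hT n) (q n) (hq n)
  have hlX := ((hx n).hasLaw M).measure_eq (p := fun z => a + δ < M.infRisk (q n) (T n) z)
    (measurableSet_lt measurable_const hm)
  have hlG := ((hg n).hasLaw M).measure_eq (p := fun z => a < M.infRisk (q n) (T n) z)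
    (measurableSet_lt measurable_const hm)
  rw [Measure.real, hlX]
  rw [Measure.real, hlG] at hG
  simp only [Measure.real] at hX
  linarith

/-- Universality of the limit in probability of the minimum of the penalized risk. -/
theorem tendstoInProb_infRisk (hM : M.Assumptions R K Kr) (hγ : 0 < γ)
    (hp : Tendsto (fun n : ℕ => (p n : ℝ) / (n : ℝ)) atTop (𝓝 γ))
    (hx : ∀ n, IsSample P (M.lawX (p n)) M.lawE (x n) (e n))
    (hg : ∀ n, IsSample P (M.lawG (p n)) M.lawE (g n) (e n)) {L : ℝ} (hL : 0 ≤ L)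
    {T : ∀ n, Set (Param (p n) k)} (hne : ∀ n, (T n).Nonempty)
    (hT : ∀ n, T n ⊆ M.paramSet (p n))
    {q : ∀ n, Param (p n) k → ℝ} (hq : ∀ n, M.GaugeLipschitz L (q n) (T n)) {c : ℝ}
    (h : TendstoInProb P (fun n ω => M.infRisk (q n) (T n) (pairSample (g n) (e n) ω)) c) :
    TendstoInProb P (fun n ω => M.infRisk (q n) (T n) (pairSample (x n) (e n) ω)) c := by
  intro ε hε
  have hlt : ∀ n (y : Fin n → Feat (p n) × ℝ) (b : ℝ), (∃ Θ ∈ T n, M.penalizedRisk (q n) y Θ < b) ↔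
      M.infRisk (q n) (T n) y < b := by
    intro n y b
    rw [infRisk, csInf_lt_iff (hM.bddBelow_penalizedRisk (hT n) (hq n) _) ((hne n).image _)]
    simp
  have h4 := h (ε / 4) (by positivity)
  have hlow := hM.tendsto_lower hγ hp hx hg hL hT hq (a := c - ε / 4) (δ := ε / 4) (by positivity)
    (tendsto_measureReal_zero_of_subset h4 (Eventually.of_forall fun n => ae_of_all _ fun ω hω => by
      rw [Set.mem_ofPred_eq, hlt] at hω
      rw [Set.mem_ofPred_eq, le_abs]
      right; linarith))
  have hup := hM.tendsto_upper hγ hp hx hg hL hne hT hq (a := c + ε / 4) (δ := ε / 4)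
    (by positivity)
    (tendsto_measureReal_zero_of_subset h4 (Eventually.of_forall fun n => ae_of_all _ fun ω hω => by
      rw [Set.mem_ofPred_eq] at hω
      rw [Set.mem_ofPred_eq, le_abs]
      left; linarith))
  refine tendsto_measureReal_zero_of_union hlow hup
    (Eventually.of_forall fun n => ae_of_all _ fun ω hω => ?_)
  rw [Set.mem_ofPred_eq, Set.mem_ofPred_eq, hlt]
  rw [Set.mem_ofPred_eq, le_abs] at hω
  rcases hω with hω | hω
  · right; linarith
  · left; linarith

end Assumptions

/-- Parameters whose Gaussian test error is far from `τ` have, with high probability, an empirical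
risk that exceeds the limit `ρ` of the minimum empirical risk. -/
def WellSeparated (M : ERMModel k kstar) (P : Measure Ω) (z : (n : ℕ) → Fin n → Ω → Feat (p n))
    (e : (n : ℕ) → Fin n → Ω → ℝ) (ρ τ : ℝ) : Prop :=
  TendstoInProb P (fun n ω => M.minRisk (fun i => z n i ω) (fun i => e n i ω)) ρ ∧
  ∀ α > 0, ∃ η > 0, Tendsto (fun n => P.real {ω | ∃ Θ ∈ {Θ ∈ M.feasible (p n) |
    α ≤ |M.testErrorG Θ - τ|}, M.empRisk (fun i => z n i ω) (fun i => e n i ω) Θ < ρ + η})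
    atTop (𝓝 0)

theorem WellSeparated.tendstoInProb {ρ τ : ℝ} (h : WellSeparated M P z e ρ τ)
    {Θ : (n : ℕ) → Ω → Param (p n) k}
    (hΘ : ∀ n, ∀ᵐ ω ∂P, M.IsERM (fun i => z n i ω) (fun i => e n i ω) (Θ n ω)) :
    TendstoInProb P (fun n ω => M.testErrorG (Θ n ω)) τ := by
  intro α hα
  obtain ⟨η, hη, hsep⟩ := h.2 α hα
  refine tendsto_measureReal_zero_of_union hsep (h.1 η hη) (Eventually.of_forall fun n => ?_)
  filter_upwards [hΘ n] with ω hω hbad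
  by_contra! hcon
  have h1 := hcon.1 (Θ n ω) ⟨hω.1, hbad⟩
  rw [hω.empRisk_eq] at h1
  linarith [(abs_lt.1 hcon.2).2]

/-- The constraint involves the deterministic function `R^g`, so the same set of parameters is used
for both samples, and the claim is about a minimum over that set. -/
theorem Assumptions.wellSeparated_transfer (hM : M.Assumptions R K Kr) (hγ : 0 < γ)
    (hp : Tendsto (fun n : ℕ => (p n : ℝ) / (n : ℝ)) atTop (𝓝 γ))
    (hx : ∀ n, IsSample P (M.lawX (p n)) M.lawE (x n) (e n))
    (hg : ∀ n, IsSample P (M.lawG (p n)) M.lawE (g n) (e n)) {ρ τ : ℝ}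
    (h : WellSeparated M P g e ρ τ) : WellSeparated M P x e ρ τ := by
  obtain ⟨L, hL, hr⟩ := hM.exists_gaugeLipschitz_r
  refine ⟨hM.tendstoInProb_infRisk hγ hp hx hg hL (T := fun n => M.feasible (p n))
    (q := fun n => M.r (p n))
    (fun n => hM.feasible_nonempty _) (fun n => hM.feasible_subset _)
    (fun n => (hr _).mono (hM.feasible_subset _)) h.1, fun α hα => ?_⟩
  obtain ⟨η, hη, hsep⟩ := h.2 α hα
  have hsub : ∀ n, {Θ ∈ M.feasible (p n) | α ≤ |M.testErrorG Θ - τ|} ⊆ M.paramSet (p n) :=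
    fun n => (Set.sep_subset _ _).trans (hM.feasible_subset _)
  have := hM.tendsto_lower hγ hp hx hg hL hsub (q := fun n => M.r (p n))
    (fun n => (hr _).mono (hsub n)) (a := ρ + η) (δ := η / 2) (by positivity) hsep
  refine ⟨η / 2, by positivity, ?_⟩
  rwa [show ρ + η - η / 2 = ρ + η / 2 by ring] at this

theorem empRisk_midpoint_le {q n : ℕ} (hconv : ∀ y : ℝ, ConvexOn ℝ Set.univ fun u => M.lossAt u y)
    {m : ℝ} (hr : StrongConvexOn Set.univ m (M.r q)) (x : Fin n → Feat q) (e : Fin n → ℝ)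
    (Θ Θ' : Param q k) :
    M.empRisk x e ((1 / 2 : ℝ) • Θ + (1 / 2 : ℝ) • Θ') ≤
      1 / 2 * M.empRisk x e Θ + 1 / 2 * M.empRisk x e Θ' - m / 8 * ‖Θ - Θ'‖ ^ 2 := by
  obtain ⟨-, h0⟩ := hr
  have h1 := h0 (Set.mem_univ Θ) (Set.mem_univ Θ') (a := 1 / 2) (b := 1 / 2) (by norm_num)
    (by norm_num) (by norm_num)
  simp only [smul_eq_mul] at h1
  have h2 : ∀ i, M.lossAt (project ((1 / 2 : ℝ) • Θ + (1 / 2 : ℝ) • Θ') (x i))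
      (M.response (x i) (e i)) ≤ 1 / 2 * M.lossAt (project Θ (x i)) (M.response (x i) (e i)) +
        1 / 2 * M.lossAt (project Θ' (x i)) (M.response (x i) (e i)) := by
    intro i
    obtain ⟨-, hc⟩ := hconv (M.response (x i) (e i))
    have h3 := hc (Set.mem_univ (project Θ (x i)))
      (Set.mem_univ (project Θ' (x i))) (a := 1 / 2) (b := 1 / 2) (by norm_num)
      (by norm_num) (by norm_num)
    have h4 : project ((1 / 2 : ℝ) • Θ + (1 / 2 : ℝ) • Θ') (x i) =
        (1 / 2 : ℝ) • project Θ (x i) + (1 / 2 : ℝ) • project Θ' (x i) := by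
      ext j
      simp [project, inner_add_left, real_inner_smul_left]
    rw [h4]
    simpa only [smul_eq_mul] using h3
  have h5 := mul_le_mul_of_nonneg_left (Finset.sum_le_sum fun i (_ : i ∈ Finset.univ) => h2 i)
    (by positivity : 0 ≤ 1 / (n : ℝ))
  rw [Finset.sum_add_distrib, ← Finset.mul_sum, ← Finset.mul_sum] at h5
  unfold empRisk
  linarith

/-- A parameter whose test error is far from `τ` is far from the minimizer in Frobenius norm. Their
midpoint is feasible and its risk is at least the minimum, so strong convexity forces a large risk.
-/
theorem Assumptions.wellSeparated_of_condA (hM : M.Assumptions R K Kr)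
    {Θ : (n : ℕ) → Ω → Param (p n) k}
    (hΘ : ∀ n, ∀ᵐ ω ∂P, M.IsERM (fun i => g n i ω) (fun i => e n i ω) (Θ n ω))
    (h : M.CondA K P g e Θ) : ∃ ρ τ, WellSeparated M P g e ρ τ := by
  obtain ⟨hconv, ⟨m, hm, hr⟩, hC, hS, ρ, τ, hρ, hτ⟩ := h
  rw [tendstoInMeasure_const_iff] at hρ hτ
  refine ⟨ρ, τ, hρ, fun α hα => ?_⟩
  set B : ℝ := K * (k * (6 * K)) + 1 with hB
  have hBpos : 0 < B := by positivity
  -- The midpoint inequality gives a gap of `2 * η` over the minimum; one `η` pays for replacing the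
  -- minimum by `ρ`.
  set η : ℝ := m / 8 * (α / (2 * B)) ^ 2 with hη
  have hηpos : 0 < η := by positivity
  refine ⟨η, hηpos, tendsto_measureReal_zero_of_union (hτ (α / 2) (by positivity)) (hρ η hηpos)
    (Eventually.of_forall fun n => ?_)⟩
  filter_upwards [hΘ n] with ω hω hbad
  by_contra! hcon
  obtain ⟨Θ', ⟨hf, hα'⟩, hlt⟩ := hbad
  obtain ⟨h1, h2⟩ := hcon
  have h3 := hM.abs_testErrorG_sub_le_norm (hS (p n)) (hM.feasible_subset _ hf)
    (hM.feasible_subset _ hω.1)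
  have h4 := abs_sub_le (M.testErrorG Θ') (M.testErrorG (Θ n ω)) τ
  have h5 : α / (2 * B) ≤ ‖Θ' - Θ n ω‖ := by
    rw [div_le_iff₀ (by positivity)]
    nlinarith [norm_nonneg (Θ' - Θ n ω)]
  have h6 := empRisk_midpoint_le hconv (hr (p n)) (fun i => g n i ω) (fun i => e n i ω) Θ' (Θ n ω)
  have hmem : (1 / 2 : ℝ) • Θ' + (1 / 2 : ℝ) • Θ n ω ∈ M.feasible (p n) := fun j =>
    hC (p n) (hf j) (hω.1 j) (by norm_num) (by norm_num) (by norm_num)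
  have h7 := hω.2 hmem
  simp only [Set.mem_ofPred_eq] at h7
  have h8 : m / 8 * (α / (2 * B)) ^ 2 ≤ m / 8 * ‖Θ' - Θ n ω‖ ^ 2 := by gcongr
  have h9 := hω.empRisk_eq
  have h10 := (abs_lt.1 h2).1
  rw [← hη] at h8
  linarith

theorem Assumptions.wellSeparated_of_condB (hM : M.Assumptions R K Kr)
    (hg : ∀ n, IsSample P (M.lawG (p n)) M.lawE (g n) (e n))
    (h : M.CondB P g e) : ∃ ρ τ, WellSeparated M P g e ρ τ := by
  have := hM.lawE_prob
  obtain ⟨ρ, τ, hρ, hsep⟩ := h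
  obtain ⟨L, hL, hr⟩ := hM.exists_gaugeLipschitz_r
  rw [tendstoInMeasure_const_iff] at hρ
  refine ⟨ρ, τ, hρ, fun α hα => ?_⟩
  obtain ⟨δ, hδ, hev⟩ := hsep α hα
  set A : ℕ → Set Ω := fun n => {ω | ∀ Θ ∈ M.feasible (p n), α ≤ |M.testErrorG Θ - τ| →
    δ ≤ |M.empRisk (fun i => g n i ω) (fun i => e n i ω) Θ
      - M.minRisk (fun i => g n i ω) (fun i => e n i ω)|} with hA
  have hrf := fun n => (hr (p n)).mono (hM.feasible_subset (p n))
  have hbdd := fun n (y : Fin n → Feat (p n) × ℝ) =>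
    hM.bddBelow_penalizedRisk (hM.feasible_subset _) (hrf n) y
  have hge : ∀ n ω, ∀ Θ ∈ M.feasible (p n), M.minRisk (fun i => g n i ω) (fun i => e n i ω) ≤
      M.empRisk (fun i => g n i ω) (fun i => e n i ω) Θ := fun n ω Θ hΘ =>
    csInf_le (hbdd n (pairSample (g n) (e n) ω)) ⟨Θ, hΘ, rfl⟩
  -- Passing from `P (A n) → 1` to small complements needs measurability. It comes from the sample
  -- space, where `A n` compares two measurable infima.
  have hnull : ∀ n, NullMeasurableSet (A n) P := by
    intro n
    set T := {Θ ∈ M.feasible (p n) | α ≤ |M.testErrorG Θ - τ|} with hTdef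
    have hTf : T ⊆ M.feasible (p n) := Set.sep_subset _ _
    rcases T.eq_empty_or_nonempty with he | hne
    · have : A n = Set.univ := by
        refine Set.eq_univ_of_forall fun ω Θ hΘ hα' => ?_
        have : Θ ∈ T := ⟨hΘ, hα'⟩
        rw [he] at this
        exact absurd this (Set.notMem_empty _)
      rw [this]; exact MeasurableSet.univ.nullMeasurableSet
    · have hm1 : Measurable (M.infRisk (M.r (p n)) T : (Fin n → Feat (p n) × ℝ) → ℝ) :=
        hM.measurable_infRisk hne (hTf.trans (hM.feasible_subset _)) ((hrf n).mono hTf)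
      have hm2 : Measurable
          (M.infRisk (M.r (p n)) (M.feasible (p n)) : (Fin n → Feat (p n) × ℝ) → ℝ) :=
        hM.measurable_infRisk (hM.feasible_nonempty _) (hM.feasible_subset _) (hrf n)
      have hpre : A n = pairSample (g n) (e n) ⁻¹' {y | M.infRisk (M.r (p n)) (M.feasible (p n)) y +
          δ ≤ M.infRisk (M.r (p n)) T y} := by
        ext ω
        have hb := (hbdd n (pairSample (g n) (e n) ω)).mono (Set.image_mono hTf)
        simp only [hA, Set.mem_ofPred_eq, Set.mem_preimage]
        rw [infRisk, infRisk, le_csInf_iff hb (hne.image _)]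
        constructor
        · rintro h _ ⟨Θ, hΘ, rfl⟩
          have h1 := h Θ hΘ.1 hΘ.2
          rw [abs_of_nonneg (sub_nonneg.2 (hge n ω Θ hΘ.1))] at h1
          have h2 := le_sub_iff_add_le'.1 h1
          exact h2
        · intro h Θ hΘ hα'
          rw [abs_of_nonneg (sub_nonneg.2 (hge n ω Θ hΘ))]
          exact le_sub_iff_add_le'.2 (h _ ⟨Θ, ⟨hΘ, hα'⟩, rfl⟩)
      rw [hpre]
      exact ((hg n).hasLaw M).aemeasurable.nullMeasurableSet_preimage
        (measurableSet_le (hm2.add_const δ) hm1)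
  have hcompl : Tendsto (fun n => P.real (A n)ᶜ) atTop (𝓝 0) := by
    rw [tendsto_measureReal_zero_iff]
    have h1 : ∀ n, P (A n)ᶜ = 1 - P (A n) := fun n => prob_compl_eq_one_sub₀ (hnull n)
    simp only [h1]
    have := ENNReal.Tendsto.sub (tendsto_const_nhds (x := (1 : ℝ≥0∞)) (f := atTop)) hev
      (Or.inl ENNReal.one_ne_top)
    rwa [tsub_self] at this
  refine ⟨δ / 2, by positivity, tendsto_measureReal_zero_of_union hcompl (hρ (δ / 2)
    (by positivity)) (Eventually.of_forall fun n => ae_of_all _ fun ω hbad => ?_)⟩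
  by_contra! hcon
  simp only [Set.mem_compl_iff, not_not, Set.mem_ofPred_eq, not_le] at hcon hbad
  obtain ⟨Θ, ⟨hf, hα'⟩, hlt⟩ := hbad
  have h1 := hcon.1 Θ hf hα'
  rw [abs_of_nonneg (sub_nonneg.2 (hge n ω Θ hf))] at h1
  linarith [(abs_lt.1 hcon.2).1]

/-- The minimizer of the unperturbed risk competes in each perturbed problem. The sample `z` is
generic, so this serves both `X` and `G`. -/
theorem Assumptions.tendstoInProb_of_perturbed (hM : M.Assumptions R K Kr) {ρ : ℝ → ℝ}
    (hρ : DifferentiableAt ℝ ρ 0) (h : ∀ᶠ s in 𝓝 (0 : ℝ), TendstoInProb P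
      (fun n ω => M.minPerturbedRisk s (fun i => z n i ω) (fun i => e n i ω)) (ρ s))
    {Θ : (n : ℕ) → Ω → Param (p n) k}
    (hΘ : ∀ n, ∀ᵐ ω ∂P, M.IsERM (fun i => z n i ω) (fun i => e n i ω) (Θ n ω)) :
    TendstoInProb P (fun n ω => M.testErrorG (Θ n ω)) (deriv ρ 0) := by
  obtain ⟨L, hL, hr⟩ := hM.exists_gaugeLipschitz_r
  refine tendstoInProb_deriv_of_perturbation hρ h fun s n => ?_
  filter_upwards [hΘ n] with ω hω
  have h0 : M.minPerturbedRisk 0 (fun i => z n i ω) (fun i => e n i ω) =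
      M.minRisk (fun i => z n i ω) (fun i => e n i ω) := by
    simp [minPerturbedRisk, minRisk]
  rw [h0, ← hω.empRisk_eq, minPerturbedRisk_eq_infRisk, empRisk, add_assoc]
  exact csInf_le (hM.bddBelow_penalizedRisk (hM.feasible_subset _)
    (((hr (p n)).add_mul (hM.gaugeLipschitz_testErrorG _) s).mono (hM.feasible_subset _)) _)
    ⟨_, hω.1, rfl⟩

theorem Assumptions.perturbed_transfer (hM : M.Assumptions R K Kr) (hγ : 0 < γ)
    (hp : Tendsto (fun n : ℕ => (p n : ℝ) / (n : ℝ)) atTop (𝓝 γ))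
    (hx : ∀ n, IsSample P (M.lawX (p n)) M.lawE (x n) (e n))
    (hg : ∀ n, IsSample P (M.lawG (p n)) M.lawE (g n) (e n)) {s c : ℝ}
    (h : TendstoInProb P
      (fun n ω => M.minPerturbedRisk s (fun i => g n i ω) (fun i => e n i ω)) c) :
    TendstoInProb P
      (fun n ω => M.minPerturbedRisk s (fun i => x n i ω) (fun i => e n i ω)) c := by
  obtain ⟨L, hL, hr⟩ := hM.exists_gaugeLipschitz_r
  have hrate := hM.rate_pos
  simp only [minPerturbedRisk_eq_infRisk] at h ⊢
  exact hM.tendstoInProb_infRisk hγ hp hx hg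
    (L := L + |s| * (K * (k * (6 / hM.rate)))) (by positivity)
    (T := fun n => M.feasible (p n)) (fun n => hM.feasible_nonempty _)
    (fun n => hM.feasible_subset _)
    (fun n => ((hr (p n)).add_mul (hM.gaugeLipschitz_testErrorG _) s).mono (hM.feasible_subset _)) h

/-- Under each of the three conditions the Gaussian test errors of the minimizers for the two
feature distributions have the same limit. -/
theorem Assumptions.exists_common_limit (hM : M.Assumptions R K Kr) (hγ : 0 < γ)
    (hp : Tendsto (fun n : ℕ => (p n : ℝ) / (n : ℝ)) atTop (𝓝 γ))
    (hx : ∀ n, IsSample P (M.lawX (p n)) M.lawE (x n) (e n))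
    (hg : ∀ n, IsSample P (M.lawG (p n)) M.lawE (g n) (e n))
    {ΘX ΘG : (n : ℕ) → Ω → Param (p n) k}
    (hΘX : ∀ n, ∀ᵐ ω ∂P, M.IsERM (fun i => x n i ω) (fun i => e n i ω) (ΘX n ω))
    (hΘG : ∀ n, ∀ᵐ ω ∂P, M.IsERM (fun i => g n i ω) (fun i => e n i ω) (ΘG n ω))
    (hcond : M.CondA K P g e ΘG ∨ M.CondB P g e ∨ M.CondC P g e) :
    ∃ τ, TendstoInProb P (fun n ω => M.testErrorG (ΘX n ω)) τ ∧
      TendstoInProb P (fun n ω => M.testErrorG (ΘG n ω)) τ := by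
  have hsep : (∃ ρ τ, WellSeparated M P g e ρ τ) →
      ∃ τ, TendstoInProb P (fun n ω => M.testErrorG (ΘX n ω)) τ ∧
        TendstoInProb P (fun n ω => M.testErrorG (ΘG n ω)) τ := by
    rintro ⟨ρ, τ, h⟩
    exact ⟨τ, (hM.wellSeparated_transfer hγ hp hx hg h).tendstoInProb hΘX, h.tendstoInProb hΘG⟩
  rcases hcond with h | h | ⟨ρ, hρ, h⟩
  · exact hsep (hM.wellSeparated_of_condA hΘG h)
  · exact hsep (hM.wellSeparated_of_condB hg h)
  · simp only [tendstoInMeasure_const_iff] at h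
    exact ⟨deriv ρ 0, hM.tendstoInProb_of_perturbed hρ
      (h.mono fun s hs => hM.perturbed_transfer hγ hp hx hg hs) hΘX,
      hM.tendstoInProb_of_perturbed hρ h hΘG⟩

end ERMModel

theorem theorem3 {k kstar : ℕ} (M : ERMModel k kstar)
    {R : ℝ} {K : ℝ≥0} {Kr : ℝ → ℝ≥0} (hM : M.Assumptions R K Kr)
    {p : ℕ → ℕ} {γ : ℝ} (hγ : 0 < γ)
    (hp : Tendsto (fun n : ℕ => (p n : ℝ) / (n : ℝ)) atTop (𝓝 γ))
    {Ω : Type*} [MeasurableSpace Ω] (P : Measure Ω) [IsProbabilityMeasure P]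
    (x g : (n : ℕ) → Fin n → Ω → Feat (p n)) (e : (n : ℕ) → Fin n → Ω → ℝ)
    (hx : ∀ n, IsSample P (M.lawX (p n)) M.lawE (x n) (e n))
    (hg : ∀ n, IsSample P (M.lawG (p n)) M.lawE (g n) (e n))
    (ΘX ΘG : (n : ℕ) → Ω → Param (p n) k)
    (hΘX : ∀ n, ∀ᵐ ω ∂P, M.IsERM (fun i => x n i ω) (fun i => e n i ω) (ΘX n ω))
    (hΘG : ∀ n, ∀ᵐ ω ∂P, M.IsERM (fun i => g n i ω) (fun i => e n i ω) (ΘG n ω))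
    (hcond : M.CondA K P g e ΘG ∨ M.CondB P g e ∨ M.CondC P g e) :
    TendstoInMeasure P (fun n ω => |M.testErrorX (ΘX n ω) - M.testErrorG (ΘG n ω)|)
      atTop (fun _ => 0) := by
  obtain ⟨τ, hX, hG⟩ := hM.exists_common_limit hγ hp hx hg hΘX hΘG hcond
  rw [tendstoInMeasure_const_iff]
  intro ε hε
  -- Uniformity over parameters is essential here, since `ΘX` depends on the data.
  obtain ⟨p₀, hp₀⟩ := hM.exists_testError_close (ε := ε / 4) (by positivity)
  refine tendsto_measureReal_zero_of_union (hX (ε / 4) (by positivity))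
    (hG (ε / 4) (by positivity)) ?_
  filter_upwards [(tendsto_dimension_atTop hγ hp).eventually_ge_atTop p₀] with n hn
  filter_upwards [hΘX n] with ω hω hbad
  by_contra! hcon
  simp only [sub_zero, abs_abs] at hcon hbad
  have h1 := hp₀ (p n) hn (ΘX n ω) (hM.feasible_subset _ hω.1)
  have h2 := abs_lt.1 hcon.1
  have h3 := abs_lt.1 hcon.2
  have h4 := abs_le.1 h1
  rcases le_abs.1 hbad with h | h <;> linarith [h2.1, h2.2, h3.1, h3.2, h4.1, h4.2]
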